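/- **Setting.** Let $\Phi:\{0,1\}^n\to\mathbb R^{2^N}$ be a feature map on data points encoded as $n$-bit strings, and let $U_\Phi$ be a unitary on $n+N$ qubits with $U_\Phi|x\rangle|0\rangle=|x\rangle|\Phi(x)\rangle$, where $|\Phi(x)\rangle=\|\Phi(x)\|^{-1}\sum_j\Phi(x)_j|j\rangle$. One application of $U_\Phi$ or $U_\Phi^{-1}$ takes time $T_\Phi\ge\max(1,n+N)$. Let $(x_1,y_1),\dots,(x_m,y_m)$ with $y_i=\pm1$ be a training set, $R=\max_i\|\Phi(x_i)\|$ and, for $c\in\{0,1\}^m$, $$\Psi_c=\frac1m\sum_i c_iy_i\Phi(x_i),\qquad \eta_c=\Big(\frac1m\sum_i c_i\|\Phi(x_i)\|^2\Big)^{1/2}.$$ **Training.** Let $C>0$, $\epsilon_0>0$, $t_{\max}\ge1$, and let $\hat\alpha$ be the output of any run of the following algorithm. Start with $W_1=\{c^{(0)}\}$ for some $c^{(0)}\in\{0,1\}^m$. In iteration $t$: 1. obtain estimates $\tilde J_{cc'}$ of $\langle\Psi_c,\Psi_{c'}\rangle$ for $c,c'\in W_t$, and let $\hat J$ be the Frobenius-norm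 projection of $\tilde J$ to the positive semidefinite cone; 2. let $\hat\alpha^{(t)}$ maximize $-\frac12\sum_{c,c'\in W_t}\alpha_c\alpha_{c'}\hat J_{cc'}+\sum_{c\in W_t}\frac{\|c\|_1}m\alpha_c$ over $\alpha\ge0$ with $\sum_{c\in W_t}\alpha_c\le C$; 3. put $\hat\xi^{(t)}=\max_{c\in W_t}\max\{\frac{\|c\|_1}m-\sum_{c'\in W_t}\hat\alpha^{(t)}_{c'}\hat J_{cc'},0\}+\frac1{t_{\max}}$; 4. obtain estimates $\zeta_i$ of $\langle\sum_{c\in W_t}\hat\alpha_c^{(t)}\Psi_c,y_i\Phi(x_i)\rangle$ for $i=1,\dots,m$; 5. stop with output $\hat\alpha=\hat\alpha^{(t)}$ if $\frac1m\sum_i\max\{0,1-\zeta_i\}\le\hat\xi^{(t)}+2\epsilon_0$ or $t+1>t_{\max}$. Otherwise $W_{t+1}=W_t\cup\{c^{(t+1)}\}$, where $c^{(t+1)}_i=1$ if $\zeta_i<1$ and $c^{(t+1)}_i=0$ otherwise. No assumption is made on how accurate the estimates are. Let $W$ be the working set in the last iteration, and assume $\Psi_{\min}=\min_{c\in W}\|\Psi_c\|>0$.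 **Access.** The qRAM holds the $x_i$, the vectors $(c_iy_i\|\Phi(x_i)\|/\sqrt m)_i$ for $c\in W$, the coefficients $\hat\alpha_c$ for $c\in W$, and a new point $x$ with $\|\Phi(x)\|\le R$. A qRAM operation is one of: $|i\rangle|z\rangle\mapsto|i\rangle|z\oplus x_i\rangle$; $|z\rangle\mapsto|z\oplus x\rangle$; a unitary with $|0\rangle\mapsto\eta_c^{-1}\sum_i\frac{c_iy_i}{\sqrt m}\|\Phi(x_i)\||i\rangle$, or its inverse; reading one $\hat\alpha_c$. It takes time $(1+\lfloor\log_2(m+n+t_{\max})\rfloor)^\kappa$ for a constant $\kappa$. The numbers $\eta_c$ ($c\in W$), $C$, $R$, $\|\Phi(x)\|$, $\epsilon,\delta$ and the integers $m,\lceil\log_2 m\rceil,n,N,|W|,t_{\max}$ are known classically. A quantum algorithm is a program of a classical real-number random access machine that controls a register of qubits. Classical instructions cost one step per operation in them, with exact real arithmetic and elementary functions. One-qubit gates and one-qubit measurements cost one step each. Queries cost the times above. A control costs one further step per controlling qubit, and resetting the register costs one step per qubit, both up to one step per operation needed to evaluate the operands. **Theorem.** There is a quantum algorithm, the same for all instances,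 such that for every $\kappa$ there are constants $K,k$ depending only on $\kappa$ with the following property. For all data as above, all $\epsilon>0$ and all $0<\delta\le\frac12$, with probability at least $1-\delta$ it outputs a number within $\epsilon$ of $$\Big\langle\sum_c\hat\alpha_c\Psi_c,\Phi(x)\Big\rangle,$$ and its running time in every branch of positive probability is $\tilde O(f)$ with $$f=\frac{CR^3\log(1/\delta)}{\Psi_{\min}}\,\frac{t_{\max}}\epsilon\,T_\Phi ,$$ that is, at most $K\,(1+f)\,\log(3+m+n+f)^k$. In particular, $f$ does not involve $m$ explicitly: apart from polylogarithmic factors, the running time does not depend on $m$. -/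

import Mathlib

noncomputable section

namespace QSVM

/-- Bit strings of length `k`; they label the computational basis of `k` qubits. -/
abbrev Bits (k : ℕ) : Type := Fin k → Bool

/-- The real feature space `ℝ^(2^N)` whose vectors are the amplitude vectors of `N` qubits. -/
abbrev Feature (N : ℕ) : Type := EuclideanSpace ℝ (Bits N)

/- ## The machine: classical control of a register of qubits, with a step count.

Classical part: a random access machine with natural-number registers (used for addresses and
counters) and real registers. Real arithmetic and elementary functions are exact and cost one step
each; there is no rounding of reals to integers.  The syntax below has no access to the data of the
problem except through the counted instructions that query the memory. -/

/-- Natural-number expressions; `reg a` is the content of the register whose address is `a`. -/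
inductive NExp : Type
  | const (k : ℕ)
  | reg (a : NExp)
  | add (a b : NExp)
  | sub (a b : NExp)

def NExp.eval (r : ℕ → ℕ) : NExp → ℕ
  | .const k => k
  | .reg a => r (a.eval r)
  | .add a b => a.eval r + b.eval r
  | .sub a b => a.eval r - b.eval r

/-- The number of steps needed to evaluate an expression. -/
def NExp.size : NExp → ℕ
  | .const _ => 1
  | .reg a => a.size + 1
  | .add a b => a.size + b.size + 1
  | .sub a b => a.size + b.size + 1

/-- Elementary real functions available to the classical control. -/
inductive Elem : Type
  | sqrt | exp | log | sin | cos | arcsin | arccos | arctan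

def Elem.eval : Elem → ℝ → ℝ
  | .sqrt => Real.sqrt
  | .exp => Real.exp
  | .log => Real.log
  | .sin => Real.sin
  | .cos => Real.cos
  | .arcsin => Real.arcsin
  | .arccos => Real.arccos
  | .arctan => Real.arctan

/-- Real expressions. -/
inductive RExp : Type
  | ofNat (a : NExp)
  | reg (a : NExp)
  | add (a b : RExp)
  | sub (a b : RExp)
  | mul (a b : RExp)
  | div (a b : RExp)
  | app (f : Elem) (a : RExp)

def RExp.eval (r : ℕ → ℕ) (z : ℕ → ℝ) : RExp → ℝ
  | .ofNat a => (a.eval r : ℝ)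
  | .reg a => z (a.eval r)
  | .add a b => a.eval r z + b.eval r z
  | .sub a b => a.eval r z - b.eval r z
  | .mul a b => a.eval r z * b.eval r z
  | .div a b => a.eval r z / b.eval r z
  | .app f a => f.eval (a.eval r z)

def RExp.size : RExp → ℕ
  | .ofNat a => a.size + 1
  | .reg a => a.size + 1
  | .add a b => a.size + b.size + 1
  | .sub a b => a.size + b.size + 1
  | .mul a b => a.size + b.size + 1
  | .div a b => a.size + b.size + 1
  | .app _ a => a.size + 1

/-- A control: every qubit in the range `start, …, start + len - 1` must have the value `val`. -/
structure Ctrl : Type where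
  start : NExp
  len : NExp
  val : Bool

/-- Unitary instructions. Wires and blocks of consecutive wires are given by (the first) number.
* `hadamard`, `not`, `phase`: one-qubit gates, the last one being `diag (1, exp (i θ))`;
* `lookup a b`: qRAM query `|i⟩|z⟩ ↦ |i⟩|z ⊕ x_i⟩` to the training points, with the address
  in the block at `a` and the target block at `b`;
* `load b`: qRAM query `|z⟩ ↦ |z ⊕ x⟩` to the new point;
* `prep inv s a`: preparation, from `|0⟩`, of the amplitude encoding of the `s`-th real vector
  stored in qRAM, on the address block at `a` (`inv = true`: the inverse);
* `feature inv a b`: the feature map unitary, input block at `a` and output block at `b`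
  (`inv = true`: its inverse). -/
inductive Op : Type
  | hadamard (w : NExp)
  | not (w : NExp)
  | phase (w : NExp) (θ : RExp)
  | lookup (a b : NExp)
  | load (b : NExp)
  | prep (inv : Bool) (s a : NExp)
  | feature (inv : Bool) (a b : NExp)

def Op.size : Op → ℕ
  | .hadamard w => w.size
  | .not w => w.size
  | .phase w θ => w.size + θ.size
  | .lookup a b => a.size + b.size
  | .load b => b.size
  | .prep _ s a => s.size + a.size
  | .feature _ a b => a.size + b.size

/-- Programs.
* `ite a b p p'` runs `p` if `a ≤ b` and `p'` otherwise;
* `loop a p` runs `p` as long as the number of completed rounds is less than the value of `a`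
  at the start of the loop;
* `unitary l o` applies `o` under the controls `l`;
* `measure d w` measures the qubit `w` and writes the outcome to the natural register `d`;
* `reset` measures and discards all qubits and sets them to zero;
* `readAlpha d s` and `readEta d s` copy the `s`-th stored coefficient, respectively the `s`-th
  stored normalization, to the real register `d`. -/
inductive Prog : Type
  | skip
  | seq (p p' : Prog)
  | setNat (d a : NExp)
  | setReal (d : NExp) (a : RExp)
  | ite (a b : RExp) (p p' : Prog)
  | loop (a : RExp) (p : Prog)
  | unitary (l : List Ctrl) (o : Op)
  | measure (d w : NExp)
  | reset
  | readAlpha (d s : NExp)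
  | readEta (d s : NExp)

/-- The black boxes and stored data that a program can query, with the time per query. -/
structure Memory : Type where
  /-- width of addresses -/
  ℓ : ℕ
  /-- width of the encoding of a data point -/
  n : ℕ
  /-- width of the output register of the feature map -/
  N : ℕ
  /-- the content of the qRAM cell with the given address -/
  cell : Bits ℓ → Bits n
  /-- the new data point -/
  point : Bits n
  /-- state preparation unitaries of the stored vectors -/
  prepU : ℕ → Matrix (Bits ℓ) (Bits ℓ) ℂ
  /-- the feature map unitary; basis states of the two registers are joined by `Sum.elim` -/
  featU : Matrix (Fin n ⊕ Fin N → Bool) (Fin n ⊕ Fin N → Bool) ℂ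
  alpha : ℕ → ℝ
  eta : ℕ → ℝ
  /-- time of one operation on the qRAM -/
  qramTime : ℕ
  /-- time of one application of the feature map unitary -/
  featTime : ℕ

/-- Configurations of a machine with `q` qubits. The amplitude vector is not renormalized after
measurements: its squared norm is the probability of the branch. -/
structure Config (q : ℕ) : Type where
  nat : ℕ → ℕ
  real : ℕ → ℝ
  amp : Bits q → ℂ
  time : ℕ

def Config.tick {q : ℕ} (c : Config q) (t : ℕ) : Config q := { c with time := c.time + t }

/-- Probability of the branch. -/
def Config.weight {q : ℕ} (c : Config q) : ℝ := ∑ b : Bits q, ‖c.amp b‖ ^ 2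

open Classical in
/-- Apply the matrix `U` to the wires `e i`, under the controls `l` (start, length, value).
An instruction whose wires do not exist, are repeated or meet the controls does nothing. -/
def applyAt {q : ℕ} {ι : Type} [Fintype ι] (l : List (ℕ × ℕ × Bool)) (e : ι → ℕ)
    (U : Matrix (ι → Bool) (ι → Bool) ℂ) (ψ : Bits q → ℂ) : Bits q → ℂ :=
  if h : Function.Injective e ∧ (∀ i, e i < q) ∧
      (∀ c ∈ l, c.1 + c.2.1 ≤ q ∧ ∀ i, ¬ (c.1 ≤ e i ∧ e i < c.1 + c.2.1)) then
    fun b =>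
      if ∀ c ∈ l, ∀ w : Fin q, c.1 ≤ (w : ℕ) → (w : ℕ) < c.1 + c.2.1 → b w = c.2.2 then
        ∑ v : ι → Bool, U (fun i => b ⟨e i, h.2.1 i⟩) v *
          ψ (Function.extend (fun i => (⟨e i, h.2.1 i⟩ : Fin q)) v b)
      else ψ b
  else ψ

/-- Consecutive wires starting at `a`. -/
def block (a k : ℕ) : Fin k → ℕ := fun i => a + i

/-- Matrix of a one-qubit gate. -/
def gate (g : Bool → Bool → ℂ) : Matrix (Bits 1) (Bits 1) ℂ := fun u v => g (u 0) (v 0)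

def hadamardGate : Matrix (Bits 1) (Bits 1) ℂ :=
  gate fun u v => (if u && v then -1 else 1) / (Real.sqrt 2 : ℂ)

def notGate : Matrix (Bits 1) (Bits 1) ℂ := gate fun u v => if u = v then 0 else 1

def phaseGate (θ : ℝ) : Matrix (Bits 1) (Bits 1) ℂ :=
  gate fun u v => if u = v then (if u then Complex.exp (θ * Complex.I) else 1) else 0

/-- The permutation matrix of `|i⟩|z⟩ ↦ |i⟩|z ⊕ f i⟩`. -/
def lookupMatrix {ℓ n : ℕ} (f : Bits ℓ → Bits n) :
    Matrix (Fin ℓ ⊕ Fin n → Bool) (Fin ℓ ⊕ Fin n → Bool) ℂ :=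
  fun u v => if u = Sum.elim (v ∘ Sum.inl) (fun j => xor (v (Sum.inr j)) (f (v ∘ Sum.inl) j))
    then 1 else 0

/-- The permutation matrix of `|z⟩ ↦ |z ⊕ x⟩`. -/
def loadMatrix {n : ℕ} (x : Bits n) : Matrix (Bits n) (Bits n) ℂ :=
  fun u v => if u = fun j => xor (v j) (x j) then 1 else 0

/-- Time of an uncontrolled unitary instruction. -/
def Op.time (M : Memory) : Op → ℕ
  | .hadamard _ => 1
  | .not _ => 1
  | .phase _ _ => 1
  | .lookup _ _ => M.qramTime
  | .load _ => M.qramTime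
  | .prep _ _ _ => M.qramTime
  | .feature _ _ _ => M.featTime

/-- Action of a unitary instruction on the amplitudes. -/
def Op.apply (M : Memory) {q : ℕ} (l : List (ℕ × ℕ × Bool)) (r : ℕ → ℕ) (z : ℕ → ℝ)
    (ψ : Bits q → ℂ) : Op → Bits q → ℂ
  | .hadamard w => applyAt l (block (w.eval r) 1) hadamardGate ψ
  | .not w => applyAt l (block (w.eval r) 1) notGate ψ
  | .phase w θ => applyAt l (block (w.eval r) 1) (phaseGate (θ.eval r z)) ψ
  | .lookup a b =>
      applyAt l (Sum.elim (block (a.eval r) M.ℓ) (block (b.eval r) M.n)) (lookupMatrix M.cell) ψ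
  | .load b => applyAt l (block (b.eval r) M.n) (loadMatrix M.point) ψ
  | .prep inv s a =>
      applyAt l (block (a.eval r) M.ℓ)
        (if inv then (M.prepU (s.eval r)).conjTranspose else M.prepU (s.eval r)) ψ
  | .feature inv a b =>
      applyAt l (Sum.elim (block (a.eval r) M.n) (block (b.eval r) M.N))
        (if inv then M.featU.conjTranspose else M.featU) ψ

/-- The part of `ψ` in which qubit `w` has the value `v`. -/
def project {q : ℕ} (w : Fin q) (v : Bool) (ψ : Bits q → ℂ) : Bits q → ℂ :=
  fun b => if b w = v then ψ b else 0

/-- The list of all branches of an execution. A controlled instruction costs, besides the time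
of the instruction, one step for each controlling qubit. -/
def Prog.exec (M : Memory) {q : ℕ} : Prog → Config q → List (Config q)
  | .skip => fun c => [c]
  | .seq p p' => fun c => (p.exec M c).flatMap (p'.exec M)
  | .setNat d a => fun c =>
      [{ c.tick (1 + d.size + a.size) with
          nat := Function.update c.nat (d.eval c.nat) (a.eval c.nat) }]
  | .setReal d a => fun c =>
      [{ c.tick (1 + d.size + a.size) with
          real := Function.update c.real (d.eval c.nat) (a.eval c.nat c.real) }]
  | .ite a b p p' => fun c =>
      if a.eval c.nat c.real ≤ b.eval c.nat c.real then p.exec M (c.tick (1 + a.size + b.size))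
      else p'.exec M (c.tick (1 + a.size + b.size))
  | .loop a p => fun c =>
      (fun cs : List (Config q) => cs.flatMap fun c' => p.exec M (c'.tick 1))^[
        ⌈a.eval c.nat c.real⌉₊] [c.tick (1 + a.size)]
  | .unitary l o => fun c =>
      [{ c.tick (1 + o.time M + o.size +
            (l.map fun k => k.start.size + k.len.size + k.len.eval c.nat).sum) with
          amp := o.apply M (l.map fun k => (k.start.eval c.nat, k.len.eval c.nat, k.val))
            c.nat c.real c.amp }]
  | .measure d w => fun c =>
      if h : w.eval c.nat < q then
        [false, true].map fun v =>
          { c.tick (1 + d.size + w.size) with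
            nat := Function.update c.nat (d.eval c.nat) (if v then 1 else 0)
            amp := project ⟨w.eval c.nat, h⟩ v c.amp }
      else [c.tick (1 + d.size + w.size)]
  | .reset => fun c =>
      (Finset.univ : Finset (Bits q)).toList.map fun b =>
        { c.tick (1 + q) with amp := Pi.single (fun _ => false) (c.amp b) }
  | .readAlpha d s => fun c =>
      [{ c.tick (1 + M.qramTime + d.size + s.size) with
          real := Function.update c.real (d.eval c.nat) (M.alpha (s.eval c.nat)) }]
  | .readEta d s => fun c =>
      [{ c.tick (1 + d.size + s.size) with
          real := Function.update c.real (d.eval c.nat) (M.eta (s.eval c.nat)) }]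

/-- An algorithm: a program, and the number of qubits it uses as a function of its integer
inputs. -/
structure Algorithm : Type where
  qubits : NExp
  body : Prog

/-- All branches of the run on the integer inputs `a` and the real inputs `r`; the registers
after the inputs are zero, and all qubits start in the state zero. -/
def Algorithm.run (P : Algorithm) (M : Memory) (a : List ℕ) (r : List ℝ) :
    List (Config (P.qubits.eval fun i => a.getD i 0)) :=
  P.body.exec M
    { nat := fun i => a.getD i 0
      real := fun i => r.getD i 0
      amp := Pi.single (fun _ => false) 1
      time := 0 }

open Classical in
/-- Probability that the output, which is the final content of real register `0`, satisfies
`good`. -/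
def Algorithm.prob (P : Algorithm) (M : Memory) (a : List ℕ) (r : List ℝ) (good : ℝ → Prop) : ℝ :=
  ((P.run M a r).map fun c => if good (c.real 0) then c.weight else 0).sum

/-- The running time is at most `T`, in every branch of positive probability. -/
def Algorithm.TimeLE (P : Algorithm) (M : Memory) (a : List ℕ) (r : List ℝ) (T : ℝ) : Prop :=
  ∀ c ∈ P.run M a r, 0 < c.weight → (c.time : ℝ) ≤ T

/- ## Feature maps and the vectors `Ψ_c` -/

/-- `U` is a quantum feature map for `Φ`: a unitary with `U |x⟩|0⟩ = |x⟩ |Φ(x)⟩`, where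
`|Φ(x)⟩ = ‖Φ(x)‖⁻¹ ∑_j Φ(x)_j |j⟩`, for every basis state `x` (with nonzero `Φ(x)`). -/
def IsFeatureMap {n N : ℕ} (U : Matrix (Fin n ⊕ Fin N → Bool) (Fin n ⊕ Fin N → Bool) ℂ)
    (Φ : Bits n → Feature N) : Prop :=
  U ∈ Matrix.unitaryGroup (Fin n ⊕ Fin N → Bool) ℂ ∧
  ∀ x : Bits n, Φ x ≠ 0 → ∀ (x' : Bits n) (j : Bits N),
    U (Sum.elim x' j) (Sum.elim x fun _ => false) =
      if x' = x then ((Φ x j / ‖Φ x‖ : ℝ) : ℂ) else 0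

/-- A bit as a real number. -/
def bit (b : Bool) : ℝ := if b then 1 else 0

section TrainingSet

variable {m n N : ℕ} (Φ : Bits n → Feature N) (pts : Fin m → Bits n) (y : Fin m → ℝ)

/-- `Ψ_c = (1/m) ∑_i c_i y_i Φ(x_i)`. -/
def Psi (c : Bits m) : Feature N := (1 / m : ℝ) • ∑ i, (bit (c i) * y i) • Φ (pts i)

/-- `η_c = √((1/m) ∑_i c_i ‖Φ(x_i)‖²)`. -/
def eta (c : Bits m) : ℝ := Real.sqrt ((∑ i, bit (c i) * ‖Φ (pts i)‖ ^ 2) / m)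

/-- The vector with entries `c_i y_i ‖Φ(x_i)‖ / √m` that is stored in qRAM. -/
def stored (c : Bits m) (i : Fin m) : ℝ := bit (c i) * y i / Real.sqrt m * ‖Φ (pts i)‖

/-- `R = max_i ‖Φ(x_i)‖`. -/
def maxNorm : ℝ := ⨆ i, ‖Φ (pts i)‖

/-- `Ψ_min = min_{c ∈ W} ‖Ψ_c‖`. -/
def psiMin (W : Finset (Bits m)) : ℝ := ⨅ c : W, ‖Psi Φ pts y c‖

/-- `V` is a state preparation unitary for `stored c` on the address register:
`V |0⟩ = η_c⁻¹ ∑_i (c_i y_i ‖Φ(x_i)‖ / √m) |i⟩`, addresses being binary numbers. -/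
def IsStatePrep {ℓ : ℕ} (V : Matrix (Bits ℓ) (Bits ℓ) ℂ) (c : Bits m) : Prop :=
  V ∈ Matrix.unitaryGroup (Bits ℓ) ℂ ∧
  ∀ b : Bits ℓ, V b (fun _ => false) =
    if h : Nat.ofBits b < m then
      ((stored Φ pts y c ⟨Nat.ofBits b, h⟩ / eta Φ pts c : ℝ) : ℂ)
    else 0

end TrainingSet

/-- The cell with address `b` holds the training point with that number. -/
def cellOf {m n ℓ : ℕ} (pts : Fin m → Bits n) (b : Bits ℓ) : Bits n :=
  if h : Nat.ofBits b < m then pts ⟨Nat.ofBits b, h⟩ else fun _ => false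

/- ## The training algorithm -/

/-- `‖c‖₁ / m`. -/
def frac {m : ℕ} (c : Bits m) : ℝ := (∑ i, bit (c i)) / m

/-- `Y` is the projection of `X` to the positive semidefinite cone in the Frobenius norm. -/
def IsPsdProjection {ι : Type} [Fintype ι] (X Y : Matrix ι ι ℝ) : Prop :=
  Y.PosSemidef ∧ ∀ Z : Matrix ι ι ℝ, Z.PosSemidef →
    ∑ i, ∑ j, (Y i j - X i j) ^ 2 ≤ ∑ i, ∑ j, (Z i j - X i j) ^ 2

/-- The dual objective restricted to the working set `W`, with Gram matrix `J`. -/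
def dualObjective {m : ℕ} (W : Finset (Bits m)) (J : Matrix W W ℝ) (α : Bits m → ℝ) : ℝ :=
  -(1 / 2) * (∑ c : W, ∑ c' : W, α c * α c' * J c c') + ∑ c : W, frac c.1 * α c

/-- Feasible points of the restricted dual: `α ≥ 0`, supported in `W`, of sum at most `C`. -/
def DualFeasible {m : ℕ} (W : Finset (Bits m)) (C : ℝ) (α : Bits m → ℝ) : Prop :=
  (∀ c, 0 ≤ α c) ∧ (∀ c, c ∉ W → α c = 0) ∧ ∑ c ∈ W, α c ≤ C

/-- `ξ_c = max {‖c‖₁ / m - ∑_{c'} α_{c'} J_{cc'}, 0}`. -/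
def slack {m : ℕ} (W : Finset (Bits m)) (J : Matrix W W ℝ) (α : Bits m → ℝ) (c : W) : ℝ :=
  max (frac c.1 - ∑ c' : W, α c' * J c c') 0

/-- `ξ̂ = max_{c ∈ W} ξ_c + 1 / t_max`. -/
def slackHat {m : ℕ} (W : Finset (Bits m)) (J : Matrix W W ℝ) (α : Bits m → ℝ) (tmax : ℕ) : ℝ :=
  (⨆ c : W, slack W J α c) + 1 / tmax

/-- A run of the quantum-classical structural SVM training algorithm with hyperparameter `C`,
tolerance `ε`, iteration limit `tmax` and initial vector `c₀`, which stops in iteration `last`.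

`Jt t` and `ζ t` are the values that the randomized inner product subroutine returned in
iteration `t` as estimates of `⟨Ψ_c, Ψ_c'⟩` and of `⟨∑_c α^(t)_c Ψ_c, y_i Φ(x_i)⟩`. Since such an
estimate is reliable only with a certain probability, any values are admitted here, so that
every possible run on every training set is covered. -/
structure TrainingRun (m : ℕ) (C ε : ℝ) (tmax : ℕ) (c₀ : Bits m) : Type where
  last : ℕ
  W : ℕ → Finset (Bits m)
  Jt : (t : ℕ) → Matrix (W t) (W t) ℝ
  Jhat : (t : ℕ) → Matrix (W t) (W t) ℝ
  α : ℕ → Bits m → ℝ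
  ζ : ℕ → Fin m → ℝ
  one_le_last : 1 ≤ last
  W_one : W 1 = {c₀}
  Jhat_spec : ∀ t, 1 ≤ t → t ≤ last → IsPsdProjection (Jt t) (Jhat t)
  α_spec : ∀ t, 1 ≤ t → t ≤ last → DualFeasible (W t) C (α t) ∧
    ∀ β, DualFeasible (W t) C β →
      dualObjective (W t) (Jhat t) β ≤ dualObjective (W t) (Jhat t) (α t)
  /-- the set `W` grows by the vector `c` with `c_i = 1` if and only if `ζ_i < 1` -/
  W_succ : ∀ t, 1 ≤ t → t < last → W (t + 1) = insert (fun i => decide (ζ t i < 1)) (W t)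
  continue_spec : ∀ t, 1 ≤ t → t < last →
    ¬ ((∑ i, max 0 (1 - ζ t i)) / m ≤ slackHat (W t) (Jhat t) (α t) tmax + 2 * ε) ∧
      ¬ (tmax < t + 1)
  stop_spec :
    (∑ i, max 0 (1 - ζ last i)) / m ≤ slackHat (W last) (Jhat last) (α last) tmax + 2 * ε ∨
      tmax < last + 1

/-- The output `α̂` of the training algorithm. -/
def TrainingRun.alphaHat {m : ℕ} {C ε : ℝ} {tmax : ℕ} {c₀ : Bits m}
    (T : TrainingRun m C ε tmax c₀) : Bits m → ℝ := T.α T.last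

/-- The working set in the last iteration. -/
def TrainingRun.workingSet {m : ℕ} {C ε : ℝ} {tmax : ℕ} {c₀ : Bits m}
    (T : TrainingRun m C ε tmax c₀) : Finset (Bits m) := T.W T.last

/- ## The classification problem -/

/-- The memory available for classification: the qRAM holds the training points, the vectors
`stored c` for the `c` in the working set `W` (in the order `e`), the coefficients `α` and the
new point `x`; the numbers `η_c` are stored classically. An operation on the qRAM takes time
`(1 + log₂ (m + n + tmax))^κ` (rounded), an application of the feature map takes time `TΦ`. -/
def classificationMemory {m n N : ℕ} (κ tmax : ℕ) (Φ : Bits n → Feature N)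
    (U : Matrix (Fin n ⊕ Fin N → Bool) (Fin n ⊕ Fin N → Bool) ℂ) (TΦ : ℕ)
    (pts : Fin m → Bits n) (W : Finset (Bits m)) (e : Fin W.card ≃ W) (α : Bits m → ℝ)
    (V : Fin W.card → Matrix (Bits (Nat.clog 2 m)) (Bits (Nat.clog 2 m)) ℂ)
    (x : Bits n) : Memory where
  ℓ := Nat.clog 2 m
  n := n
  N := N
  cell := cellOf pts
  point := x
  prepU := fun s => if h : s < W.card then V ⟨s, h⟩ else 1
  featU := U
  alpha := fun s => if h : s < W.card then α (e ⟨s, h⟩) else 0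
  eta := fun s => if h : s < W.card then eta Φ pts (e ⟨s, h⟩) else 0
  qramTime := (1 + Nat.log 2 (m + n + tmax)) ^ κ
  featTime := TΦ

/-- `C R³ log(1/δ) t_max T_Φ / (Ψ_min ε)`. -/
def mainTerm (C R δ Ψmin ε : ℝ) (tmax TΦ : ℕ) : ℝ :=
  C * R ^ 3 * Real.log (1 / δ) / Ψmin * (tmax / ε) * TΦ

end QSVM

end

/-!
The decision value is `∑_c α_c ⟨Ψ_c, Φ(x)⟩`, and each term is a known number `β_c` times an
amplitude `a_c ∈ [-1, 1]`. Indeed, let the state preparation for `c` be followed by a qRAM lookup,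
the feature map and the inverse lookup: this gives the state `η_c⁻¹ ∑_i (c_i y_i ‖Φ(x_i)‖ / √m)
|i⟩|Φ(x_i)⟩`, and its inner product with the uniform superposition of addresses times `|Φ(x)⟩` is
`a_c`, with `β_c = α_c η_c ‖Φ(x)‖ √(2^ℓ / m)` (`overlap_classificationMemory`,
`sum_termWeight_mul`). The number `m` of points enters only through the width `ℓ` of the address
register, since `2^ℓ ≤ 2m`.

The number of qubits must not depend on the accuracy, which excludes textbook phase estimation.
Each `a_c` is instead located by a bisection with iterated amplitude amplification. Given an
interval `[L, L + w]` that contains `a = a_c`, a control qubit is rotated according to `L`, so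
that the circuit has the amplitude `sin θ = (a - L) / √(2 (1 + L²))` at `|0⟩`, up to a phase
(`offsetMap_amplitude`). With a number `k` of amplification steps of the order `1 / w`, the state
`|0⟩` is measured with probability `sin² ((2k + 1) θ)` (`amplification`, `norm_amplified`). In the
range considered this is monotone in `a`, and it differs by at least `1 / 432` from its value at
the midpoint if `a` is in the first or in the last third of the interval (`gap_left`,
`gap_right`). Comparing the number of successes in `T` trials with its expectation for the
midpoint decides which of these two thirds is discarded. It is wrong with probability at most `exp
(-decayRate) ^ T`, by an exponential potential (`exists_potential`). A round costs `O(T / w)`, and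
since `w` shrinks geometrically, the total cost is that of the last round, where `w` is of order
`ε / (C R²)` (`triple_estimate`). Classical bookkeeping uses a program logic (`Triple`) which
bounds the time of all branches together with the expectation of a function of the final
configuration.

Since `η_c, ‖Φ(x)‖ ≤ R` and `∑_c α_c ≤ C`, the errors `(2/3)^J β_c` add up to at most `ε`. There
are at most `t_max` terms, because the working set grows by at most one vector in each iteration,
and `Ψ_min ≤ ‖Ψ_c‖ ≤ R` turns the cost `C R² / ε` per term into the bound of the theorem
(`total_time_le`). If `C R ‖Φ(x)‖ ≤ ε`, the program outputs `0`, which covers in particular the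
case `Φ(x) = 0`, in which the feature state of `x` is undefined. The numerical constants in the
time bounds are generous.

Layout of the program. Wire `0` is the control qubit of the overlap circuit, wire `1` the flag
that is measured, and the address, data and feature registers follow in this order. Natural
registers: `0` to `5` hold the integer inputs, `6` the index of the current vector, `7` the
measured bit, `8` the number of amplification steps, `9` a loop counter. Real registers: `0` to
`4` hold the real inputs `C, R, ε, δ, ‖Φ(x)‖`, `5` the accumulated sum, `6` and `7` the interval
`L, w`, `8` the excess of successes over the threshold, `9` and `10` the numbers of rounds and of
trials before rounding up, `11` the threshold, `12` and `13` the current `η_c` and `α_c`.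
-/

open scoped ComplexConjugate

namespace QSVM

noncomputable section

/-! ### Unitary maps on amplitude vectors -/

/-- The Hermitian inner product of two amplitude vectors, antilinear in the first. -/
def braket {q : ℕ} (φ ψ : Bits q → ℂ) : ℂ := ∑ b, conj (φ b) * ψ b

/-- The basis vector `|0⋯0⟩`. -/
def ket0 (q : ℕ) : Bits q → ℂ := Pi.single (fun _ => false) 1

lemma braket_ket0 {q : ℕ} (ψ : Bits q → ℂ) : braket (ket0 q) ψ = ψ fun _ => false := by
  unfold braket ket0
  rw [Finset.sum_eq_single (fun _ => false)]
  · simp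
  · intro b _ hb; simp [hb]
  · simp

lemma braket_conj {q : ℕ} (φ ψ : Bits q → ℂ) : conj (braket φ ψ) = braket ψ φ := by
  simp [braket, map_sum, mul_comm]

lemma braket_self {q : ℕ} (ψ : Bits q → ℂ) : braket ψ ψ = ((∑ b, ‖ψ b‖ ^ 2 : ℝ) : ℂ) := by
  simp [braket, Complex.conj_mul']

/-- A linear isometry of the amplitude space. -/
structure IsUnitaryMap {q : ℕ} (O : (Bits q → ℂ) → Bits q → ℂ) : Prop where
  map_add : ∀ φ ψ, O (φ + ψ) = O φ + O ψ
  map_smul : ∀ (z : ℂ) ψ, O (z • ψ) = z • O ψ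
  braket_map : ∀ φ ψ, braket (O φ) (O ψ) = braket φ ψ

lemma IsUnitaryMap.comp {q : ℕ} {O O' : (Bits q → ℂ) → Bits q → ℂ} (h : IsUnitaryMap O)
    (h' : IsUnitaryMap O') : IsUnitaryMap fun ψ => O (O' ψ) :=
  ⟨fun φ ψ => by rw [h'.map_add, h.map_add], fun z ψ => by rw [h'.map_smul, h.map_smul],
    fun φ ψ => by rw [h.braket_map, h'.braket_map]⟩

lemma isUnitaryMap_id {q : ℕ} : IsUnitaryMap fun ψ : Bits q → ℂ => ψ :=
  ⟨fun _ _ => rfl, fun _ _ => rfl, fun _ _ => rfl⟩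

lemma IsUnitaryMap.sum_norm_sq {q : ℕ} {O : (Bits q → ℂ) → Bits q → ℂ} (h : IsUnitaryMap O)
    (ψ : Bits q → ℂ) : ∑ b, ‖O ψ b‖ ^ 2 = ∑ b, ‖ψ b‖ ^ 2 := by
  have := h.braket_map ψ ψ
  rw [braket_self, braket_self] at this
  exact_mod_cast this

/-- `ψ` has no component in which wire `1`, the flag, is set. -/
def FlagClear {q : ℕ} (ψ : Bits q → ℂ) : Prop :=
  ∀ (b : Bits q) (h : 1 < q), b ⟨1, h⟩ = true → ψ b = 0

section Act

variable {q : ℕ} {ι : Type} [Fintype ι] [DecidableEq ι]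

open Classical in
/-- The matrix `U` acting on the wires `e i` of the basis states that satisfy `ctl`. -/
def act (e : ι → Fin q) (ctl : Bits q → Prop) (U : Matrix (ι → Bool) (ι → Bool) ℂ)
    (ψ : Bits q → ℂ) : Bits q → ℂ :=
  fun b => if ctl b then ∑ v : ι → Bool, U (fun i => b (e i)) v * ψ (Function.extend e v b)
    else ψ b

lemma extend_extend {α β γ : Type*} {e : α → β} (he : e.Injective) (v w : α → γ) (b : β → γ) :
    Function.extend e w (Function.extend e v b) = Function.extend e w b := by
  funext x
  by_cases h : ∃ i, e i = x
  · obtain ⟨i, rfl⟩ := h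
    rw [he.extend_apply, he.extend_apply]
  · rw [Function.extend_apply' _ _ _ h, Function.extend_apply' _ _ _ h,
      Function.extend_apply' _ _ _ h]

lemma extend_comp_self {α β γ : Type*} {e : α → β} (he : e.Injective) (b : β → γ) :
    Function.extend e (fun i => b (e i)) b = b := by
  funext x
  by_cases h : ∃ i, e i = x
  · obtain ⟨i, rfl⟩ := h
    rw [he.extend_apply]
  · rw [Function.extend_apply' _ _ _ h]

lemma act_act {e : ι → Fin q} (he : e.Injective) {ctl : Bits q → Prop}
    (hc : ∀ v b, ctl (Function.extend e v b) ↔ ctl b)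
    (U U' : Matrix (ι → Bool) (ι → Bool) ℂ) (ψ : Bits q → ℂ) :
    act e ctl U (act e ctl U' ψ) = act e ctl (U * U') ψ := by
  funext b
  unfold act
  by_cases hb : ctl b
  · simp only [hb, if_true, hc, extend_extend he, he.extend_apply, Matrix.mul_apply,
      Finset.mul_sum, Finset.sum_mul]
    rw [Finset.sum_comm]
    exact Finset.sum_congr rfl fun _ _ => Finset.sum_congr rfl fun _ _ => (mul_assoc _ _ _).symm
  · simp [hb]

lemma act_one {e : ι → Fin q} (he : e.Injective) (ctl : Bits q → Prop)
    (ψ : Bits q → ℂ) : act e ctl 1 ψ = ψ := by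
  funext b
  unfold act
  split_ifs
  · rw [Finset.sum_eq_single (fun i => b (e i))]
    · rw [extend_comp_self he]; simp
    · intro v _ hv; simp [Matrix.one_apply_ne' hv]
    · simp
  · rfl

/-- The adjoint of an action is the action of the adjoint matrix. The sum over a basis state and
a new value of the wires is invariant under exchanging old and new values. -/
lemma braket_act {e : ι → Fin q} (he : e.Injective) {ctl : Bits q → Prop}
    (hc : ∀ v b, ctl (Function.extend e v b) ↔ ctl b)
    (U : Matrix (ι → Bool) (ι → Bool) ℂ) (φ ψ : Bits q → ℂ) :
    braket φ (act e ctl U ψ) = braket (act e ctl U.conjTranspose φ) ψ := by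
  classical
  let σ : Bits q × (ι → Bool) → Bits q × (ι → Bool) :=
    fun p => (Function.extend e p.2 p.1, fun i => p.1 (e i))
  have hσ : Function.Involutive σ := by
    rintro ⟨b, v⟩
    simp only [σ, extend_extend he, he.extend_apply, extend_comp_self he]
  have key : ∀ b : Bits q,
      conj (φ b) * act e ctl U ψ b = (∑ v : ι → Bool, if ctl b then
        conj (φ b) * (U (fun i => b (e i)) v * ψ (Function.extend e v b)) else 0) +
        if ctl b then 0 else conj (φ b) * ψ b := by
    intro b
    unfold act
    by_cases hb : ctl b
    · simp [hb, Finset.mul_sum]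
    · simp [hb]
  have key' : ∀ b : Bits q,
      conj (act e ctl U.conjTranspose φ b) * ψ b = (∑ v : ι → Bool, if ctl b then
        conj (φ (Function.extend e v b)) * (U v (fun i => b (e i)) * ψ b) else 0) +
        if ctl b then 0 else conj (φ b) * ψ b := by
    intro b
    unfold act
    by_cases hb : ctl b
    · simp only [hb, if_true, map_sum, map_mul, Finset.sum_mul, Matrix.conjTranspose_apply,
        RCLike.star_def, Complex.conj_conj, add_zero]
      exact Finset.sum_congr rfl fun v _ => by ring
    · simp [hb]
  unfold braket
  rw [Finset.sum_congr rfl fun b _ => key b, Finset.sum_congr rfl fun b _ => key' b,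
    Finset.sum_add_distrib, Finset.sum_add_distrib]
  congr 1
  refine (Fintype.sum_prod_type' _).symm.trans (Eq.trans ?_ (Fintype.sum_prod_type' _))
  refine Fintype.sum_equiv hσ.toPerm _ _ ?_
  rintro ⟨b, v⟩
  simp only [Function.Involutive.coe_toPerm, σ, hc, extend_extend he, he.extend_apply,
    extend_comp_self he]

lemma isUnitaryMap_act {e : ι → Fin q} (he : e.Injective) {ctl : Bits q → Prop}
    (hc : ∀ v b, ctl (Function.extend e v b) ↔ ctl b)
    {U : Matrix (ι → Bool) (ι → Bool) ℂ} (hU : U ∈ Matrix.unitaryGroup (ι → Bool) ℂ) :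
    IsUnitaryMap (act e ctl U) := by
  refine ⟨fun φ ψ => ?_, fun z ψ => ?_, fun φ ψ => ?_⟩
  · funext b
    by_cases hb : ctl b <;> simp [act, hb, mul_add, Finset.sum_add_distrib]
  · funext b
    by_cases hb : ctl b
    · simp only [act, hb, if_true, Pi.smul_apply, smul_eq_mul, Finset.mul_sum]
      exact Finset.sum_congr rfl fun v _ => by ring
    · simp [act, hb]
  · rw [braket_act he hc, act_act he hc, ← Matrix.star_eq_conjTranspose,
      Matrix.mem_unitaryGroup_iff'.1 hU, act_one he]

end Act

/-! ### The action of instructions on given wires -/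

section ApplyAt

variable {q : ℕ} {ι : Type}

/-- The basis state satisfies all controls of the list. -/
def CtlHolds (l : List (ℕ × ℕ × Bool)) (b : Bits q) : Prop :=
  ∀ c ∈ l, ∀ w : Fin q, c.1 ≤ (w : ℕ) → (w : ℕ) < c.1 + c.2.1 → b w = c.2.2

/-- The wires exist, are distinct, and do not meet the controls. -/
def WiresOK (q : ℕ) (l : List (ℕ × ℕ × Bool)) (e : ι → ℕ) : Prop :=
  Function.Injective e ∧ (∀ i, e i < q) ∧
    (∀ c ∈ l, c.1 + c.2.1 ≤ q ∧ ∀ i, ¬ (c.1 ≤ e i ∧ e i < c.1 + c.2.1))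

lemma applyAt_eq_act [Fintype ι] [DecidableEq ι] {l : List (ℕ × ℕ × Bool)} {e : ι → ℕ}
    (h : WiresOK q l e)
    (U : Matrix (ι → Bool) (ι → Bool) ℂ) (ψ : Bits q → ℂ) :
    applyAt l e U ψ = act (fun i => ⟨e i, h.2.1 i⟩) (CtlHolds l) U ψ := by
  refine (dif_pos h).trans ?_
  funext b
  unfold act CtlHolds
  congr!

lemma applyAt_of_not [Fintype ι] {l : List (ℕ × ℕ × Bool)} {e : ι → ℕ} (h : ¬ WiresOK q l e)
    (U : Matrix (ι → Bool) (ι → Bool) ℂ) (ψ : Bits q → ℂ) : applyAt l e U ψ = ψ :=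
  dif_neg h

lemma WiresOK.injective {l : List (ℕ × ℕ × Bool)} {e : ι → ℕ} (h : WiresOK q l e) :
    Function.Injective fun i => (⟨e i, h.2.1 i⟩ : Fin q) :=
  fun _ _ hij => h.1 (Fin.mk.inj_iff.1 hij)

lemma WiresOK.ctlHolds_extend {l : List (ℕ × ℕ × Bool)} {e : ι → ℕ} (h : WiresOK q l e)
    (v : ι → Bool) (b : Bits q) :
    CtlHolds l (Function.extend (fun i => (⟨e i, h.2.1 i⟩ : Fin q)) v b) ↔ CtlHolds l b := by
  unfold CtlHolds
  refine forall₂_congr fun c hc => forall_congr' fun w => forall₂_congr fun h1 h2 => ?_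
  rw [Function.extend_apply']
  rintro ⟨i, rfl⟩
  exact (h.2.2 c hc).2 i ⟨h1, h2⟩

lemma isUnitaryMap_applyAt [Fintype ι] [DecidableEq ι] (l : List (ℕ × ℕ × Bool)) (e : ι → ℕ)
    {U : Matrix (ι → Bool) (ι → Bool) ℂ} (hU : U ∈ Matrix.unitaryGroup (ι → Bool) ℂ) :
    IsUnitaryMap (applyAt (q := q) l e U) := by
  by_cases h : WiresOK q l e
  · have : applyAt (q := q) l e U = act (fun i => ⟨e i, h.2.1 i⟩) (CtlHolds l) U :=
      funext fun ψ => applyAt_eq_act h U ψ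
    rw [this]
    exact isUnitaryMap_act h.injective h.ctlHolds_extend hU
  · have : applyAt (q := q) l e U = fun ψ => ψ := funext fun ψ => applyAt_of_not h U ψ
    rw [this]
    exact isUnitaryMap_id

lemma applyAt_applyAt [Fintype ι] [DecidableEq ι] (l : List (ℕ × ℕ × Bool)) (e : ι → ℕ)
    {U U' : Matrix (ι → Bool) (ι → Bool) ℂ} (hU : U' * U = 1) (ψ : Bits q → ℂ) :
    applyAt l e U' (applyAt l e U ψ) = ψ := by
  by_cases h : WiresOK q l e
  · rw [applyAt_eq_act h, applyAt_eq_act h, act_act h.injective h.ctlHolds_extend, hU,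
      act_one h.injective]
  · rw [applyAt_of_not h, applyAt_of_not h]

lemma flagClear_applyAt [Fintype ι] {l : List (ℕ × ℕ × Bool)} {e : ι → ℕ} (he : ∀ i, e i ≠ 1)
    (U : Matrix (ι → Bool) (ι → Bool) ℂ) {ψ : Bits q → ℂ} (hψ : FlagClear ψ) :
    FlagClear (applyAt l e U ψ) := by
  by_cases h : WiresOK q l e
  · classical
    rw [applyAt_eq_act h]
    intro b h1 hb
    unfold act
    split_ifs
    · refine Finset.sum_eq_zero fun v _ => ?_
      rw [hψ _ h1, mul_zero]
      rw [Function.extend_apply']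
      · exact hb
      · rintro ⟨i, hi⟩
        exact he i (Fin.mk.inj_iff.1 hi)
    · exact hψ b h1 hb
  · rw [applyAt_of_not h]; exact hψ

end ApplyAt

/-! ### The matrices of the instructions -/

lemma gate_mul_gate (g g' : Bool → Bool → ℂ) :
    gate g * gate g' = gate fun u v => g u false * g' false v + g u true * g' true v := by
  ext u v
  rw [Matrix.mul_apply, ← (Equiv.funUnique (Fin 1) Bool).symm.sum_comp]
  simp [gate, add_comm]

lemma gate_eq_one {g : Bool → Bool → ℂ} (h : ∀ u v, g u v = if u = v then 1 else 0) :
    gate g = 1 := by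
  ext u v
  rw [gate, h, Matrix.one_apply]
  congr 1
  rw [eq_iff_iff]
  constructor
  · intro h'; funext i; rw [Subsingleton.elim i 0]; exact h'
  · rintro rfl; rfl

lemma gate_conjTranspose (g : Bool → Bool → ℂ) :
    (gate g).conjTranspose = gate fun u v => conj (g v u) := rfl

lemma hadamardGate_mul_self : hadamardGate * hadamardGate = 1 := by
  rw [hadamardGate, gate_mul_gate]
  refine gate_eq_one fun u v => ?_
  have h : ((Real.sqrt 2 : ℝ) : ℂ) * (Real.sqrt 2 : ℝ) = 2 := by
    rw [← Complex.ofReal_mul, Real.mul_self_sqrt (by norm_num)]; norm_num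
  have h0 : ((Real.sqrt 2 : ℝ) : ℂ) ≠ 0 := by
    intro h'; rw [h'] at h; norm_num at h
  cases u <;> cases v <;> simp <;> field_simp <;> rw [pow_two, h] <;> norm_num

lemma hadamardGate_mem : hadamardGate ∈ Matrix.unitaryGroup (Bits 1) ℂ := by
  rw [Matrix.mem_unitaryGroup_iff]
  have : star hadamardGate = hadamardGate := by
    rw [Matrix.star_eq_conjTranspose, hadamardGate, gate_conjTranspose]
    congr 1
    funext u v
    cases u <;> cases v <;> simp
  rw [this, hadamardGate_mul_self]

lemma notGate_mul_self : notGate * notGate = 1 := by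
  rw [notGate, gate_mul_gate]
  refine gate_eq_one fun u v => ?_
  cases u <;> cases v <;> simp

lemma notGate_mem : notGate ∈ Matrix.unitaryGroup (Bits 1) ℂ := by
  rw [Matrix.mem_unitaryGroup_iff]
  have : star notGate = notGate := by
    rw [Matrix.star_eq_conjTranspose, notGate, gate_conjTranspose]
    congr 1
    funext u v
    cases u <;> cases v <;> simp
  rw [this, notGate_mul_self]

lemma phaseGate_mul (θ θ' : ℝ) (h : θ + θ' = 0) : phaseGate θ * phaseGate θ' = 1 := by
  rw [phaseGate, phaseGate, gate_mul_gate]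
  refine gate_eq_one fun u v => ?_
  have : Complex.exp (θ * Complex.I) * Complex.exp (θ' * Complex.I) = 1 := by
    rw [← Complex.exp_add, ← add_mul, ← Complex.ofReal_add, h]; simp
  cases u <;> cases v <;> simp [this]

lemma phaseGate_mem (θ : ℝ) : phaseGate θ ∈ Matrix.unitaryGroup (Bits 1) ℂ := by
  rw [Matrix.mem_unitaryGroup_iff]
  have : star (phaseGate θ) = phaseGate (-θ) := by
    rw [Matrix.star_eq_conjTranspose, phaseGate, gate_conjTranspose, phaseGate]
    congr 1
    funext u v
    cases u <;> cases v <;> simp [← Complex.exp_conj]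
  rw [this, phaseGate_mul _ _ (by ring)]

/-- The matrix of an involution of the basis states is its own inverse. -/
lemma involution_mul_self {α : Type} [Fintype α] [DecidableEq α] {σ : α → α}
    (hσ : Function.Involutive σ) :
    (Matrix.of fun u v => if u = σ v then (1 : ℂ) else 0) *
      (Matrix.of fun u v => if u = σ v then (1 : ℂ) else 0) = 1 := by
  ext u v
  rw [Matrix.mul_apply, Finset.sum_eq_single (σ v)]
  · simp [hσ v, Matrix.one_apply]
  · intro w _ hw; simp [hw]
  · simp

lemma involution_mem {α : Type} [Fintype α] [DecidableEq α] {σ : α → α}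
    (hσ : Function.Involutive σ) :
    (Matrix.of fun u v => if u = σ v then (1 : ℂ) else 0) ∈ Matrix.unitaryGroup α ℂ := by
  rw [Matrix.mem_unitaryGroup_iff]
  have : star (Matrix.of fun u v => if u = σ v then (1 : ℂ) else 0) =
      Matrix.of fun u v => if u = σ v then (1 : ℂ) else 0 := by
    ext u v
    simp only [Matrix.star_apply, Matrix.of_apply, apply_ite star, star_one, star_zero]
    congr 1
    rw [eq_iff_iff]
    constructor
    · rintro rfl; rw [hσ]
    · rintro rfl; rw [hσ]
  rw [this, involution_mul_self hσ]

lemma involutive_lookup {ℓ n : ℕ} (f : Bits ℓ → Bits n) :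
    Function.Involutive fun v : Fin ℓ ⊕ Fin n → Bool =>
      (Sum.elim (v ∘ Sum.inl) (fun j => xor (v (Sum.inr j)) (f (v ∘ Sum.inl) j)) :
        Fin ℓ ⊕ Fin n → Bool) := by
  intro v
  funext i
  rcases i with i | i
  · rfl
  · simp

lemma involutive_load {n : ℕ} (x : Bits n) :
    Function.Involutive fun v : Bits n => (fun j => xor (v j) (x j) : Bits n) := by
  intro v
  funext i
  simp

lemma lookupMatrix_mul_self {ℓ n : ℕ} (f : Bits ℓ → Bits n) :
    lookupMatrix f * lookupMatrix f = 1 := involution_mul_self (involutive_lookup f)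

lemma lookupMatrix_mem {ℓ n : ℕ} (f : Bits ℓ → Bits n) :
    lookupMatrix f ∈ Matrix.unitaryGroup (Fin ℓ ⊕ Fin n → Bool) ℂ :=
  involution_mem (involutive_lookup f)

lemma loadMatrix_mul_self {n : ℕ} (x : Bits n) : loadMatrix x * loadMatrix x = 1 :=
  involution_mul_self (involutive_load x)

lemma loadMatrix_mem {n : ℕ} (x : Bits n) : loadMatrix x ∈ Matrix.unitaryGroup (Bits n) ℂ :=
  involution_mem (involutive_load x)

/-! ### Circuits: sequences of unitary instructions -/

/-- All black boxes of the memory are unitary. -/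
structure Memory.IsUnitary (M : Memory) : Prop where
  prep : ∀ s, M.prepU s ∈ Matrix.unitaryGroup (Bits M.ℓ) ℂ
  feat : M.featU ∈ Matrix.unitaryGroup (Fin M.n ⊕ Fin M.N → Bool) ℂ

lemma conjTranspose_mem {α : Type} [Fintype α] [DecidableEq α] {U : Matrix α α ℂ}
    (hU : U ∈ Matrix.unitaryGroup α ℂ) : U.conjTranspose ∈ Matrix.unitaryGroup α ℂ := by
  rw [← Matrix.star_eq_conjTranspose]
  exact Unitary.star_mem hU

lemma isUnitaryMap_apply {M : Memory} (hM : M.IsUnitary) {q : ℕ} (l : List (ℕ × ℕ × Bool))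
    (r : ℕ → ℕ) (z : ℕ → ℝ) (o : Op) :
    IsUnitaryMap fun ψ : Bits q → ℂ => o.apply M l r z ψ := by
  cases o with
  | hadamard w => exact isUnitaryMap_applyAt _ _ hadamardGate_mem
  | not w => exact isUnitaryMap_applyAt _ _ notGate_mem
  | phase w θ => exact isUnitaryMap_applyAt _ _ (phaseGate_mem _)
  | lookup a b => exact isUnitaryMap_applyAt _ _ (lookupMatrix_mem _)
  | load b => exact isUnitaryMap_applyAt _ _ (loadMatrix_mem _)
  | prep inv s a =>
    cases inv
    · exact isUnitaryMap_applyAt _ _ (hM.prep _)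
    · exact isUnitaryMap_applyAt _ _ (conjTranspose_mem (hM.prep _))
  | feature inv a b =>
    cases inv
    · exact isUnitaryMap_applyAt _ _ hM.feat
    · exact isUnitaryMap_applyAt _ _ (conjTranspose_mem hM.feat)

/-- The instruction that undoes `o`. -/
def Op.inverse : Op → Op
  | .hadamard w => .hadamard w
  | .not w => .not w
  | .phase w θ => .phase w (.sub (.ofNat (.const 0)) θ)
  | .lookup a b => .lookup a b
  | .load b => .load b
  | .prep inv s a => .prep (!inv) s a
  | .feature inv a b => .feature (!inv) a b

lemma apply_inverse_apply {M : Memory} (hM : M.IsUnitary) {q : ℕ} (l : List (ℕ × ℕ × Bool))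
    (r : ℕ → ℕ) (z : ℕ → ℝ) (o : Op) (ψ : Bits q → ℂ) :
    o.inverse.apply M l r z (o.apply M l r z ψ) = ψ := by
  cases o with
  | hadamard w => exact applyAt_applyAt _ _ hadamardGate_mul_self _
  | not w => exact applyAt_applyAt _ _ notGate_mul_self _
  | phase w θ =>
    refine applyAt_applyAt _ _ (phaseGate_mul _ _ ?_) _
    simp [RExp.eval, NExp.eval]
  | lookup a b => exact applyAt_applyAt _ _ (lookupMatrix_mul_self _) _
  | load b => exact applyAt_applyAt _ _ (loadMatrix_mul_self _) _
  | prep inv s a =>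
    cases inv
    · exact applyAt_applyAt _ _ (Matrix.mem_unitaryGroup_iff'.1 (hM.prep _)) _
    · exact applyAt_applyAt _ _ (Matrix.mem_unitaryGroup_iff.1 (hM.prep _)) _
  | feature inv a b =>
    cases inv
    · exact applyAt_applyAt _ _ (Matrix.mem_unitaryGroup_iff'.1 hM.feat) _
    · exact applyAt_applyAt _ _ (Matrix.mem_unitaryGroup_iff.1 hM.feat) _

/-- The instruction does not act on the flag, wire `1`. -/
def Op.OffFlag (r : ℕ → ℕ) : Op → Prop
  | .hadamard w => w.eval r ≠ 1
  | .not w => w.eval r ≠ 1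
  | .phase w _ => w.eval r ≠ 1
  | .lookup a b => 2 ≤ a.eval r ∧ 2 ≤ b.eval r
  | .load b => 2 ≤ b.eval r
  | .prep _ _ a => 2 ≤ a.eval r
  | .feature _ a b => 2 ≤ a.eval r ∧ 2 ≤ b.eval r

lemma block_ne_one {a k : ℕ} (h : 2 ≤ a) (i : Fin k) : block a k i ≠ 1 := by
  unfold block; omega

lemma block_one_ne_one {a : ℕ} (h : a ≠ 1) (i : Fin 1) : block a 1 i ≠ 1 := by
  unfold block; omega

lemma flagClear_apply {M : Memory} {q : ℕ} (l : List (ℕ × ℕ × Bool))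
    {r : ℕ → ℕ} (z : ℕ → ℝ) {o : Op} (ho : o.OffFlag r) {ψ : Bits q → ℂ} (hψ : FlagClear ψ) :
    FlagClear (o.apply M l r z ψ) := by
  cases o with
  | hadamard w => exact flagClear_applyAt (block_one_ne_one ho) _ hψ
  | not w => exact flagClear_applyAt (block_one_ne_one ho) _ hψ
  | phase w θ => exact flagClear_applyAt (block_one_ne_one ho) _ hψ
  | lookup a b =>
    exact flagClear_applyAt (Sum.forall.2 ⟨block_ne_one ho.1, block_ne_one ho.2⟩) _ hψ
  | load b => exact flagClear_applyAt (block_ne_one ho) _ hψ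
  | prep inv s a => exact flagClear_applyAt (block_ne_one ho) _ hψ
  | feature inv a b =>
    exact flagClear_applyAt (Sum.forall.2 ⟨block_ne_one ho.1, block_ne_one ho.2⟩) _ hψ

/-- A list of controlled unitary instructions. -/
abbrev Circuit : Type := List (List Ctrl × Op)

/-- The program that executes a circuit. -/
def Circuit.prog : Circuit → Prog
  | [] => .skip
  | g :: gs => .seq (.unitary g.1 g.2) (Circuit.prog gs)

/-- The values of controls. -/
def ctrlVals (r : ℕ → ℕ) (l : List Ctrl) : List (ℕ × ℕ × Bool) :=
  l.map fun k => (k.start.eval r, k.len.eval r, k.val)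

/-- The action of a circuit on the amplitudes. -/
def Circuit.run (M : Memory) (r : ℕ → ℕ) (z : ℕ → ℝ) {q : ℕ} :
    Circuit → (Bits q → ℂ) → Bits q → ℂ
  | [], ψ => ψ
  | g :: gs, ψ => Circuit.run M r z gs (g.2.apply M (ctrlVals r g.1) r z ψ)

/-- The running time of a circuit. -/
def Circuit.time (M : Memory) (r : ℕ → ℕ) : Circuit → ℕ
  | [] => 0
  | g :: gs => (1 + g.2.time M + g.2.size +
      (g.1.map fun k => k.start.size + k.len.size + k.len.eval r).sum) + Circuit.time M r gs

/-- The circuit that undoes a circuit. -/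
def Circuit.inverse (gs : Circuit) : Circuit := (gs.map fun g => (g.1, g.2.inverse)).reverse

lemma Circuit.exec_prog (M : Memory) {q : ℕ} (gs : Circuit) (c : Config q) :
    gs.prog.exec M c = [{ c with
      amp := gs.run M c.nat c.real c.amp, time := c.time + gs.time M c.nat }] := by
  induction gs generalizing c with
  | nil => rfl
  | cons g gs ih =>
    simp only [Circuit.prog, Prog.exec, List.flatMap_cons, List.flatMap_nil, List.append_nil]
    rw [ih]
    simp only [Config.tick, Circuit.run, Circuit.time, ctrlVals, add_assoc]

lemma Circuit.run_append (M : Memory) (r : ℕ → ℕ) (z : ℕ → ℝ) {q : ℕ} (gs gs' : Circuit)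
    (ψ : Bits q → ℂ) :
    Circuit.run M r z (gs ++ gs') ψ = Circuit.run M r z gs' (Circuit.run M r z gs ψ) := by
  induction gs generalizing ψ with
  | nil => rfl
  | cons g gs ih => exact ih _

lemma Circuit.isUnitaryMap {M : Memory} (hM : M.IsUnitary) (r : ℕ → ℕ) (z : ℕ → ℝ) {q : ℕ}
    (gs : Circuit) : IsUnitaryMap (Circuit.run (q := q) M r z gs) := by
  induction gs with
  | nil => exact isUnitaryMap_id
  | cons g gs ih => exact ih.comp (isUnitaryMap_apply hM _ _ _ _)

lemma Circuit.run_inverse {M : Memory} (hM : M.IsUnitary) (r : ℕ → ℕ) (z : ℕ → ℝ) {q : ℕ}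
    (gs : Circuit) (ψ : Bits q → ℂ) :
    Circuit.run M r z gs.inverse (Circuit.run M r z gs ψ) = ψ := by
  induction gs generalizing ψ with
  | nil => rfl
  | cons g gs ih =>
    have : Circuit.inverse (g :: gs) = Circuit.inverse gs ++ [(g.1, g.2.inverse)] := by
      simp [Circuit.inverse]
    rw [this, Circuit.run_append]
    change Op.apply M _ r z _ _ = _
    rw [Circuit.run, ih]
    exact apply_inverse_apply hM _ _ _ _ _

lemma Circuit.flagClear_run {M : Memory} {r : ℕ → ℕ} {z : ℕ → ℝ} {q : ℕ}
    {gs : Circuit} (h : ∀ g ∈ gs, g.2.OffFlag r) {ψ : Bits q → ℂ} (hψ : FlagClear ψ) :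
    FlagClear (Circuit.run M r z gs ψ) := by
  induction gs generalizing ψ with
  | nil => exact hψ
  | cons g gs ih =>
    exact ih (fun g' hg' => h g' (List.mem_cons_of_mem _ hg'))
      (flagClear_apply _ _ (h g List.mem_cons_self) hψ)

/-- Execution of a loop whose body has a single branch. -/
lemma exec_loop_single (M : Memory) {q : ℕ} {a : RExp} {p : Prog} {c : Config q} {n : ℕ}
    (hn : ⌈a.eval c.nat c.real⌉₊ = n) (cs : ℕ → Config q) (h0 : cs 0 = c.tick (1 + a.size))
    (hs : ∀ i < n, p.exec M ((cs i).tick 1) = [cs (i + 1)]) :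
    (Prog.loop a p).exec M c = [cs n] := by
  simp only [Prog.exec]
  rw [hn]
  clear hn
  have : ∀ j ≤ n, (fun cs : List (Config q) => cs.flatMap fun c' => p.exec M (c'.tick 1))^[j]
      [c.tick (1 + a.size)] = [cs j] := by
    intro j hj
    induction j with
    | zero => simp [h0]
    | succ j ih =>
      rw [Function.iterate_succ_apply', ih (by omega)]
      simp [hs j (by omega)]
  exact this n le_rfl

/-! ### Hadamard gates on the address register -/

/-- Composition of the maps `g 0, …, g (j - 1)`. -/
def composeFirst {α : Type} (g : ℕ → α → α) : ℕ → α → α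
  | 0, x => x
  | j + 1, x => g j (composeFirst g j x)

lemma composeFirst_reverse {α : Type} {g : ℕ → α → α} (hg : ∀ i x, g i (g i x) = x) (ℓ : ℕ)
    (x : α) : composeFirst (fun i => g (ℓ - 1 - i)) ℓ (composeFirst g ℓ x) = x := by
  have : ∀ i ≤ ℓ, composeFirst (fun i => g (ℓ - 1 - i)) i (composeFirst g ℓ x) =
      composeFirst g (ℓ - i) x := by
    intro i hi
    induction i with
    | zero => rfl
    | succ i ih =>
      have h1 : ℓ - i = (ℓ - (i + 1)) + 1 := by omega
      have h2 : ℓ - 1 - i = ℓ - (i + 1) := by omega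
      simp only [composeFirst]
      rw [ih (by omega), h1, composeFirst, h2, hg]
  simpa [composeFirst] using this ℓ le_rfl

lemma IsUnitaryMap.composeFirst {q : ℕ} {g : ℕ → (Bits q → ℂ) → Bits q → ℂ}
    (hg : ∀ i, IsUnitaryMap (g i)) (j : ℕ) : IsUnitaryMap (composeFirst g j) := by
  induction j with
  | zero => exact isUnitaryMap_id
  | succ j ih => exact (hg j).comp ih

lemma flagClear_composeFirst {q : ℕ} {g : ℕ → (Bits q → ℂ) → Bits q → ℂ}
    (hg : ∀ i ψ, FlagClear ψ → FlagClear (g i ψ)) (j : ℕ) {ψ : Bits q → ℂ} (hψ : FlagClear ψ) :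
    FlagClear (composeFirst g j ψ) := by
  induction j with
  | zero => exact hψ
  | succ j ih => exact hg j _ ih

/-- The control by wire `0`. -/
def ctrl0 : Ctrl := ⟨.const 0, .const 1, true⟩

/-- Hadamard gate on wire `2 + i`, controlled by wire `0`. -/
def hadStep {q : ℕ} (i : ℕ) (ψ : Bits q → ℂ) : Bits q → ℂ :=
  applyAt [(0, 1, true)] (block (2 + i) 1) hadamardGate ψ

/-- Content of the `k`-th natural register. -/
abbrev nreg (k : ℕ) : NExp := .reg (.const k)

/-- Content of the `k`-th real register. -/
abbrev rreg (k : ℕ) : RExp := .reg (.const k)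

/-- Hadamard gates on the address register, controlled by wire `0`, with register `9` as loop
counter; the order of the wires is reversed in the inverse. -/
def hadLoop (inv : Bool) : Prog :=
  .seq (.loop (.ofNat (nreg 1)) (.seq
    (.unitary [ctrl0] (.hadamard
      (if inv then .sub (.add (.const 1) (nreg 1)) (nreg 9) else .add (.const 2) (nreg 9))))
    (.setNat (.const 9) (.add (nreg 9) (.const 1)))))
  (.setNat (.const 9) (.const 0))

/-- The action of `hadLoop`. -/
def hadMap {q : ℕ} (inv : Bool) (ℓ : ℕ) : (Bits q → ℂ) → Bits q → ℂ :=
  composeFirst (fun i => hadStep (if inv then ℓ - 1 - i else i)) ℓ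

lemma exec_hadLoop (M : Memory) {q : ℕ} (inv : Bool) (c : Config q) (h9 : c.nat 9 = 0) :
    ∃ t ≤ 19 * c.nat 1 + 7, (hadLoop inv).exec M c =
      [{ c with amp := hadMap inv (c.nat 1) c.amp, time := c.time + t }] := by
  refine ⟨(if inv then 19 else 16) * c.nat 1 + 7, by split_ifs <;> omega, ?_⟩
  have hup : Function.update c.nat 9 0 = c.nat := by rw [← h9, Function.update_eq_self]
  unfold hadLoop
  have key := exec_loop_single M (q := q) (a := .ofNat (nreg 1)) (p := .seq
    (.unitary [ctrl0] (.hadamard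
      (if inv then .sub (.add (.const 1) (nreg 1)) (nreg 9) else .add (.const 2) (nreg 9))))
    (.setNat (.const 9) (.add (nreg 9) (.const 1)))) (c := c) (n := c.nat 1)
    (by simp [RExp.eval, NExp.eval])
    (fun i => { c with
      nat := Function.update c.nat 9 i
      amp := composeFirst (fun i => hadStep (if inv then c.nat 1 - 1 - i else i)) i c.amp
      time := c.time + 4 + (if inv then 19 else 16) * i })
    (by simp [Config.tick, composeFirst, RExp.size, NExp.size, hup])
    (by
      intro i hi
      cases inv
      · simp [Prog.exec, Config.tick, composeFirst, hadStep, Op.apply, Op.size, Op.time, NExp.eval,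
          NExp.size, ctrl0]
        ring
      · have : 1 + c.nat 1 - i = 2 + (c.nat 1 - 1 - i) := by omega
        simp [Prog.exec, Config.tick, composeFirst, hadStep, Op.apply, Op.size, Op.time, NExp.eval,
          NExp.size, ctrl0, this]
        ring)
  change List.flatMap _ _ = _
  rw [key]
  simp [Prog.exec, NExp.eval, NExp.size, Config.tick, hadMap, hup]
  ring

lemma hadMap_inverse {q : ℕ} (ℓ : ℕ) (ψ : Bits q → ℂ) :
    hadMap true ℓ (hadMap false ℓ ψ) = ψ := by
  simpa [hadMap] using composeFirst_reverse (g := hadStep (q := q))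
    (fun i x => applyAt_applyAt _ _ hadamardGate_mul_self _) ℓ ψ

lemma isUnitaryMap_hadMap {q : ℕ} (inv : Bool) (ℓ : ℕ) :
    IsUnitaryMap (hadMap (q := q) inv ℓ) :=
  IsUnitaryMap.composeFirst (fun _ => isUnitaryMap_applyAt _ _ hadamardGate_mem) _

lemma flagClear_hadMap {q : ℕ} (inv : Bool) (ℓ : ℕ) {ψ : Bits q → ℂ} (hψ : FlagClear ψ) :
    FlagClear (hadMap inv ℓ ψ) :=
  flagClear_composeFirst
    (fun _ _ h => flagClear_applyAt (block_one_ne_one (by omega)) _ h) _ hψ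

/-! ### The offset overlap circuit -/

/-- The constant `k` as a real expression. -/
abbrev rnat (k : ℕ) : RExp := .ofNat (.const k)

/-- The number `π`, as `arccos (-1)`. -/
def piExp : RExp := .app .arccos (.sub (rnat 0) (rnat 1))

/-- First wire of the address register. -/
abbrev addrE : NExp := .const 2
/-- First wire of the data register. -/
abbrev dataE : NExp := .add (.const 2) (nreg 1)
/-- First wire of the feature register. -/
abbrev featE : NExp := .add (.add (.const 2) (nreg 1)) (nreg 2)

/-- Rotation of wire `0` into a superposition whose amplitudes have the ratio `-L : 1`, where
`L` is the content of real register `6`. The phase `π / 2`, written as `arccos 0`, makes this ratio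
real. -/
def rotCircuit : Circuit :=
  [([], .hadamard (.const 0)),
   ([], .phase (.const 0) (.add piExp (.mul (rnat 2) (.app .arctan (rreg 6))))),
   ([], .hadamard (.const 0)),
   ([], .phase (.const 0) (.app .arccos (rnat 0)))]

/-- On an address register in uniform superposition: prepare the feature state of the new point,
undo the feature map of the training points and the state preparation; then mix wire `0`. The
lookups are repeated in order to clear the data register. -/
def overlapCircuit : Circuit :=
  [([ctrl0], .load dataE),
   ([ctrl0], .feature false dataE featE),
   ([ctrl0], .load dataE),
   ([ctrl0], .lookup addrE dataE),
   ([ctrl0], .feature true dataE featE),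
   ([ctrl0], .lookup addrE dataE),
   ([ctrl0], .prep true (nreg 6) addrE),
   ([], .hadamard (.const 0))]

/-- The circuit whose amplitude `⟨0|·|0⟩` is proportional to the difference of the overlap for the
vector with the number in register `6`, and the number in real register `6`; and its inverse. -/
def offsetProg (inv : Bool) : Prog :=
  if inv then .seq overlapCircuit.inverse.prog (.seq (hadLoop true) rotCircuit.inverse.prog)
  else .seq rotCircuit.prog (.seq (hadLoop false) overlapCircuit.prog)

/-- The action of `offsetProg`. -/
def offsetMap (M : Memory) (r : ℕ → ℕ) (z : ℕ → ℝ) {q : ℕ} (inv : Bool) (ψ : Bits q → ℂ) :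
    Bits q → ℂ :=
  if inv then rotCircuit.inverse.run M r z (hadMap true (r 1) (overlapCircuit.inverse.run M r z ψ))
  else overlapCircuit.run M r z (hadMap false (r 1) (rotCircuit.run M r z ψ))

/-- A unit of time that bounds the time of every instruction. -/
def Memory.unit (M : Memory) : ℕ := M.qramTime + M.featTime + M.ℓ + M.n + M.N + 1

/-- The registers hold the sizes of the memory, and the loop counter of `hadLoop` is zero. -/
structure SizesOK (M : Memory) (r : ℕ → ℕ) : Prop where
  addr : r 1 = M.ℓ
  data : r 2 = M.n
  feat : r 3 = M.N
  counter : r 9 = 0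

lemma exec_offsetProg (M : Memory) {q : ℕ} (inv : Bool) (c : Config q) (hc : SizesOK M c.nat) :
    ∃ t ≤ 300 * M.unit, (offsetProg inv).exec M c =
      [{ c with amp := offsetMap M c.nat c.real inv c.amp, time := c.time + t }] := by
  cases inv
  · obtain ⟨t, ht, h⟩ := exec_hadLoop M false { c with
      amp := rotCircuit.run M c.nat c.real c.amp, time := c.time + rotCircuit.time M c.nat }
      hc.counter
    refine ⟨rotCircuit.time M c.nat + t + overlapCircuit.time M c.nat, ?_, ?_⟩
    · have := hc.addr
      simp only [Circuit.time, rotCircuit, overlapCircuit, Op.time, Op.size, NExp.size, RExp.size,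
        Memory.unit, ctrl0, NExp.eval, piExp, List.map, List.sum_cons, List.sum_nil] at ht ⊢
      omega
    · simp [offsetProg, Prog.exec, Circuit.exec_prog, h, offsetMap, add_assoc]
  · obtain ⟨t, ht, h⟩ := exec_hadLoop M true { c with
      amp := overlapCircuit.inverse.run M c.nat c.real c.amp
      time := c.time + overlapCircuit.inverse.time M c.nat }
      hc.counter
    refine ⟨overlapCircuit.inverse.time M c.nat + t + rotCircuit.inverse.time M c.nat, ?_, ?_⟩
    · have := hc.addr
      simp only [Circuit.time, Circuit.inverse, Op.inverse, rotCircuit, overlapCircuit, Op.time,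
        Op.size, NExp.size, RExp.size, List.reverse_cons, List.reverse_nil, List.nil_append,
        List.cons_append,
        Memory.unit, ctrl0, NExp.eval, piExp, List.map, List.sum_cons, List.sum_nil] at ht ⊢
      omega
    · simp [offsetProg, Prog.exec, Circuit.exec_prog, h, offsetMap, add_assoc]

lemma isUnitaryMap_offsetMap {M : Memory} (hM : M.IsUnitary) (r : ℕ → ℕ) (z : ℕ → ℝ) {q : ℕ}
    (inv : Bool) : IsUnitaryMap (offsetMap (q := q) M r z inv) := by
  cases inv
  · exact (Circuit.isUnitaryMap hM r z _).comp
      ((isUnitaryMap_hadMap _ _).comp (Circuit.isUnitaryMap hM r z _))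
  · exact (Circuit.isUnitaryMap hM r z _).comp
      ((isUnitaryMap_hadMap _ _).comp (Circuit.isUnitaryMap hM r z _))

lemma offsetMap_inverse {M : Memory} (hM : M.IsUnitary) (r : ℕ → ℕ) (z : ℕ → ℝ) {q : ℕ}
    (ψ : Bits q → ℂ) : offsetMap M r z true (offsetMap M r z false ψ) = ψ := by
  simp only [offsetMap, if_true, Bool.false_eq_true, if_false]
  rw [Circuit.run_inverse hM, hadMap_inverse, Circuit.run_inverse hM]

lemma flagClear_offsetMap {M : Memory} {r : ℕ → ℕ} {z : ℕ → ℝ} {q : ℕ} (inv : Bool)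
    {ψ : Bits q → ℂ} (hψ : FlagClear ψ) : FlagClear (offsetMap M r z inv ψ) := by
  cases inv
  · refine Circuit.flagClear_run ?_ (flagClear_hadMap _ _ (Circuit.flagClear_run ?_ hψ))
    · simp [overlapCircuit, Op.OffFlag, NExp.eval]; omega
    · simp [rotCircuit, Op.OffFlag, NExp.eval]
  · refine Circuit.flagClear_run ?_ (flagClear_hadMap _ _ (Circuit.flagClear_run ?_ hψ))
    · simp [Circuit.inverse, rotCircuit, Op.OffFlag, Op.inverse, NExp.eval]
    · simp [Circuit.inverse, overlapCircuit, Op.OffFlag, Op.inverse, NExp.eval]; omega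

/-! ### The amplitude of the offset overlap circuit -/

lemma applyAt_gate {q : ℕ} {l : List (ℕ × ℕ × Bool)} {w : ℕ} (hw : w < q)
    (hl : ∀ c ∈ l, c.1 + c.2.1 ≤ q ∧ ¬ (c.1 ≤ w ∧ w < c.1 + c.2.1)) (g : Bool → Bool → ℂ)
    (ψ : Bits q → ℂ) {b : Bits q} (hb : CtlHolds l b) :
    applyAt l (block w 1) (gate g) ψ b =
      g (b ⟨w, hw⟩) false * ψ (Function.update b ⟨w, hw⟩ false) +
      g (b ⟨w, hw⟩) true * ψ (Function.update b ⟨w, hw⟩ true) := by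
  have h : WiresOK q l (block w 1) :=
    ⟨fun i j _ => Subsingleton.elim i j, fun i => by simpa [block] using hw,
      fun c hc => ⟨(hl c hc).1, fun i => by simpa [block] using (hl c hc).2⟩⟩
  have hext : ∀ v : Bits 1,
      Function.extend (fun i => (⟨block w 1 i, h.2.1 i⟩ : Fin q)) v b =
        Function.update b ⟨w, hw⟩ (v 0) := by
    intro v
    funext x
    by_cases hx : x = ⟨w, hw⟩
    · subst hx
      have : (⟨w, hw⟩ : Fin q) = ⟨block w 1 0, h.2.1 0⟩ := by simp [block]
      rw [Function.update_self, this]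
      exact h.injective.extend_apply v b 0
    · rw [Function.update_of_ne hx, Function.extend_apply']
      rintro ⟨i, rfl⟩
      apply hx
      simp [block]
  rw [applyAt_eq_act h, act, if_pos hb]
  simp only [hext]
  rw [← (Equiv.funUnique (Fin 1) Bool).symm.sum_comp, Fintype.sum_bool, add_comm]
  rfl

lemma applyAt_ctl {q : ℕ} {ι : Type} [Fintype ι] [DecidableEq ι] {l : List (ℕ × ℕ × Bool)}
    {e : ι → ℕ} (h : WiresOK q l e) (U : Matrix (ι → Bool) (ι → Bool) ℂ) (ψ : Bits q → ℂ)
    {b : Bits q} (hb : CtlHolds l b) :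
    applyAt l e U ψ b = ∑ v, U (fun i => b ⟨e i, h.2.1 i⟩) v *
      ψ (Function.extend (fun i => (⟨e i, h.2.1 i⟩ : Fin q)) v b) := by
  rw [applyAt_eq_act h, act, if_pos hb]

lemma applyAt_ctl_not {q : ℕ} {ι : Type} [Fintype ι] {l : List (ℕ × ℕ × Bool)}
    {e : ι → ℕ} (U : Matrix (ι → Bool) (ι → Bool) ℂ) (ψ : Bits q → ℂ)
    {b : Bits q} (hb : ¬ CtlHolds l b) : applyAt l e U ψ b = ψ b := by
  classical
  by_cases h : WiresOK q l e
  · rw [applyAt_eq_act h, act, if_neg hb]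
  · rw [applyAt_of_not h]

/-- The state `χ` on wire `0`, and zero on all other wires. -/
def wireState {q : ℕ} (χ : Bool → ℂ) : Bits q → ℂ := fun b =>
  open Classical in if ∀ w : Fin q, (w : ℕ) ≠ 0 → b w = false then
    (if h : 0 < q then χ (b ⟨0, h⟩) else 0) else 0

lemma ket0_eq_wireState {q : ℕ} (hq : 0 < q) :
    ket0 q = wireState fun v => if v then 0 else 1 := by
  funext b
  unfold ket0 wireState
  rw [Pi.single_apply, dif_pos hq]
  by_cases h : b = fun _ => false
  · subst h; simp
  · rw [if_neg h]
    split_ifs with h1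
    · cases h2 : b ⟨0, hq⟩
      · exfalso; apply h
        funext w
        by_cases hw : (w : ℕ) = 0
        · rw [Fin.ext (b := ⟨0, hq⟩) hw]; exact h2
        · exact h1 w hw
      · rfl
    · rfl

lemma ctlHolds_nil {q : ℕ} (b : Bits q) : CtlHolds [] b := by simp [CtlHolds]

lemma applyAt_wireState {q : ℕ} (hq : 0 < q) (g : Bool → Bool → ℂ) (χ : Bool → ℂ) :
    applyAt [] (block 0 1) (gate g) (wireState (q := q) χ) =
      wireState fun v => g v false * χ false + g v true * χ true := by
  funext b
  rw [applyAt_gate hq (by simp) g _ (ctlHolds_nil b)]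
  have hu : ∀ v, (∀ w : Fin q, (w : ℕ) ≠ 0 → Function.update b ⟨0, hq⟩ v w = false) ↔
      (∀ w : Fin q, (w : ℕ) ≠ 0 → b w = false) := by
    intro v
    refine forall₂_congr fun w hw => ?_
    rw [Function.update_of_ne]
    rintro rfl; exact hw rfl
  unfold wireState
  simp only [hu, dif_pos hq, Function.update_self]
  split_ifs <;> simp

lemma sqrt_two_mul_self : ((Real.sqrt 2 : ℝ) : ℂ) * (Real.sqrt 2 : ℝ) = 2 := by
  rw [← Complex.ofReal_mul, Real.mul_self_sqrt (by norm_num)]; norm_num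

lemma sqrt_two_ne_zero : ((Real.sqrt 2 : ℝ) : ℂ) ≠ 0 := by
  intro h
  have := sqrt_two_mul_self
  rw [h] at this; norm_num at this

lemma eval_piExp (r : ℕ → ℕ) (z : ℕ → ℝ) : piExp.eval r z = Real.pi := by
  simp [piExp, RExp.eval, NExp.eval, Elem.eval]

/-- The global phase of the rotation of wire `0`. -/
def rotPhase (L : ℝ) : ℂ := Complex.I * Complex.exp (Real.arctan L * Complex.I)

lemma norm_rotPhase (L : ℝ) : ‖rotPhase L‖ = 1 := by
  rw [rotPhase, norm_mul, Complex.norm_exp_ofReal_mul_I, Complex.norm_I, mul_one]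

/-- The rotation angle `π + 2 arctan L` gives the amplitudes `-sin (arctan L)`, `cos (arctan L)`,
whose ratio is `-L`. -/
lemma rotCircuit_ket0 (M : Memory) (r : ℕ → ℕ) (z : ℕ → ℝ) {q : ℕ} (hq : 0 < q) :
    rotCircuit.run M r z (ket0 q) = wireState fun v => rotPhase (z 6) *
      (if v then (Real.cos (Real.arctan (z 6)) : ℂ) else -(Real.sin (Real.arctan (z 6)) : ℂ)) := by
  have hθ : (RExp.add piExp (.mul (rnat 2) (.app .arctan (rreg 6)))).eval r z =
      Real.pi + 2 * Real.arctan (z 6) := by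
    rw [RExp.eval, eval_piExp]
    simp [RExp.eval, NExp.eval, Elem.eval]
  have hθ' : (RExp.app .arccos (rnat 0)).eval r z = Real.pi / 2 := by
    simp [RExp.eval, NExp.eval, Elem.eval]
  simp only [rotCircuit, Circuit.run, ctrlVals, List.map, Op.apply, NExp.eval, hθ, hθ']
  rw [ket0_eq_wireState hq]
  unfold hadamardGate phaseGate
  rw [applyAt_wireState hq, applyAt_wireState hq, applyAt_wireState hq, applyAt_wireState hq]
  congr 1
  funext v
  have h2 := sqrt_two_mul_self
  have h0 := sqrt_two_ne_zero
  set t := Real.arctan (z 6)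
  have e1 : Complex.exp (((Real.pi + 2 * t : ℝ) : ℂ) * Complex.I) =
      -(Complex.exp (t * Complex.I) * Complex.exp (t * Complex.I)) := by
    rw [← Complex.exp_add]
    push_cast
    rw [add_mul, Complex.exp_add, Complex.exp_pi_mul_I]
    rw [neg_one_mul]; congr 2; ring
  have e2 : Complex.exp (((Real.pi / 2 : ℝ) : ℂ) * Complex.I) = Complex.I := by
    push_cast; exact Complex.exp_pi_div_two_mul_I
  have e3 : Complex.exp (t * Complex.I) =
      (Real.cos t : ℂ) + (Real.sin t : ℂ) * Complex.I := by
    rw [Complex.exp_mul_I]; simp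
  have hcs : (Real.cos t : ℂ) ^ 2 + (Real.sin t : ℂ) ^ 2 = 1 := by
    exact_mod_cast Real.cos_sq_add_sin_sq t
  rw [rotPhase, e1, e2, e3]
  generalize (Real.cos t : ℂ) = C at *
  generalize (Real.sin t : ℂ) = S at *
  generalize ((Real.sqrt 2 : ℝ) : ℂ) = Q at *
  have hI := Complex.I_mul_I
  cases v
  · simp
    field_simp
    rw [pow_two Q, h2]
    linear_combination S ^ 2 * hI - hcs
  · simp
    field_simp
    rw [pow_two Q, h2]
    linear_combination S ^ 2 * hI - hcs

section Registers

variable {ℓ n N q : ℕ}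

/-- The address register in a basis state. -/
def addrBits (hq : q = 2 + ℓ + n + N) (b : Bits q) : Bits ℓ := fun i => b ⟨2 + i, by omega⟩
/-- The data register in a basis state. -/
def dataBits (hq : q = 2 + ℓ + n + N) (b : Bits q) : Bits n := fun i => b ⟨2 + ℓ + i, by omega⟩
/-- The feature register in a basis state. -/
def featBits (hq : q = 2 + ℓ + n + N) (b : Bits q) : Bits N :=
  fun i => b ⟨2 + ℓ + n + i, by omega⟩

/-- On the basis states in which wire `0` is set and wire `1` is not, the amplitudes of `ψ` are
given by `G` as a function of the contents of the three registers. -/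
def Represents (hq : q = 2 + ℓ + n + N) (ψ : Bits q → ℂ)
    (G : Bits ℓ → Bits n → Bits N → ℂ) : Prop :=
  ∀ b : Bits q, b ⟨0, by omega⟩ = true → b ⟨1, by omega⟩ = false →
    ψ b = G (addrBits hq b) (dataBits hq b) (featBits hq b)

lemma ctlHolds_ctrl0 (hq : q = 2 + ℓ + n + N) {b : Bits q} :
    CtlHolds [(0, 1, true)] b ↔ b ⟨0, by omega⟩ = true := by
  simp only [CtlHolds, List.mem_singleton, forall_eq]
  constructor
  · intro h; exact h ⟨0, _⟩ (Nat.zero_le _) (by simp)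
  · intro h w _ hw
    have : w = ⟨0, by omega⟩ := Fin.ext (by simpa using hw)
    rw [this]; exact h

lemma wiresOK_ctrl0 {ι : Type} (hq : q = 2 + ℓ + n + N) {e : ι → ℕ} (he : e.Injective)
    (h2 : ∀ i, 2 ≤ e i ∧ e i < q) : WiresOK q [(0, 1, true)] e := by
  refine ⟨he, fun i => (h2 i).2, ?_⟩
  simp only [List.mem_singleton, forall_eq]
  refine ⟨by omega, fun i => ?_⟩
  have := (h2 i).1
  omega

lemma injective_block (a k : ℕ) : Function.Injective (block a k) := by
  intro i j h
  unfold block at h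
  exact Fin.ext (by omega)

lemma injective_sum_block {a k b k' : ℕ} (h : a + k ≤ b) :
    Function.Injective (Sum.elim (block a k) (block b k')) := by
  refine Function.Injective.sumElim (injective_block _ _) (injective_block _ _) fun i j => ?_
  unfold block
  omega

lemma extend_of_not {ι : Type} {e : ι → ℕ} (he : ∀ i, e i < q) (v : ι → Bool) (b : Bits q)
    {k : ℕ} (hk : k < q) (h : ∀ i, e i ≠ k) :
    Function.extend (fun i => (⟨e i, he i⟩ : Fin q)) v b ⟨k, hk⟩ = b ⟨k, hk⟩ := by
  rw [Function.extend_apply']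
  rintro ⟨i, hi⟩
  exact h i (Fin.mk.inj_iff.1 hi)

lemma extend_of_eq {ι : Type} {e : ι → ℕ} (hi : e.Injective) (he : ∀ i, e i < q) (v : ι → Bool)
    (b : Bits q) {k : ℕ} (hk : k < q) (i : ι) (h : e i = k) :
    Function.extend (fun i => (⟨e i, he i⟩ : Fin q)) v b ⟨k, hk⟩ = v i := by
  subst h
  exact Function.Injective.extend_apply (f := fun i => (⟨e i, he i⟩ : Fin q))
    (fun _ _ hij => hi (Fin.mk.inj_iff.1 hij)) v b i

lemma Represents.addr (hq : q = 2 + ℓ + n + N) {ψ : Bits q → ℂ}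
    {G : Bits ℓ → Bits n → Bits N → ℂ} (h : Represents hq ψ G)
    (U : Matrix (Bits ℓ) (Bits ℓ) ℂ) :
    Represents hq (applyAt [(0, 1, true)] (block 2 ℓ) U ψ)
      fun i d z => ∑ v, U i v * G v d z := by
  have hi := injective_block 2 ℓ
  have hr : ∀ i, 2 ≤ block 2 ℓ i ∧ block 2 ℓ i < q := fun i => by unfold block; omega
  intro b h0 h1
  rw [applyAt_ctl (wiresOK_ctrl0 hq hi hr) _ _ ((ctlHolds_ctrl0 hq).2 h0)]
  refine Finset.sum_congr rfl fun v _ => ?_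
  rw [h]
  · congr 2
    · funext i
      exact extend_of_eq hi _ v b _ i rfl
    · funext i
      exact extend_of_not _ v b _ fun j => by unfold block; omega
    · funext i
      exact extend_of_not _ v b _ fun j => by unfold block; omega
  · rw [extend_of_not _ v b _ fun j => by unfold block; omega]; exact h0
  · rw [extend_of_not _ v b _ fun j => by unfold block; omega]; exact h1

lemma Represents.data (hq : q = 2 + ℓ + n + N) {ψ : Bits q → ℂ}
    {G : Bits ℓ → Bits n → Bits N → ℂ} (h : Represents hq ψ G)
    (U : Matrix (Bits n) (Bits n) ℂ) :
    Represents hq (applyAt [(0, 1, true)] (block (2 + ℓ) n) U ψ)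
      fun i d z => ∑ v, U d v * G i v z := by
  have hi := injective_block (2 + ℓ) n
  have hr : ∀ i, 2 ≤ block (2 + ℓ) n i ∧ block (2 + ℓ) n i < q := fun i => by unfold block; omega
  intro b h0 h1
  rw [applyAt_ctl (wiresOK_ctrl0 hq hi hr) _ _ ((ctlHolds_ctrl0 hq).2 h0)]
  refine Finset.sum_congr rfl fun v _ => ?_
  rw [h]
  · congr 2
    · funext i
      exact extend_of_not _ v b _ fun j => by unfold block; omega
    · funext i
      exact extend_of_eq hi _ v b _ i rfl
    · funext i
      exact extend_of_not _ v b _ fun j => by unfold block; omega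
  · rw [extend_of_not _ v b _ fun j => by unfold block; omega]; exact h0
  · rw [extend_of_not _ v b _ fun j => by unfold block; omega]; exact h1

lemma sum_elim_block_ne {a k b k' x : ℕ} (h : ∀ i : Fin k, a + i ≠ x)
    (h' : ∀ i : Fin k', b + i ≠ x) : ∀ i, Sum.elim (block a k) (block b k') i ≠ x :=
  Sum.forall.2 ⟨h, h'⟩

lemma Represents.addrData (hq : q = 2 + ℓ + n + N) {ψ : Bits q → ℂ}
    {G : Bits ℓ → Bits n → Bits N → ℂ} (h : Represents hq ψ G)
    (U : Matrix (Fin ℓ ⊕ Fin n → Bool) (Fin ℓ ⊕ Fin n → Bool) ℂ) :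
    Represents hq (applyAt [(0, 1, true)] (Sum.elim (block 2 ℓ) (block (2 + ℓ) n)) U ψ)
      fun i d z => ∑ v, U (Sum.elim i d) v * G (v ∘ Sum.inl) (v ∘ Sum.inr) z := by
  have hi := injective_sum_block (a := 2) (k := ℓ) (b := 2 + ℓ) (k' := n) le_rfl
  have hr : ∀ i, 2 ≤ Sum.elim (block 2 ℓ) (block (2 + ℓ) n) i ∧
      Sum.elim (block 2 ℓ) (block (2 + ℓ) n) i < q := by
    refine Sum.forall.2 ⟨fun i => ?_, fun i => ?_⟩ <;> simp only [Sum.elim_inl, Sum.elim_inr, block]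
      <;> omega
  intro b h0 h1
  rw [applyAt_ctl (wiresOK_ctrl0 hq hi hr) _ _ ((ctlHolds_ctrl0 hq).2 h0)]
  refine Finset.sum_congr rfl fun v _ => ?_
  rw [h]
  · congr 2
    · funext i
      rcases i with i | i <;> rfl
    · funext i
      exact extend_of_eq hi _ v b _ (Sum.inl i) rfl
    · funext i
      exact extend_of_eq hi _ v b _ (Sum.inr i) rfl
    · funext i
      exact extend_of_not _ v b _ (sum_elim_block_ne (fun j => by omega) fun j => by omega)
  · rw [extend_of_not _ v b _ (sum_elim_block_ne (fun j => by omega) fun j => by omega)]; exact h0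
  · rw [extend_of_not _ v b _ (sum_elim_block_ne (fun j => by omega) fun j => by omega)]; exact h1

lemma Represents.dataFeat (hq : q = 2 + ℓ + n + N) {ψ : Bits q → ℂ}
    {G : Bits ℓ → Bits n → Bits N → ℂ} (h : Represents hq ψ G)
    (U : Matrix (Fin n ⊕ Fin N → Bool) (Fin n ⊕ Fin N → Bool) ℂ) :
    Represents hq
      (applyAt [(0, 1, true)] (Sum.elim (block (2 + ℓ) n) (block (2 + ℓ + n) N)) U ψ)
      fun i d z => ∑ v, U (Sum.elim d z) v * G i (v ∘ Sum.inl) (v ∘ Sum.inr) := by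
  have hi := injective_sum_block (a := 2 + ℓ) (k := n) (b := 2 + ℓ + n) (k' := N) le_rfl
  have hr : ∀ i, 2 ≤ Sum.elim (block (2 + ℓ) n) (block (2 + ℓ + n) N) i ∧
      Sum.elim (block (2 + ℓ) n) (block (2 + ℓ + n) N) i < q := by
    refine Sum.forall.2 ⟨fun i => ?_, fun i => ?_⟩ <;> simp only [Sum.elim_inl, Sum.elim_inr, block]
      <;> omega
  intro b h0 h1
  rw [applyAt_ctl (wiresOK_ctrl0 hq hi hr) _ _ ((ctlHolds_ctrl0 hq).2 h0)]
  refine Finset.sum_congr rfl fun v _ => ?_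
  rw [h]
  · congr 2
    · funext i
      rcases i with i | i <;> rfl
    · funext i
      exact extend_of_not _ v b _ (sum_elim_block_ne (fun j => by omega) fun j => by omega)
    · funext i
      exact extend_of_eq hi _ v b _ (Sum.inl i) rfl
    · funext i
      exact extend_of_eq hi _ v b _ (Sum.inr i) rfl
  · rw [extend_of_not _ v b _ (sum_elim_block_ne (fun j => by omega) fun j => by omega)]; exact h0
  · rw [extend_of_not _ v b _ (sum_elim_block_ne (fun j => by omega) fun j => by omega)]; exact h1

lemma sum_involution {α : Type} [Fintype α] [DecidableEq α] {σ : α → α}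
    (hσ : Function.Involutive σ) (u : α) (F : α → ℂ) :
    ∑ v, (if u = σ v then (1 : ℂ) else 0) * F v = F (σ u) := by
  rw [Finset.sum_eq_single (σ u)]
  · rw [hσ u, if_pos rfl, one_mul]
  · intro v _ hv
    rw [if_neg, zero_mul]
    rintro rfl
    exact hv (hσ v).symm
  · simp

lemma Represents.load (hq : q = 2 + ℓ + n + N) {ψ : Bits q → ℂ}
    {G : Bits ℓ → Bits n → Bits N → ℂ} (h : Represents hq ψ G) (x : Bits n) :
    Represents hq (applyAt [(0, 1, true)] (block (2 + ℓ) n) (loadMatrix x) ψ)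
      fun i d z => G i (fun j => xor (d j) (x j)) z := by
  intro b h0 h1
  rw [h.data hq _ b h0 h1]
  exact sum_involution (involutive_load x) _ fun v => G _ v _

lemma Represents.lookup (hq : q = 2 + ℓ + n + N) {ψ : Bits q → ℂ}
    {G : Bits ℓ → Bits n → Bits N → ℂ} (h : Represents hq ψ G) (f : Bits ℓ → Bits n) :
    Represents hq
      (applyAt [(0, 1, true)] (Sum.elim (block 2 ℓ) (block (2 + ℓ) n)) (lookupMatrix f) ψ)
      fun i d z => G i (fun j => xor (d j) (f i j)) z := by
  intro b h0 h1
  rw [h.addrData hq _ b h0 h1]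
  exact sum_involution (involutive_lookup f) _ fun v => G (v ∘ Sum.inl) (v ∘ Sum.inr) _

lemma Represents.hadStep (hq : q = 2 + ℓ + n + N) {ψ : Bits q → ℂ}
    {G : Bits ℓ → Bits n → Bits N → ℂ} (h : Represents hq ψ G) (k : Fin ℓ) :
    Represents hq (hadStep k ψ) fun i d z =>
      (1 : ℂ) / (Real.sqrt 2 : ℝ) * G (Function.update i k false) d z +
      (if i k then (-1 : ℂ) else 1) / (Real.sqrt 2 : ℝ) * G (Function.update i k true) d z := by
  intro b h0 h1
  have hu : ∀ (v : Bool) (j : ℕ) (hj : j < q), j ≠ 2 + k →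
      Function.update b ⟨2 + k, by omega⟩ v ⟨j, hj⟩ = b ⟨j, hj⟩ := by
    intro v j hj hne
    rw [Function.update_of_ne]
    intro h'; exact hne (Fin.mk.inj_iff.1 h')
  have hG : ∀ v, ψ (Function.update b ⟨2 + k, by omega⟩ v) =
      G (Function.update (addrBits hq b) k v) (dataBits hq b) (featBits hq b) := by
    intro v
    rw [h]
    · congr 1
      · funext i
        by_cases hi : i = k
        · subst hi
          simp [addrBits]
        · rw [Function.update_of_ne hi]
          exact hu _ _ _ fun h' => hi (Fin.ext (by omega))
      · funext i; exact hu _ _ _ (by omega)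
      · funext i; exact hu _ _ _ (by omega)
    · rw [hu _ _ _ (by omega)]; exact h0
    · rw [hu _ _ _ (by omega)]; exact h1
  rw [QSVM.hadStep, hadamardGate, applyAt_gate (w := 2 + (k : ℕ)) (by omega) (by simp; omega) _ _
    ((ctlHolds_ctrl0 hq).2 h0), hG, hG]
  simp only [addrBits, Bool.and_true, Bool.and_false, Bool.false_eq_true, if_false]
  congr!

/-- Hadamard gates turn the zero address into the uniform superposition. -/
lemma Represents.hadMap (hq : q = 2 + ℓ + n + N) {ψ : Bits q → ℂ} {F : Bits n → Bits N → ℂ}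
    (h : Represents hq ψ fun i d z => if i = fun _ => false then F d z else 0) :
    Represents hq (hadMap false ℓ ψ) fun _ d z => (1 / (Real.sqrt 2 : ℝ) : ℂ) ^ ℓ * F d z := by
  have key : ∀ j ≤ ℓ, Represents hq
      (composeFirst (fun i => QSVM.hadStep (if false then ℓ - 1 - i else i)) j ψ)
      fun i d z => if ∀ k : Fin ℓ, j ≤ (k : ℕ) → i k = false then
        (1 / (Real.sqrt 2 : ℝ) : ℂ) ^ j * F d z else 0 := by
    intro j hj
    induction j with
    | zero =>
      intro b h0 h1
      rw [composeFirst, h b h0 h1]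
      simp only [Nat.zero_le, forall_const, pow_zero, one_mul, funext_iff]
    | succ j ih =>
      intro b h0 h1
      have := (ih (by omega)).hadStep hq ⟨j, by omega⟩ b h0 h1
      simp only [composeFirst, Bool.false_eq_true, if_false] at this ⊢
      rw [this]
      generalize addrBits hq b = i
      have c1 : (∀ k : Fin ℓ, j ≤ (k : ℕ) →
          Function.update i ⟨j, by omega⟩ false k = false) ↔
          ∀ k : Fin ℓ, j + 1 ≤ (k : ℕ) → i k = false := by
        constructor
        · intro H k hk
          rw [← H k (by omega), Function.update_of_ne]
          rintro rfl; simp at hk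
        · intro H k hk
          by_cases hkj : k = ⟨j, by omega⟩
          · rw [hkj, Function.update_self]
          · rw [Function.update_of_ne hkj]
            refine H k ?_
            have : (k : ℕ) ≠ j := fun h' => hkj (Fin.ext h')
            omega
      have c2 : ¬ (∀ k : Fin ℓ, j ≤ (k : ℕ) →
          Function.update i ⟨j, by omega⟩ true k = false) := by
        intro H
        have := H ⟨j, by omega⟩ le_rfl
        simp at this
      rw [if_neg c2]
      simp only [c1]
      split_ifs <;> simp [pow_succ] <;> ring
  have := key ℓ le_rfl
  intro b h0 h1
  rw [QSVM.hadMap, this b h0 h1]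
  exact if_pos fun k hk => absurd k.isLt (by omega)

end Registers

/-- The inner product of the `s`-th stored vector, with the feature state of the respective point
attached to each address, and of the uniform superposition of all addresses, with the feature state
of the new point attached. -/
def Memory.overlap (M : Memory) (s : ℕ) : ℂ :=
  ∑ i : Bits M.ℓ, conj (M.prepU s i fun _ => false) *
    ((1 / (Real.sqrt 2 : ℝ) : ℂ) ^ M.ℓ * ∑ z : Bits M.N,
      conj (M.featU (Sum.elim (M.cell i) z) (Sum.elim (M.cell i) fun _ => false)) *
        M.featU (Sum.elim M.point z) (Sum.elim M.point fun _ => false))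

/-- The feature map keeps the new point in the data register. -/
def Memory.KeepsPoint (M : Memory) : Prop :=
  ∀ (x' : Bits M.n) (z : Bits M.N), x' ≠ M.point →
    M.featU (Sum.elim x' z) (Sum.elim M.point fun _ => false) = 0

/-- The basis state in which only wire `0` is set. -/
def ket1 (q : ℕ) : Bits q := fun w => decide ((w : ℕ) = 0)

/-- `overlapCircuit` without its last gate. -/
def innerCircuit : Circuit := overlapCircuit.dropLast

lemma sum_sumElim {α β : Type} [Fintype α] [Fintype β] [DecidableEq α] [DecidableEq β]
    (F : (α ⊕ β → Bool) → ℂ) :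
    ∑ v, F v = ∑ a : α → Bool, ∑ b : β → Bool, F (Sum.elim a b) := by
  rw [← Fintype.sum_prod_type', ← (Equiv.sumArrowEquivProdArrow α β Bool).symm.sum_comp]
  rfl

/-- The controlled part of the circuit maps the component in which wire `0` is set and all other
wires are zero, with amplitude `χ`, to a vector whose component there is `χ` times the overlap. -/
lemma innerCircuit_apply {M : Memory} (hK : M.KeepsPoint) {r : ℕ → ℕ} (z : ℕ → ℝ)
    (hr : SizesOK M r) {q : ℕ} (hq : q = 2 + M.ℓ + M.n + M.N) (χ : Bool → ℂ) :
    innerCircuit.run M r z (hadMap false (r 1) (wireState (q := q) χ)) (ket1 q) =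
      χ true * M.overlap (r 6) := by
  have h0 : Represents hq (wireState (q := q) χ) fun i d z => if i = fun _ => false then
      (if d = (fun _ => false) ∧ z = (fun _ => false) then χ true else 0) else 0 := by
    intro b h0 h1
    have hq0 : 0 < q := by omega
    unfold wireState
    rw [dif_pos hq0, h0]
    beta_reduce
    rw [← ite_and]
    refine if_congr ?_ rfl rfl
    constructor
    · intro H
      exact ⟨funext fun i => H _ (by simp), funext fun i => H _ (by simp),
        funext fun i => H _ (by simp)⟩
    · rintro ⟨ha, hd, hf⟩ ⟨w, hw⟩ hw0
      simp only [ne_eq] at hw0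
      by_cases w1 : w = 1
      · subst w1; exact h1
      by_cases w2 : w < 2 + M.ℓ
      · obtain ⟨k, rfl⟩ := Nat.exists_eq_add_of_le (show 2 ≤ w by omega)
        exact congrFun ha ⟨k, by omega⟩
      by_cases w3 : w < 2 + M.ℓ + M.n
      · obtain ⟨k, rfl⟩ := Nat.exists_eq_add_of_le (show 2 + M.ℓ ≤ w by omega)
        exact congrFun hd ⟨k, by omega⟩
      · obtain ⟨k, rfl⟩ := Nat.exists_eq_add_of_le (show 2 + M.ℓ + M.n ≤ w by omega)
        exact congrFun hf ⟨k, by omega⟩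
  have h1 := h0.hadMap hq
  have h2 := h1.load hq M.point
  have h3 := h2.dataFeat hq M.featU
  have h4 := h3.load hq M.point
  have h5 := h4.lookup hq M.cell
  have h6 := h5.dataFeat hq M.featU.conjTranspose
  have h7 := h6.lookup hq M.cell
  have h8 := (h7.addr hq (M.prepU (r 6)).conjTranspose) (ket1 q) (by simp [ket1]) (by simp [ket1])
  have ea : addrBits hq (ket1 q) = fun _ => false := by funext i; simp [addrBits, ket1]
  have ed : dataBits hq (ket1 q) = fun _ => false := by funext i; simp [dataBits, ket1]
  have ef : featBits hq (ket1 q) = fun _ => false := by funext i; simp [featBits, ket1]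
  rw [ea, ed, ef] at h8
  have hrun : innerCircuit.run M r z (hadMap false (r 1) (wireState (q := q) χ)) (ket1 q) =
      applyAt [(0, 1, true)] (block 2 M.ℓ) (M.prepU (r 6)).conjTranspose
      (applyAt [(0, 1, true)] (Sum.elim (block 2 M.ℓ) (block (2 + M.ℓ) M.n)) (lookupMatrix M.cell)
      (applyAt [(0, 1, true)] (Sum.elim (block (2 + M.ℓ) M.n) (block (2 + M.ℓ + M.n) M.N))
        M.featU.conjTranspose
      (applyAt [(0, 1, true)] (Sum.elim (block 2 M.ℓ) (block (2 + M.ℓ) M.n)) (lookupMatrix M.cell)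
      (applyAt [(0, 1, true)] (block (2 + M.ℓ) M.n) (loadMatrix M.point)
      (applyAt [(0, 1, true)] (Sum.elim (block (2 + M.ℓ) M.n) (block (2 + M.ℓ + M.n) M.N)) M.featU
      (applyAt [(0, 1, true)] (block (2 + M.ℓ) M.n) (loadMatrix M.point)
      (hadMap false M.ℓ (wireState (q := q) χ)))))))) (ket1 q) := by
    simp [innerCircuit, overlapCircuit, Circuit.run, ctrlVals, ctrl0, NExp.eval, Op.apply,
      hr.addr, hr.data]
  rw [hrun, h8, Memory.overlap, Finset.mul_sum]
  refine Finset.sum_congr rfl fun i _ => ?_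
  rw [Matrix.conjTranspose_apply, mul_left_comm]
  congr 1
  -- the inner sum of the feature map has a single term
  have hin : ∀ (d : Bits M.n) (z : Bits M.N),
      ∑ v, M.featU (Sum.elim d z) v * ((1 / (Real.sqrt 2 : ℝ) : ℂ) ^ M.ℓ *
        (if (fun j => xor ((v ∘ Sum.inl) j) (M.point j)) = (fun _ => false) ∧
          v ∘ Sum.inr = (fun _ => false) then χ true else 0)) =
      M.featU (Sum.elim d z) (Sum.elim M.point fun _ => false) *
        ((1 / (Real.sqrt 2 : ℝ) : ℂ) ^ M.ℓ * χ true) := by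
    intro d z
    rw [Finset.sum_eq_single (Sum.elim M.point fun _ => false)]
    · simp
    · intro v _ hv
      rw [if_neg, mul_zero, mul_zero]
      rintro ⟨hv1, hv2⟩
      apply hv
      funext w
      rcases w with w | w
      · simpa using congrFun hv1 w
      · exact congrFun hv2 w
    · simp
  simp only [hin]
  rw [sum_sumElim, Finset.sum_eq_single (M.cell i), Finset.mul_sum, Finset.mul_sum]
  · refine Finset.sum_congr rfl fun z _ => ?_
    simp [Matrix.conjTranspose_apply]
    ring
  · intro d _ hd
    refine Finset.sum_eq_zero fun z _ => ?_
    rw [hK, zero_mul, mul_zero]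
    intro h'
    apply hd
    funext j
    have := congrFun h' j
    simp only [Sum.elim_comp_inl] at this
    revert this
    generalize d j = u, M.cell i j = v, M.point j = w
    revert u v w
    decide
  · simp

lemma hadMap_ctl_not {ℓ q : ℕ} (hq : 0 < q) {b : Bits q} (hb : b ⟨0, hq⟩ = false) (inv : Bool)
    (ψ : Bits q → ℂ) : hadMap inv ℓ ψ b = ψ b := by
  have hc : ¬ CtlHolds [(0, 1, true)] b := by
    intro h
    have := h _ List.mem_cons_self ⟨0, hq⟩ (Nat.zero_le _) (by simp)
    rw [hb] at this; cases this
  have : ∀ j, composeFirst (fun i => hadStep (if inv then ℓ - 1 - i else i)) j ψ b = ψ b := by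
    intro j
    induction j with
    | zero => rfl
    | succ j ih => rw [composeFirst, hadStep, applyAt_ctl_not _ _ hc, ih]
  exact this ℓ

lemma innerCircuit_ctl_not (M : Memory) (r : ℕ → ℕ) (z : ℕ → ℝ) {q : ℕ} (hq : 0 < q) {b : Bits q}
    (hb : b ⟨0, hq⟩ = false) (ψ : Bits q → ℂ) : innerCircuit.run M r z ψ b = ψ b := by
  have hc : ¬ CtlHolds [(0, 1, true)] b := by
    intro h
    have := h _ List.mem_cons_self ⟨0, hq⟩ (Nat.zero_le _) (by simp)
    rw [hb] at this; cases this
  simp [innerCircuit, overlapCircuit, Circuit.run, ctrlVals, ctrl0, NExp.eval, Op.apply,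
    applyAt_ctl_not _ _ hc]

/-- On `|0⟩`, the branch in which wire `0` is unset contributes `-L` and the other one contributes
the overlap; the last Hadamard gate adds them up. -/
lemma offsetMap_amplitude {M : Memory} (hK : M.KeepsPoint) {r : ℕ → ℕ} (z : ℕ → ℝ)
    (hr : SizesOK M r) {q : ℕ} (hq : q = 2 + M.ℓ + M.n + M.N) :
    offsetMap M r z false (ket0 q) (fun _ => false) =
      rotPhase (z 6) * ((1 / Real.sqrt (2 * (1 + z 6 ^ 2)) : ℝ) * (M.overlap (r 6) - z 6)) := by
  have hq0 : 0 < q := by omega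
  have hsplit : overlapCircuit = innerCircuit ++ [([], .hadamard (.const 0))] := rfl
  simp only [offsetMap, Bool.false_eq_true, if_false]
  rw [hsplit, Circuit.run_append, rotCircuit_ket0 M r z hq0]
  set χ : Bool → ℂ := fun v => rotPhase (z 6) *
    (if v then (Real.cos (Real.arctan (z 6)) : ℂ) else -(Real.sin (Real.arctan (z 6)) : ℂ)) with hχ
  simp only [Circuit.run, Op.apply, NExp.eval, ctrlVals, List.map_nil, hadamardGate]
  rw [applyAt_gate hq0 (by simp) _ _ (ctlHolds_nil _)]
  have e0 : Function.update (fun _ => false : Bits q) ⟨0, hq0⟩ false = fun _ => false := by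
    funext w; simp [Function.update_apply]
  have e1 : Function.update (fun _ => false : Bits q) ⟨0, hq0⟩ true = ket1 q := by
    funext w
    simp [Function.update_apply, ket1, Fin.ext_iff]
  rw [e0, e1, innerCircuit_apply hK z hr hq, innerCircuit_ctl_not M r z hq0 rfl,
    hadMap_ctl_not hq0 rfl]
  have hw : wireState χ (fun _ => false : Bits q) = χ false := by
    simp [wireState, hq0]
  have hs : Real.sqrt (2 * (1 + z 6 ^ 2)) = Real.sqrt 2 * Real.sqrt (1 + z 6 ^ 2) :=
    Real.sqrt_mul (by norm_num) _
  rw [hw, hχ, hs]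
  simp only [Real.cos_arctan, Real.sin_arctan, Bool.false_and, Bool.false_eq_true, if_false, if_true]
  push_cast
  have h1 : ((Real.sqrt (1 + z 6 ^ 2) : ℝ) : ℂ) ≠ 0 := by
    rw [Complex.ofReal_ne_zero]; positivity
  have h2 := sqrt_two_ne_zero
  field_simp
  ring

/-- The overlap is an amplitude of a unit vector. -/
lemma norm_overlap_le {M : Memory} (hM : M.IsUnitary) (hK : M.KeepsPoint) (s : ℕ) :
    ‖M.overlap s‖ ≤ 1 := by
  let r : ℕ → ℕ := fun k => if k = 1 then M.ℓ else if k = 2 then M.n else if k = 3 then M.N else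
    if k = 6 then s else 0
  have hr : SizesOK M r := ⟨rfl, rfl, rfl, rfl⟩
  have hq0 : 0 < 2 + M.ℓ + M.n + M.N := by omega
  have h := innerCircuit_apply hK (fun _ => 0) hr rfl (fun v => if v then 1 else 0)
  simp only [if_true, one_mul] at h
  change _ = M.overlap s at h
  rw [← h]
  set O := fun ψ : Bits (2 + M.ℓ + M.n + M.N) → ℂ =>
    innerCircuit.run M r (fun _ => 0) (hadMap false (r 1) ψ) with hO
  have hu : IsUnitaryMap O :=
    (Circuit.isUnitaryMap hM _ _ _).comp (isUnitaryMap_hadMap _ _)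
  have hn := hu.sum_norm_sq (wireState fun v => if v then 1 else 0)
  have h1 : ∑ b : Bits (2 + M.ℓ + M.n + M.N),
      ‖wireState (fun v => if v then (1 : ℂ) else 0) b‖ ^ 2 = 1 := by
    rw [Finset.sum_eq_single (ket1 _)]
    · simp [wireState, hq0]
      simp [ket1]
    · intro b _ hb
      have : wireState (fun v => if v then (1 : ℂ) else 0) b = 0 := by
        unfold wireState
        rw [dif_pos hq0]
        split_ifs with g1
        · cases g2 : b ⟨0, hq0⟩
          · simp
          · exfalso; apply hb
            funext w
            by_cases hw : (w : ℕ) = 0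
            · rw [Fin.ext (b := ⟨0, hq0⟩) hw]; simpa [ket1] using g2
            · rw [g1 w hw]; simp [ket1, hw]
        · rfl
      rw [this]; simp
    · simp
  rw [h1] at hn
  have : ‖O (wireState fun v => if v then 1 else 0) (ket1 _)‖ ^ 2 ≤ 1 := by
    rw [← hn]
    exact Finset.single_le_sum (f := fun b => ‖O (wireState fun v => if v then 1 else 0) b‖ ^ 2)
      (fun b _ => by positivity) (Finset.mem_univ _)
  exact (sq_le_one_iff₀ (norm_nonneg _)).1 this

/-! ### Amplitude amplification -/

lemma braket_sub_smul {q : ℕ} (φ ψ χ : Bits q → ℂ) (z : ℂ) :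
    braket φ (ψ - z • χ) = braket φ ψ - z * braket φ χ := by
  simp only [braket, Pi.sub_apply, Pi.smul_apply, smul_eq_mul, mul_sub, Finset.sum_sub_distrib,
    Finset.mul_sum]
  congr 1
  exact Finset.sum_congr rfl fun b _ => by ring

/-- Iteration of the product of the reflections about `O |0⟩` and `|0⟩`, applied to `O |0⟩`. The
two reflections act on the plane spanned by these two vectors, whose angle is `π / 2 - θ`. -/
lemma amplification {q : ℕ} {O O' S : (Bits q → ℂ) → Bits q → ℂ} (hO : IsUnitaryMap O)
    (hO' : IsUnitaryMap O') (hinv : ∀ ψ, O' (O ψ) = ψ)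
    (hS : ∀ ψ, S ψ = ψ - (2 * braket (ket0 q) ψ) • ket0 q) {ω : ℂ} (hω : ‖ω‖ = 1) {θ : ℝ}
    (hθ : braket (ket0 q) (O (ket0 q)) = ω * Real.sin θ) (k : ℕ) :
    braket (ket0 q) ((fun ψ => O (S (O' (S ψ))))^[k] (O (ket0 q))) =
      (-1) ^ k * (ω * Real.sin ((2 * k + 1) * θ)) ∧
    braket (O (ket0 q)) ((fun ψ => O (S (O' (S ψ))))^[k] (O (ket0 q))) =
      (-1) ^ k * Real.cos (2 * k * θ) := by
  set e := ket0 q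
  have hee : braket e e = 1 := by rw [braket_ket0]; simp [e, ket0]
  have hSb : ∀ φ ψ, braket φ (S ψ) = braket φ ψ - 2 * braket e ψ * braket φ e := fun φ ψ => by
    rw [hS, braket_sub_smul]
  have hωω : conj ω * ω = 1 := by
    rw [Complex.conj_mul', hω]; simp
  have hfe : braket (O e) e = conj ω * Real.sin θ := by
    rw [← braket_conj, hθ, map_mul, Complex.conj_ofReal]
  -- the two inner products satisfy a linear recursion, which the addition theorems solve
  induction k with
  | zero =>
    simp only [Function.iterate_zero, id_eq, pow_zero, one_mul, Nat.cast_zero, mul_zero, zero_add,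
      zero_mul, Real.cos_zero, Complex.ofReal_one]
    exact ⟨hθ, by rw [hO.braket_map, hee]⟩
  | succ k ih =>
    obtain ⟨ihp, ihr⟩ := ih
    rw [Function.iterate_succ_apply']
    set u := (fun ψ => O (S (O' (S ψ))))^[k] (O e)
    have h1 : braket e (S u) = -braket e u := by rw [hSb, hee]; ring
    have h2 : braket (O e) (S u) =
        braket (O e) u - 2 * braket e u * (conj ω * Real.sin θ) := by rw [hSb, hfe]
    have h3 : braket e (O' (S u)) = braket (O e) (S u) := by
      rw [← hO'.braket_map (O e), hinv]
    have h4 : braket (O' e) (O' (S u)) = braket e (S u) := hO'.braket_map _ _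
    have h5 : braket (O' e) e = ω * Real.sin θ := by
      rw [← hθ, ← hO'.braket_map e (O e), hinv]
    have hr : braket (O e) (O (S (O' (S u)))) = -braket (O e) (S u) := by
      rw [hO.braket_map, hSb, hee, h3]; ring
    have hp : braket e (O (S (O' (S u)))) =
        braket e (S u) - 2 * braket (O e) (S u) * (ω * Real.sin θ) := by
      rw [← hO'.braket_map, hinv, hSb, h4, h3, h5]
    have c1 : Real.cos (2 * (k + 1 : ℕ) * θ) =
        Real.cos (2 * k * θ) - 2 * Real.sin θ * Real.sin ((2 * k + 1) * θ) := by
      have e1 : (2 * (k + 1 : ℕ) * θ : ℝ) = (2 * k + 1) * θ + θ := by push_cast; ring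
      have e2 : (2 * k * θ : ℝ) = (2 * k + 1) * θ - θ := by ring
      rw [e1, e2, Real.cos_add, Real.cos_sub]; ring
    have c2 : Real.sin ((2 * (k + 1 : ℕ) + 1) * θ) =
        Real.sin ((2 * k + 1) * θ) + 2 * Real.sin θ * Real.cos (2 * (k + 1 : ℕ) * θ) := by
      have e1 : ((2 * (k + 1 : ℕ) + 1) * θ : ℝ) = 2 * (k + 1 : ℕ) * θ + θ := by ring
      have e2 : ((2 * k + 1) * θ : ℝ) = 2 * (k + 1 : ℕ) * θ - θ := by push_cast; ring
      rw [e1, e2, Real.sin_add, Real.sin_sub]; ring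
    have hr' : braket (O e) (O (S (O' (S u)))) =
        (-1) ^ (k + 1) * Real.cos (2 * (k + 1 : ℕ) * θ) := by
      rw [hr, h2, ihr, ihp, c1]
      push_cast
      linear_combination (2 * (-1) ^ k * Complex.sin θ * Complex.sin ((2 * k + 1) * θ)) * hωω
    refine ⟨?_, hr'⟩
    have : braket (O e) (S u) = (-1) ^ k * Real.cos (2 * (k + 1 : ℕ) * θ) := by
      have := hr.symm.trans hr'
      rw [pow_succ] at this
      linear_combination -this
    rw [hp, this, h1, ihp, c2]
    push_cast
    ring

/-! ### The measured trial -/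

/-- Reflection about `|0⟩`. -/
def reflCircuit : Circuit :=
  [([], .not (.const 0)),
   ([⟨.const 1, .add (.add (.add (.const 1) (nreg 1)) (nreg 2)) (nreg 3), false⟩],
      .phase (.const 0) piExp),
   ([], .not (.const 0))]

/-- Set the flag if all other wires are zero. -/
def flagCircuit : Circuit :=
  [([⟨.const 0, .const 1, false⟩, ⟨.const 2, .add (.add (nreg 1) (nreg 2)) (nreg 3), false⟩],
      .not (.const 1))]

/-- One step of amplitude amplification. -/
def amplifyStep : Prog :=
  .seq reflCircuit.prog (.seq (offsetProg true) (.seq reflCircuit.prog (offsetProg false)))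

/-- Reset; prepare and amplify, with the number of steps in register `8`; then measure whether
the state is `|0⟩`. The outcome minus real register `11` is added to real register `8`. -/
def trial : Prog :=
  .seq .reset (.seq (offsetProg false) (.seq (.loop (.ofNat (nreg 8)) amplifyStep)
    (.seq flagCircuit.prog (.seq (.measure (.const 7) (.const 1))
      (.setReal (.const 8) (.add (rreg 8) (.sub (.ofNat (nreg 7)) (rreg 11))))))))

lemma applyAt_not {q : ℕ} {l : List (ℕ × ℕ × Bool)} {w : ℕ} (hw : w < q)
    (hl : ∀ c ∈ l, c.1 + c.2.1 ≤ q ∧ ¬ (c.1 ≤ w ∧ w < c.1 + c.2.1))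
    (ψ : Bits q → ℂ) {b : Bits q} (hb : CtlHolds l b) :
    applyAt l (block w 1) notGate ψ b = ψ (Function.update b ⟨w, hw⟩ (!b ⟨w, hw⟩)) := by
  rw [notGate, applyAt_gate hw hl _ _ hb]
  cases b ⟨w, hw⟩ <;> simp

lemma reflCircuit_run {M : Memory} {r : ℕ → ℕ} (z : ℕ → ℝ) (hr : SizesOK M r) {q : ℕ}
    (hq : q = 2 + M.ℓ + M.n + M.N) (ψ : Bits q → ℂ) :
    reflCircuit.run M r z ψ = ψ - (2 * braket (ket0 q) ψ) • ket0 q := by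
  have hq0 : 0 < q := by omega
  rw [braket_ket0]
  funext b
  simp only [reflCircuit, Circuit.run, ctrlVals, List.map, Op.apply, NExp.eval, eval_piExp,
    hr.addr, hr.data, hr.feat]
  rw [applyAt_not hq0 (by simp) _ (ctlHolds_nil _)]
  set b' := Function.update b ⟨0, hq0⟩ (!b ⟨0, hq0⟩) with hb'
  have hb0 : b' ⟨0, hq0⟩ = !b ⟨0, hq0⟩ := Function.update_self _ _ _
  have hback : Function.update b' ⟨0, hq0⟩ (!b' ⟨0, hq0⟩) = b := by
    rw [hb0, Bool.not_not, hb', Function.update_idem, Function.update_eq_self]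
  have hctl : CtlHolds [(1, 1 + M.ℓ + M.n + M.N, false)] b' ↔
      ∀ w : Fin q, (w : ℕ) ≠ 0 → b w = false := by
    simp only [CtlHolds, List.mem_singleton, forall_eq]
    refine forall_congr' fun w => ?_
    have hw : (w : ℕ) ≠ 0 → b' w = b w := fun h =>
      Function.update_of_ne (fun h' => h (by rw [h'])) _ _
    constructor
    · intro h h0; rw [← hw h0]; exact h (by omega) (by omega)
    · intro h h1 h2; rw [hw (by omega)]; exact h (by omega)
  have hn : ∀ b'', applyAt [] (block 0 1) notGate ψ b'' =
      ψ (Function.update b'' ⟨0, hq0⟩ (!b'' ⟨0, hq0⟩)) := fun b'' =>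
    applyAt_not hq0 (by simp) _ (ctlHolds_nil _)
  by_cases hc : CtlHolds [(1, 1 + M.ℓ + M.n + M.N, false)] b'
  · rw [phaseGate, applyAt_gate hq0 (by simp; omega) _ _ hc]
    have hb := hctl.1 hc
    cases h : b ⟨0, hq0⟩
    · have hz : b = fun _ => false := by
        funext w
        by_cases hw : (w : ℕ) = 0
        · rw [Fin.ext (b := ⟨0, hq0⟩) hw]; exact h
        · exact hb w hw
      have hu : Function.update b' ⟨0, hq0⟩ true = b' := by
        rw [h] at hb0
        simp only [Bool.not_false] at hb0
        rw [← hb0, Function.update_eq_self]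
      rw [hb0, h, hu, hn b', hback]
      simp [hz, ket0, Complex.exp_pi_mul_I]
      ring
    · have hz : b ≠ fun _ => false := by
        intro h'; rw [h'] at h; cases h
      have hu : Function.update b' ⟨0, hq0⟩ false = b' := by
        rw [h] at hb0
        simp only [Bool.not_true] at hb0
        rw [← hb0, Function.update_eq_self]
      rw [hb0, h, hu, hn b', hback]
      simp [hz, ket0]
  · rw [applyAt_ctl_not _ _ hc, hn, hback]
    have hz : b ≠ fun _ => false := by
      intro h'; apply hc; rw [hctl]; intro w _; rw [h']
    simp [ket0, hz]

/-- After `flagCircuit`, the flag is set with the probability of the state `|0⟩`. -/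
lemma flagCircuit_run {M : Memory} {r : ℕ → ℕ} (z : ℕ → ℝ) (hr : SizesOK M r) {q : ℕ}
    (hq : q = 2 + M.ℓ + M.n + M.N) {ψ : Bits q → ℂ} (hψ : FlagClear ψ) :
    ∑ b, ‖project ⟨1, by omega⟩ true (flagCircuit.run M r z ψ) b‖ ^ 2 =
      ‖ψ fun _ => false‖ ^ 2 := by
  have hq1 : 1 < q := by omega
  let b₁ : Bits q := Function.update (fun _ => false) ⟨1, hq1⟩ true
  rw [Finset.sum_eq_single b₁]
  · have hc : CtlHolds [(0, 1, false), (2, M.ℓ + M.n + M.N, false)] b₁ := by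
      intro c hc w h1 h2
      have hw : (w : ℕ) ≠ 1 := by
        simp only [List.mem_cons, List.not_mem_nil, or_false] at hc
        rcases hc with rfl | rfl <;> simp at h1 h2 <;> omega
      have : b₁ w = false := Function.update_of_ne (fun h => hw (by rw [h])) _ _
      rw [this]
      simp only [List.mem_cons, List.not_mem_nil, or_false] at hc
      rcases hc with rfl | rfl <;> rfl
    simp only [project, flagCircuit, Circuit.run, ctrlVals, List.map, Op.apply, NExp.eval, hr.addr,
      hr.data, hr.feat]
    rw [applyAt_not hq1 (by simp; omega) _ hc]
    simp [b₁]
  · intro b _ hb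
    have : project ⟨1, hq1⟩ true (flagCircuit.run M r z ψ) b = 0 := by
      unfold project
      split_ifs with h
      · have hc : ¬ CtlHolds [(0, 1, false), (2, M.ℓ + M.n + M.N, false)] b := by
          intro hc
          apply hb
          funext w
          by_cases hw : (w : ℕ) = 1
          · rw [Fin.ext (b := ⟨1, hq1⟩) hw, h]; simp [b₁]
          · rw [show b₁ w = false from Function.update_of_ne (fun h => hw (by rw [h])) _ _]
            by_cases hw0 : (w : ℕ) = 0
            · exact hc _ List.mem_cons_self w (Nat.zero_le _) (by simp [hw0])
            · have h2 := hc (2, M.ℓ + M.n + M.N, false) (by simp) w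
              simp only at h2
              exact h2 (by omega) (by omega)
        simp only [flagCircuit, Circuit.run, ctrlVals, List.map, Op.apply, NExp.eval, hr.addr,
          hr.data, hr.feat]
        rw [applyAt_ctl_not _ _ hc]
        exact hψ b hq1 h
      · rfl
    rw [this]; simp
  · simp

lemma sum_project {q : ℕ} (w : Fin q) (ψ : Bits q → ℂ) :
    ∑ b, ‖project w false ψ b‖ ^ 2 + ∑ b, ‖project w true ψ b‖ ^ 2 = ∑ b, ‖ψ b‖ ^ 2 := by
  rw [← Finset.sum_add_distrib]
  refine Finset.sum_congr rfl fun b _ => ?_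
  unfold project
  cases b w <;> simp

/-- The action of `amplifyStep`. -/
def amplifyMap (M : Memory) (r : ℕ → ℕ) (z : ℕ → ℝ) {q : ℕ} (ψ : Bits q → ℂ) : Bits q → ℂ :=
  offsetMap M r z false (reflCircuit.run M r z (offsetMap M r z true (reflCircuit.run M r z ψ)))

lemma exec_amplifyStep (M : Memory) {q : ℕ} (c : Config q) (hc : SizesOK M c.nat) :
    ∃ t ≤ 800 * M.unit, amplifyStep.exec M c =
      [{ c with amp := amplifyMap M c.nat c.real c.amp, time := c.time + t }] := by
  obtain ⟨t1, ht1, h1⟩ := exec_offsetProg M true { c with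
    amp := reflCircuit.run M c.nat c.real c.amp, time := c.time + reflCircuit.time M c.nat } hc
  obtain ⟨t2, ht2, h2⟩ := exec_offsetProg M false { c with
    amp := reflCircuit.run M c.nat c.real
      (offsetMap M c.nat c.real true (reflCircuit.run M c.nat c.real c.amp))
    time := c.time + reflCircuit.time M c.nat + t1 + reflCircuit.time M c.nat } hc
  refine ⟨reflCircuit.time M c.nat + t1 + reflCircuit.time M c.nat + t2, ?_, ?_⟩
  · have hr : reflCircuit.time M c.nat ≤ 50 * M.unit := by
      simp only [Circuit.time, reflCircuit, Op.time, Op.size, NExp.size, RExp.size,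
        Memory.unit, NExp.eval, piExp, List.map, List.sum_cons, List.sum_nil, hc.addr, hc.data,
        hc.feat]
      omega
    omega
  · simp [amplifyStep, Prog.exec, Circuit.exec_prog, h1, h2, amplifyMap, ← add_assoc]

lemma isUnitaryMap_amplifyMap {M : Memory} (hM : M.IsUnitary) (r : ℕ → ℕ) (z : ℕ → ℝ) {q : ℕ} :
    IsUnitaryMap (amplifyMap (q := q) M r z) :=
  (isUnitaryMap_offsetMap hM r z false).comp ((Circuit.isUnitaryMap hM r z _).comp
    ((isUnitaryMap_offsetMap hM r z true).comp (Circuit.isUnitaryMap hM r z _)))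

lemma flagClear_amplifyMap {M : Memory} {r : ℕ → ℕ} {z : ℕ → ℝ} {q : ℕ}
    {ψ : Bits q → ℂ} (hψ : FlagClear ψ) : FlagClear (amplifyMap M r z ψ) := by
  have hR : ∀ {ψ : Bits q → ℂ}, FlagClear ψ → FlagClear (reflCircuit.run M r z ψ) := by
    refine fun h => Circuit.flagClear_run ?_ h
    simp [reflCircuit, Op.OffFlag, NExp.eval]
  exact flagClear_offsetMap _ (hR (flagClear_offsetMap _ (hR hψ)))

lemma IsUnitaryMap.iterate {q : ℕ} {O : (Bits q → ℂ) → Bits q → ℂ} (h : IsUnitaryMap O) (k : ℕ) :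
    IsUnitaryMap (O^[k]) := by
  induction k with
  | zero => exact isUnitaryMap_id
  | succ k ih => rw [Function.iterate_succ']; exact h.comp ih

/-- The state before the measurement, for the amplified circuit. -/
def amplified (M : Memory) (r : ℕ → ℕ) (z : ℕ → ℝ) (q k : ℕ) : Bits q → ℂ :=
  (amplifyMap M r z)^[k] (offsetMap M r z false (ket0 q))

lemma flagClear_ket0 {q : ℕ} : FlagClear (ket0 q) := by
  intro b h hb
  unfold ket0
  rw [Pi.single_apply, if_neg]
  rintro rfl; cases hb

lemma flagClear_amplified (M : Memory) (r : ℕ → ℕ) (z : ℕ → ℝ) (q k : ℕ) :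
    FlagClear (amplified M r z q k) := by
  unfold amplified
  induction k with
  | zero => exact flagClear_offsetMap _ flagClear_ket0
  | succ k ih => rw [Function.iterate_succ_apply']; exact flagClear_amplifyMap ih

lemma sum_norm_sq_ket0 {q : ℕ} : ∑ b, ‖ket0 q b‖ ^ 2 = 1 := by
  rw [Finset.sum_eq_single (fun _ => false)]
  · simp [ket0]
  · intro b _ hb; simp [ket0, hb]
  · simp

lemma sum_norm_sq_amplified {M : Memory} (hM : M.IsUnitary) (r : ℕ → ℕ) (z : ℕ → ℝ) (q k : ℕ) :
    ∑ b, ‖amplified M r z q k b‖ ^ 2 = 1 := by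
  unfold amplified
  rw [((isUnitaryMap_amplifyMap hM r z).iterate k).sum_norm_sq,
    (isUnitaryMap_offsetMap hM r z false).sum_norm_sq, sum_norm_sq_ket0]

/-- The factor by which the difference of the overlap and `L` is scaled in the amplitude. -/
def offsetScale (L : ℝ) : ℝ := 1 / Real.sqrt (2 * (1 + L ^ 2))

lemma offsetScale_mul_le {a L : ℝ} (ha : |a| ≤ 1) : |offsetScale L * (a - L)| ≤ 1 := by
  have hp : 0 < Real.sqrt (2 * (1 + L ^ 2)) := Real.sqrt_pos.2 (by positivity)
  rw [offsetScale, one_div, abs_mul, abs_of_pos (inv_pos.2 hp), inv_mul_le_one₀ hp]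
  refine Real.le_sqrt_of_sq_le ?_
  rw [sq_abs]
  have : a ^ 2 ≤ 1 := by rw [← sq_abs]; nlinarith [abs_nonneg a]
  nlinarith [sq_nonneg (a + L)]

/-- The success probability of a trial: for the amplitude `sin θ`, it is `sin² ((2k+1)θ)`. -/
def successProb (a L : ℝ) (k : ℕ) : ℝ :=
  Real.sin ((2 * k + 1) * Real.arcsin (offsetScale L * (a - L))) ^ 2

/-- The probability of measuring `|0⟩` after `k` amplification steps. -/
lemma norm_amplified {M : Memory} (hM : M.IsUnitary) (hK : M.KeepsPoint) {r : ℕ → ℕ} (z : ℕ → ℝ)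
    (hr : SizesOK M r) {q : ℕ} (hq : q = 2 + M.ℓ + M.n + M.N) {a : ℝ} (ha : M.overlap (r 6) = a)
    (k : ℕ) : ‖amplified M r z q k fun _ => false‖ ^ 2 = successProb a (z 6) k := by
  have ha1 : |a| ≤ 1 := by
    have := norm_overlap_le hM hK (r 6)
    rwa [ha, Complex.norm_real] at this
  have hle := abs_le.1 (offsetScale_mul_le (L := z 6) ha1)
  have h := amplification (isUnitaryMap_offsetMap (q := q) hM r z false)
    (isUnitaryMap_offsetMap hM r z true) (offsetMap_inverse hM r z)
    (reflCircuit_run z hr hq) (norm_rotPhase (z 6))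
    (θ := Real.arcsin (offsetScale (z 6) * (a - z 6)))
    (by
      rw [braket_ket0, offsetMap_amplitude hK z hr hq, ha, Real.sin_arcsin hle.1 hle.2, offsetScale]
      push_cast; rfl) k
  have h' := h.1
  rw [braket_ket0] at h'
  change amplified M r z q k _ = _ at h'
  rw [h', norm_mul, norm_mul, norm_rotPhase, norm_pow, norm_neg, norm_one, one_pow, one_mul, one_mul,
    Complex.norm_real, Real.norm_eq_abs, sq_abs, successProb]

lemma successProb_nonneg (a L : ℝ) (k : ℕ) : 0 ≤ successProb a L k := sq_nonneg _

lemma successProb_le_one (a L : ℝ) (k : ℕ) : successProb a L k ≤ 1 := Real.sin_sq_le_one _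

/-! ### A program logic for running times and expectations -/

/-- Every branch of the execution of `p` on `c` satisfies `Post`, and the expectation of `g` after
the execution is at most `v`, relative to the weight of `c`. -/
def Triple (M : Memory) {q : ℕ} (p : Prog) (c : Config q) (Post : Config q → Prop)
    (g : Config q → ℝ) (v : ℝ) : Prop :=
  (∀ c' ∈ p.exec M c, Post c') ∧
    ((p.exec M c).map fun c' => c'.weight * g c').sum ≤ c.weight * v

section Logic

variable {M : Memory} {q : ℕ}

lemma Config.weight_nonneg (c : Config q) : 0 ≤ c.weight :=
  Finset.sum_nonneg fun _ _ => sq_nonneg _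

@[simp] lemma Config.weight_tick (c : Config q) (t : ℕ) : (c.tick t).weight = c.weight := rfl

lemma Triple.single {p : Prog} {c : Config q} {Post : Config q → Prop} {g : Config q → ℝ} {v : ℝ}
    {c' : Config q} (h : p.exec M c = [c']) (hw : c'.weight = c.weight) (hP : Post c')
    (hg : g c' ≤ v) : Triple M p c Post g v := by
  refine ⟨by simpa [h] using hP, ?_⟩
  rw [h]
  simpa [hw] using mul_le_mul_of_nonneg_left hg c.weight_nonneg

lemma Triple.mono {p : Prog} {c : Config q} {Post Post' : Config q → Prop} {g g' : Config q → ℝ}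
    {v v' : ℝ} (h : Triple M p c Post g v) (hP : ∀ c', Post c' → Post' c')
    (hg : ∀ c', Post c' → g' c' ≤ g c') (hv : v ≤ v') : Triple M p c Post' g' v' := by
  refine ⟨fun c' hc' => hP _ (h.1 c' hc'), le_trans ?_
    (h.2.trans (mul_le_mul_of_nonneg_left hv c.weight_nonneg))⟩
  exact List.sum_le_sum fun c' hc' =>
    mul_le_mul_of_nonneg_left (hg _ (h.1 c' hc')) c'.weight_nonneg

lemma sum_map_flatMap {α β : Type} (l : List α) (f : α → List β) (G : β → ℝ) :
    ((l.flatMap f).map G).sum = (l.map fun a => ((f a).map G).sum).sum := by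
  induction l with
  | nil => simp
  | cons a l ih => simp [ih]

lemma triple_flatMap {l : List (Config q)} {f : Config q → List (Config q)}
    {Mid : Config q → Prop} {h : Config q → ℝ} {w : ℝ} {Post : Config q → Prop} {g : Config q → ℝ}
    (hl : ∀ c ∈ l, Mid c) (hs : (l.map fun c => c.weight * h c).sum ≤ w)
    (hf : ∀ c, Mid c → (∀ c' ∈ f c, Post c') ∧
      ((f c).map fun c' => c'.weight * g c').sum ≤ c.weight * h c) :
    (∀ c' ∈ l.flatMap f, Post c') ∧ ((l.flatMap f).map fun c' => c'.weight * g c').sum ≤ w := by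
  constructor
  · intro c' hc'
    obtain ⟨c, hc, hcc⟩ := List.mem_flatMap.1 hc'
    exact (hf c (hl c hc)).1 c' hcc
  · rw [sum_map_flatMap]
    exact (List.sum_le_sum fun c hc => (hf c (hl c hc)).2).trans hs

lemma Triple.seq {p p' : Prog} {c : Config q} {Mid Post : Config q → Prop} {h g : Config q → ℝ}
    {v : ℝ} (h1 : Triple M p c Mid h v) (h2 : ∀ c', Mid c' → Triple M p' c' Post g (h c')) :
    Triple M (.seq p p') c Post g v :=
  triple_flatMap h1.1 h1.2 h2

lemma Triple.ite {a b : RExp} {p p' : Prog} {c : Config q} {Post : Config q → Prop}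
    {g : Config q → ℝ} {v : ℝ}
    (h1 : a.eval c.nat c.real ≤ b.eval c.nat c.real →
      Triple M p (c.tick (1 + a.size + b.size)) Post g v)
    (h2 : ¬ a.eval c.nat c.real ≤ b.eval c.nat c.real →
      Triple M p' (c.tick (1 + a.size + b.size)) Post g v) :
    Triple M (.ite a b p p') c Post g v := by
  unfold Triple
  simp only [Prog.exec]
  split_ifs with h
  · exact h1 h
  · exact h2 h

lemma Triple.loop {a : RExp} {p : Prog} {c : Config q} {n : ℕ}
    (hn : ⌈a.eval c.nat c.real⌉₊ = n) (Inv : ℕ → Config q → Prop) (g : ℕ → Config q → ℝ) {v : ℝ}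
    (h0 : Inv 0 (c.tick (1 + a.size))) (hv : g 0 (c.tick (1 + a.size)) ≤ v)
    (hs : ∀ i < n, ∀ c', Inv i c' → Triple M p (c'.tick 1) (Inv (i + 1)) (g (i + 1)) (g i c')) :
    Triple M (.loop a p) c (Inv n) (g n) v := by
  unfold Triple
  simp only [Prog.exec]
  rw [hn]
  clear hn
  have : ∀ j ≤ n, (∀ c' ∈ (fun cs : List (Config q) => cs.flatMap fun c' =>
        p.exec M (c'.tick 1))^[j] [c.tick (1 + a.size)], Inv j c') ∧
      (((fun cs : List (Config q) => cs.flatMap fun c' => p.exec M (c'.tick 1))^[j]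
        [c.tick (1 + a.size)]).map fun c' => c'.weight * g j c').sum ≤ c.weight * v := by
    intro j hj
    induction j with
    | zero =>
      refine ⟨by simpa using h0, ?_⟩
      simpa using mul_le_mul_of_nonneg_left hv c.weight_nonneg
    | succ j ih =>
      have ih := ih (by omega)
      rw [Function.iterate_succ_apply']
      exact triple_flatMap ih.1 ih.2 fun c' hc' => hs j (by omega) c' hc'
  exact this n le_rfl

lemma Triple.setNat {d a : NExp} {c : Config q} {Post : Config q → Prop} {g : Config q → ℝ} {v : ℝ}
    (hP : Post { c.tick (1 + d.size + a.size) with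
      nat := Function.update c.nat (d.eval c.nat) (a.eval c.nat) })
    (hg : g { c.tick (1 + d.size + a.size) with
      nat := Function.update c.nat (d.eval c.nat) (a.eval c.nat) } ≤ v) :
    Triple M (.setNat d a) c Post g v :=
  Triple.single (by simp [Prog.exec]) (by rfl) hP hg

lemma Triple.setReal {d : NExp} {a : RExp} {c : Config q} {Post : Config q → Prop}
    {g : Config q → ℝ} {v : ℝ}
    (hP : Post { c.tick (1 + d.size + a.size) with
      real := Function.update c.real (d.eval c.nat) (a.eval c.nat c.real) })
    (hg : g { c.tick (1 + d.size + a.size) with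
      real := Function.update c.real (d.eval c.nat) (a.eval c.nat c.real) } ≤ v) :
    Triple M (.setReal d a) c Post g v :=
  Triple.single (by simp [Prog.exec]) (by rfl) hP hg

lemma Triple.readAlpha {d s : NExp} {c : Config q} {Post : Config q → Prop} {g : Config q → ℝ}
    {v : ℝ}
    (hP : Post { c.tick (1 + M.qramTime + d.size + s.size) with
      real := Function.update c.real (d.eval c.nat) (M.alpha (s.eval c.nat)) })
    (hg : g { c.tick (1 + M.qramTime + d.size + s.size) with
      real := Function.update c.real (d.eval c.nat) (M.alpha (s.eval c.nat)) } ≤ v) :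
    Triple M (.readAlpha d s) c Post g v :=
  Triple.single (by simp [Prog.exec]) (by rfl) hP hg

lemma Triple.readEta {d s : NExp} {c : Config q} {Post : Config q → Prop} {g : Config q → ℝ}
    {v : ℝ}
    (hP : Post { c.tick (1 + d.size + s.size) with
      real := Function.update c.real (d.eval c.nat) (M.eta (s.eval c.nat)) })
    (hg : g { c.tick (1 + d.size + s.size) with
      real := Function.update c.real (d.eval c.nat) (M.eta (s.eval c.nat)) } ≤ v) :
    Triple M (.readEta d s) c Post g v :=
  Triple.single (by simp [Prog.exec]) (by rfl) hP hg

/-- After a reset, the amplitude vector is a multiple of `|0⟩`. -/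
lemma Triple.reset {c : Config q} {Post : Config q → Prop} {g : Config q → ℝ} {v : ℝ}
    (hP : ∀ z : ℂ, Post { c.tick (1 + q) with amp := z • ket0 q })
    (hg : ∀ z : ℂ, g { c.tick (1 + q) with amp := z • ket0 q } ≤ v) :
    Triple M .reset c Post g v := by
  have hamp : ∀ b, (Pi.single (fun _ => false) (c.amp b) : Bits q → ℂ) = c.amp b • ket0 q := by
    intro b
    unfold ket0
    rw [← Pi.single_smul, smul_eq_mul, mul_one]
  have hw : ∀ b, ({ c.tick (1 + q) with amp := c.amp b • ket0 q } : Config q).weight =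
      ‖c.amp b‖ ^ 2 := by
    intro b
    simp only [Config.weight, Pi.smul_apply, smul_eq_mul, norm_mul, mul_pow]
    rw [← Finset.mul_sum, sum_norm_sq_ket0, mul_one]
  unfold Triple
  simp only [Prog.exec, hamp]
  constructor
  · intro c' hc'
    obtain ⟨b, _, rfl⟩ := List.mem_map.1 hc'
    exact hP _
  · rw [List.map_map, Finset.sum_map_toList]
    simp only [Function.comp_def, hw]
    rw [Config.weight, Finset.sum_mul]
    exact Finset.sum_le_sum fun b _ => mul_le_mul_of_nonneg_left (hg _) (sq_nonneg _)

lemma exec_measure {d w : NExp} {c : Config q} (h : w.eval c.nat < q) :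
    (Prog.measure d w).exec M c = [false, true].map fun v =>
      { c.tick (1 + d.size + w.size) with
        nat := Function.update c.nat (d.eval c.nat) (if v then 1 else 0)
        amp := project ⟨w.eval c.nat, h⟩ v c.amp } := by
  simp only [Prog.exec]
  exact dif_pos h

/-- Execution preserves the total weight of the branches. -/
lemma exec_weight (hM : M.IsUnitary) (p : Prog) (c : Config q) :
    ((p.exec M c).map Config.weight).sum = c.weight := by
  have hflat : ∀ (l : List (Config q)) (f : Config q → List (Config q)),
      (∀ c, ((f c).map Config.weight).sum = c.weight) →
      ((l.flatMap f).map Config.weight).sum = (l.map Config.weight).sum := fun l f h => by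
    rw [sum_map_flatMap]; simp only [h]
  induction p generalizing c with
  | skip => simp [Prog.exec]
  | seq p p' ih ih' => exact (hflat _ _ ih').trans (ih c)
  | setNat d a => simp [Prog.exec, Config.weight, Config.tick]
  | setReal d a => simp [Prog.exec, Config.weight, Config.tick]
  | readAlpha d s => simp [Prog.exec, Config.weight, Config.tick]
  | readEta d s => simp [Prog.exec, Config.weight, Config.tick]
  | ite a b p p' ih ih' =>
    simp only [Prog.exec]
    split_ifs
    · exact ih _
    · exact ih' _
  | loop a p ih =>
    simp only [Prog.exec]
    generalize ⌈a.eval c.nat c.real⌉₊ = n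
    induction n with
    | zero => simp
    | succ n ihn =>
      rw [Function.iterate_succ_apply', hflat _ _ fun c' => (ih _).trans (Config.weight_tick _ _),
        ihn]
  | unitary l o =>
    simp only [Prog.exec, List.map, List.sum_cons, List.sum_nil, add_zero]
    exact (isUnitaryMap_apply hM _ _ _ o).sum_norm_sq _
  | measure d w =>
    by_cases h : w.eval c.nat < q
    · rw [exec_measure h]
      simp only [List.map, List.sum_cons, List.sum_nil, add_zero]
      exact sum_project _ _
    · simp [Prog.exec, h]
  | reset =>
    simp only [Prog.exec]
    rw [List.map_map, Finset.sum_map_toList, Config.weight]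
    refine Finset.sum_congr rfl fun b _ => ?_
    simp only [Function.comp, Config.weight]
    rw [Finset.sum_eq_single (fun _ => false)]
    · simp
    · intro b' _ hb'; simp [hb']
    · simp

/-- Adding a constant is possible since the total weight is preserved. -/
lemma Triple.add_const (hM : M.IsUnitary) {p : Prog} {c : Config q} {Post : Config q → Prop}
    {g : Config q → ℝ} {v : ℝ} (h : Triple M p c Post g v) (x : ℝ) :
    Triple M p c Post (fun c' => g c' + x) (v + x) := by
  refine ⟨h.1, ?_⟩
  have e : ((p.exec M c).map fun c' => c'.weight * (g c' + x)).sum =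
      ((p.exec M c).map fun c' => c'.weight * g c').sum + c.weight * x := by
    rw [← exec_weight hM p c, ← List.sum_map_mul_right, ← List.sum_map_add]
    simp only [mul_add]
  rw [e, mul_add]
  linarith [h.2]

end Logic

/-! ### Execution of the trial -/

/-- One trial: apart from registers `7` and `8` and the time, nothing changes, and the real
register `8` increases by `1 - thr` with the success probability and by `-thr` otherwise, where
`thr` is the content of register `11`. -/
lemma triple_trial {M : Memory} (hM : M.IsUnitary) (hK : M.KeepsPoint) {q : ℕ}
    (hq : q = 2 + M.ℓ + M.n + M.N) (c : Config q) (hc : SizesOK M c.nat) {a : ℝ}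
    (ha : M.overlap (c.nat 6) = a) (G : ℝ → ℝ) :
    Triple M trial c
      (fun c' => (∀ j ≠ 7, c'.nat j = c.nat j) ∧ (∀ j ≠ 8, c'.real j = c.real j) ∧
        c'.time ≤ c.time + 1200 * M.unit * (2 * c.nat 8 + 1))
      (fun c' => G (c'.real 8))
      ((1 - successProb a (c.real 6) (c.nat 8)) * G (c.real 8 + (0 - c.real 11)) +
        successProb a (c.real 6) (c.nat 8) * G (c.real 8 + (1 - c.real 11))) := by
  set p := successProb a (c.real 6) (c.nat 8)
  set v := (1 - p) * G (c.real 8 + (0 - c.real 11)) + p * G (c.real 8 + (1 - c.real 11))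
  set u := amplified M c.nat c.real q (c.nat 8) with hu
  have hp : ‖u fun _ => false‖ ^ 2 = p := norm_amplified hM hK c.real hc hq ha _
  have hu1 : ∑ b, ‖u b‖ ^ 2 = 1 := sum_norm_sq_amplified hM _ _ _ _
  have hunit : q + 1 ≤ 3 * M.unit := by unfold Memory.unit; omega
  refine Triple.seq (Mid := fun c' => ∃ z : ℂ,
    c' = { c.tick (1 + q) with amp := z • ket0 q }) (h := fun _ => v)
    (Triple.reset (fun z => ⟨z, rfl⟩) fun _ => le_rfl) ?_
  rintro c1 ⟨z, rfl⟩
  obtain ⟨t1, ht1, h1⟩ := exec_offsetProg M false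
    ({ c.tick (1 + q) with amp := z • ket0 q } : Config q) hc
  have hOu := isUnitaryMap_offsetMap (q := q) hM c.nat c.real false
  refine Triple.seq (Mid := fun c' => c' = { c with
      amp := z • offsetMap M c.nat c.real false (ket0 q), time := c.time + (1 + q) + t1 })
    (h := fun _ => v) (Triple.single h1 ?_ ?_ le_rfl) ?_
  · exact hOu.sum_norm_sq _
  · simp [Config.tick, hOu.map_smul]
  rintro c2 rfl
  -- the amplification steps
  have hAu := isUnitaryMap_amplifyMap (q := q) hM c.nat c.real
  have hloop : ∃ t ≤ 4 + c.nat 8 * (800 * M.unit + 1),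
      (Prog.loop (.ofNat (nreg 8)) amplifyStep).exec M
      ({ c with amp := z • offsetMap M c.nat c.real false (ket0 q), time := c.time + (1 + q) + t1 } :
        Config q) = [{ c with amp := z • u, time := c.time + (1 + q) + t1 + t }] := by
    have hstep : ∀ (ψ : Bits q → ℂ) (T : ℕ), ∃ t ≤ 800 * M.unit,
        amplifyStep.exec M ({ c with amp := ψ, time := T } : Config q) =
          [{ c with amp := amplifyMap M c.nat c.real ψ, time := T + t }] := fun ψ T =>
      exec_amplifyStep M ({ c with amp := ψ, time := T } : Config q) hc
    choose f hf hf' using hstep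
    set A : ℕ → Bits q → ℂ := fun i => (amplifyMap M c.nat c.real)^[i]
      (z • offsetMap M c.nat c.real false (ket0 q)) with hA
    let τ : ℕ → ℕ := fun i => i.rec (c.time + (1 + q) + t1 + 4)
      fun i T => T + 1 + f (A i) (T + 1)
    have hτ : ∀ i, c.time + (1 + q) + t1 ≤ τ i ∧
        τ i ≤ c.time + (1 + q) + t1 + 4 + i * (800 * M.unit + 1) := by
      intro i
      induction i with
      | zero => exact ⟨by simp [τ], by simp [τ]⟩
      | succ i ih =>
        have := hf (A i) (τ i + 1)
        have e : τ (i + 1) = τ i + 1 + f (A i) (τ i + 1) := rfl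
        rw [e, add_mul]
        omega
    refine ⟨τ (c.nat 8) - (c.time + (1 + q) + t1), ?_, ?_⟩
    · have := hτ (c.nat 8); omega
    rw [exec_loop_single M (n := c.nat 8) (by simp [RExp.eval, NExp.eval])
      (fun i => { c with amp := A i, time := τ i })]
    · have := hτ (c.nat 8)
      have e : A (c.nat 8) = z • u := ((isUnitaryMap_amplifyMap hM _ _).iterate _).map_smul _ _
      rw [e, Nat.add_sub_cancel' this.1]
    · simp [Config.tick, A, τ, RExp.size, NExp.size]
    · intro i _
      refine (hf' _ _).trans ?_
      simp only [A, Function.iterate_succ_apply']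
      rfl
  obtain ⟨t2, ht2, h2⟩ := hloop
  refine Triple.seq (Mid := fun c' => c' = { c with
      amp := z • u, time := c.time + (1 + q) + t1 + t2 })
    (h := fun _ => v) (Triple.single h2 ?_ rfl le_rfl) ?_
  · change ∑ b, ‖(z • u) b‖ ^ 2 = ∑ b, ‖(z • offsetMap M c.nat c.real false (ket0 q)) b‖ ^ 2
    have := (hAu.iterate (c.nat 8)).sum_norm_sq (z • offsetMap M c.nat c.real false (ket0 q))
    rw [← this, (hAu.iterate (c.nat 8)).map_smul]
    rfl
  rintro c3 rfl
  have hF := Circuit.isUnitaryMap (q := q) hM c.nat c.real flagCircuit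
  refine Triple.seq (Mid := fun c' => c' = { c with
      amp := z • flagCircuit.run M c.nat c.real u
      time := c.time + (1 + q) + t1 + t2 + flagCircuit.time M c.nat })
    (h := fun _ => v) (Triple.single (Circuit.exec_prog _ _ _) (hF.sum_norm_sq _) ?_ le_rfl) ?_
  · simp [hF.map_smul]
  rintro c4 rfl
  have hft : flagCircuit.time M c.nat ≤ 30 * M.unit := by
    simp only [Circuit.time, flagCircuit, Op.time, Op.size, NExp.size,
      Memory.unit, NExp.eval, List.map, List.sum_cons, List.sum_nil, hc.addr, hc.data, hc.feat]
    omega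
  have hq1 : 1 < q := by omega
  -- measurement
  set φ := flagCircuit.run M c.nat c.real u with hφ
  have hsm : ∀ (s : Bool), ∑ b, ‖project ⟨1, hq1⟩ s (z • φ) b‖ ^ 2 =
      ‖z‖ ^ 2 * ∑ b, ‖project ⟨1, hq1⟩ s φ b‖ ^ 2 := by
    intro s
    rw [Finset.mul_sum]
    refine Finset.sum_congr rfl fun b _ => ?_
    unfold project
    split_ifs <;> simp [mul_pow]
  have hT : ∑ b, ‖project ⟨1, hq1⟩ true φ b‖ ^ 2 = p := by
    rw [← hp]
    exact flagCircuit_run c.real hc hq (flagClear_amplified _ _ _ _ _)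
  have hφ1 : ∑ b, ‖φ b‖ ^ 2 = 1 := by rw [hφ, hF.sum_norm_sq, hu1]
  have hFa : ∑ b, ‖project ⟨1, hq1⟩ false φ b‖ ^ 2 = 1 - p := by
    have := sum_project ⟨1, hq1⟩ φ
    rw [hT, hφ1] at this
    linarith
  refine Triple.seq (Mid := fun c' => ∃ s : Bool, c'.nat = Function.update c.nat 7 (if s then 1 else 0)
      ∧ c'.real = c.real ∧
      c'.time = c.time + (1 + q) + t1 + t2 + flagCircuit.time M c.nat + 3)
    (h := fun c' => G (c'.real 8 + (c'.nat 7 - c'.real 11))) ?_ ?_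
  · unfold Triple
    rw [exec_measure (by exact hq1)]
    simp only [NExp.eval, NExp.size]
    refine ⟨?_, le_of_eq ?_⟩
    · intro c' hc'
      obtain ⟨s, _, rfl⟩ := List.mem_map.1 hc'
      exact ⟨s, rfl, rfl, rfl⟩
    · simp only [List.map, List.sum_cons, List.sum_nil, Config.weight, Config.tick]
      rw [hsm, hsm, hT, hFa]
      have : ∑ b, ‖(z • φ) b‖ ^ 2 = ‖z‖ ^ 2 := by
        simp only [Pi.smul_apply, smul_eq_mul, norm_mul, mul_pow]
        rw [← Finset.mul_sum, hφ1, mul_one]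
      rw [this]
      simp [v]
      ring
  · rintro c5 ⟨s, hn, hr, ht⟩
    refine Triple.setReal ⟨?_, ?_, ?_⟩ (le_of_eq ?_)
    · intro j hj
      change c5.nat j = _
      rw [hn, Function.update_of_ne hj]
    · intro j hj
      simp only [NExp.eval, hr, Function.update_of_ne hj]
    · simp only [Config.tick, ht, NExp.size, RExp.size]
      have h1u : 1 ≤ M.unit := by unfold Memory.unit; omega
      have e : 1200 * M.unit * (2 * c.nat 8 + 1) = 2400 * (c.nat 8 * M.unit) + 1200 * M.unit := by
        ring
      have e2 : c.nat 8 * (800 * M.unit + 1) = 800 * (c.nat 8 * M.unit) + c.nat 8 := by ring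
      have e3 : c.nat 8 ≤ c.nat 8 * M.unit := Nat.le_mul_of_pos_right _ h1u
      rw [e]
      rw [e2] at ht2
      omega
    · simp [NExp.eval, RExp.eval]

/-! ### The statistics of one interval -/

lemma sub_le_arcsin_sub {x y : ℝ} (hx : -1 ≤ x) (hxy : x ≤ y) (hy : y ≤ 1) :
    y - x ≤ Real.arcsin y - Real.arcsin x := by
  have h : |Real.sin (Real.arcsin y) - Real.sin (Real.arcsin x)| ≤
      |Real.arcsin y - Real.arcsin x| := by
    simpa [Real.dist_eq] using Real.lipschitzWith_sin.dist_le_mul (Real.arcsin y) (Real.arcsin x)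
  rw [Real.sin_arcsin (hx.trans hxy) hy, Real.sin_arcsin hx (hxy.trans hy),
    abs_of_nonneg (sub_nonneg.2 hxy),
    abs_of_nonneg (sub_nonneg.2 (Real.monotone_arcsin hxy))] at h
  exact h

lemma arcsin_le_mul {y : ℝ} (h0 : 0 ≤ y) (h1 : y ≤ 1) : Real.arcsin y ≤ Real.pi / 2 * y := by
  have h := Real.mul_le_sin (Real.arcsin_nonneg.2 h0) (Real.arcsin_le_pi_div_two y)
  rw [Real.sin_arcsin (by linarith) h1] at h
  have hpi := Real.pi_pos
  calc Real.arcsin y = Real.pi / 2 * (2 / Real.pi * Real.arcsin y) := by field_simp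
    _ ≤ Real.pi / 2 * y := by gcongr

lemma half_le_sin {x : ℝ} (h0 : 0 ≤ x) (h1 : x ≤ Real.pi / 2) : x / 2 ≤ Real.sin x := by
  refine le_trans ?_ (Real.mul_le_sin h0 h1)
  have h2 : (1 : ℝ) / 2 ≤ 2 / Real.pi := by
    rw [div_le_div_iff₀ (by norm_num) Real.pi_pos]
    linarith [Real.pi_le_four]
  nlinarith

lemma sin_sq_sub_sin_sq (A B : ℝ) :
    Real.sin B ^ 2 - Real.sin A ^ 2 = Real.sin (B - A) * Real.sin (B + A) := by
  rw [Real.sin_sub, Real.sin_add]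
  have h1 := Real.sin_sq_add_cos_sq A
  have h2 := Real.sin_sq_add_cos_sq B
  linear_combination Real.sin B ^ 2 * (-1) * h1 + Real.sin A ^ 2 * h2

/-- Separation of success probabilities for angles that differ by `1 / 18`. -/
lemma sin_sq_gap {A B : ℝ} (hA : 0 ≤ A) (hB : B ≤ Real.pi / 2) (hAB : 1 / 18 ≤ B - A)
    (hs : 1 / 6 ≤ A + B) (hs' : A + B ≤ 3 * Real.pi / 4) :
    1 / 432 ≤ Real.sin B ^ 2 - Real.sin A ^ 2 := by
  rw [sin_sq_sub_sin_sq]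
  have h1 : 1 / 36 ≤ Real.sin (B - A) :=
    le_trans (by linarith) (half_le_sin (by linarith) (by linarith))
  have h2 : 1 / 12 ≤ Real.sin (B + A) := by
    by_cases h : B + A ≤ Real.pi / 2
    · exact le_trans (by linarith) (half_le_sin (by linarith) h)
    · rw [← Real.sin_pi_sub]
      refine le_trans ?_ (half_le_sin (by linarith) (by linarith))
      linarith [Real.pi_gt_three]
  calc (1 : ℝ) / 432 = 1 / 36 * (1 / 12) := by norm_num
    _ ≤ _ := mul_le_mul h1 h2 (by norm_num) (by linarith)

/-- The number of amplification steps for an interval `[L, L + w]`: about as large as possible under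
the condition that the amplified angles for this interval are at most `π / 2`. -/
def ampSteps (L w : ℝ) : ℕ := ⌈(Real.sqrt (2 * (1 + L * L)) / w - 3) / 2⌉₊

/-- The success probability at the midpoint of the interval; the square is written as a product, in
the form in which the program computes it. -/
def threshold (L w : ℝ) (k : ℕ) : ℝ :=
  Real.sin ((k + k + 1) * Real.arcsin (w / 2 / Real.sqrt (2 * (1 + L * L)))) *
    Real.sin ((k + k + 1) * Real.arcsin (w / 2 / Real.sqrt (2 * (1 + L * L))))

lemma offsetScale_pos (L : ℝ) : 0 < offsetScale L :=
  one_div_pos.2 (Real.sqrt_pos.2 (by positivity))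

/-- The odd number `2k+1` is between a third of `Y` and `Y`, where `Y⁻¹` is the length of the
scaled interval. -/
lemma ampSteps_bounds {L w : ℝ} (hw : 0 < w) (h1 : -1 ≤ L) (h2 : L + w ≤ 1) :
    (2 * ampSteps L w + 1 : ℝ) * (offsetScale L * w) ≤ 1 ∧
      1 / 3 ≤ (2 * ampSteps L w + 1 : ℝ) * (offsetScale L * w) ∧
      (2 * ampSteps L w + 1 : ℝ) ≤ 2 / w := by
  set Y := Real.sqrt (2 * (1 + L * L)) / w with hY
  have hsq : 0 < Real.sqrt (2 * (1 + L * L)) := Real.sqrt_pos.2 (by nlinarith)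
  have hYp : 0 < Y := by positivity
  have hsc : offsetScale L * w = Y⁻¹ := by
    rw [hY, offsetScale, pow_two]; field_simp
  have hY1 : 1 ≤ Y := by
    rw [hY, le_div_iff₀ hw, one_mul]
    apply Real.le_sqrt_of_sq_le
    nlinarith [sq_nonneg (L + 1)]
  have hY2 : Y ≤ 2 / w := by
    rw [hY]
    gcongr
    rw [Real.sqrt_le_left (by norm_num)]
    nlinarith
  have hD : (2 * ampSteps L w + 1 : ℝ) ≤ Y ∧ Y / 3 ≤ (2 * ampSteps L w + 1 : ℝ) := by
    have hk : ampSteps L w = ⌈(Y - 3) / 2⌉₊ := rfl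
    rw [hk]
    constructor
    · by_cases h : Y ≤ 3
      · rw [Nat.ceil_eq_zero.2 (by linarith)]; simpa using hY1
      · have := Nat.ceil_lt_add_one (a := (Y - 3) / 2) (by linarith)
        linarith
    · have := Nat.le_ceil ((Y - 3) / 2)
      have h0 : (0 : ℝ) ≤ ⌈(Y - 3) / 2⌉₊ := Nat.cast_nonneg _
      by_cases h : Y ≤ 3
      · linarith
      · linarith
  refine ⟨?_, ?_, hD.1.trans hY2⟩
  · rw [hsc, ← div_eq_mul_inv, div_le_one hYp]; exact hD.1
  · rw [hsc, ← div_eq_mul_inv, le_div_iff₀ hYp]; linarith [hD.2]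

lemma threshold_eq (L w : ℝ) (k : ℕ) :
    threshold L w k = Real.sin ((2 * k + 1) * Real.arcsin (offsetScale L * (w / 2))) ^ 2 := by
  have : w / 2 / Real.sqrt (2 * (1 + L * L)) = offsetScale L * (w / 2) := by
    rw [offsetScale, pow_two]; ring
  rw [threshold, this, ← pow_two, two_mul]

/-- Angles after amplification, for a point `y` of the scaled interval. -/
lemma amplified_angle {L w y : ℝ} (hw : 0 < w) (h1 : -1 ≤ L) (h2 : L + w ≤ 1) (h0 : 0 ≤ y)
    (hy : y ≤ offsetScale L * w) :
    (2 * ampSteps L w + 1 : ℝ) * y ≤ (2 * ampSteps L w + 1) * Real.arcsin y ∧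
      (2 * ampSteps L w + 1) * Real.arcsin y ≤ Real.pi / 2 * ((2 * ampSteps L w + 1) * y) := by
  obtain ⟨hb1, hb2, hb3⟩ := ampSteps_bounds hw h1 h2
  have hD : (1 : ℝ) ≤ 2 * ampSteps L w + 1 := by
    have : (0 : ℝ) ≤ ampSteps L w := Nat.cast_nonneg _
    linarith
  have hs := mul_pos (offsetScale_pos L) hw
  have hy1 : y ≤ 1 := hy.trans (le_trans (by nlinarith) hb1)
  constructor
  · have := sub_le_arcsin_sub (x := 0) (y := y) (by norm_num) h0 hy1
    rw [Real.arcsin_zero] at this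
    gcongr
    linarith
  · have := arcsin_le_mul h0 hy1
    calc _ ≤ (2 * ampSteps L w + 1) * (Real.pi / 2 * y) := by gcongr
      _ = _ := by ring

/-- An overlap in the first third of the interval has a success probability below the threshold. -/
lemma gap_left {L w a : ℝ} (hw : 0 < w) (h1 : -1 ≤ L) (h2 : L + w ≤ 1) (ha : L ≤ a)
    (ha' : a ≤ L + w / 3) :
    successProb a L (ampSteps L w) ≤ threshold L w (ampSteps L w) - 1 / 432 := by
  obtain ⟨hb1, hb2, hb3⟩ := ampSteps_bounds hw h1 h2
  have hs := offsetScale_pos L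
  rw [threshold_eq, successProb]
  set D : ℝ := 2 * ampSteps L w + 1
  have hD : 0 < D := by positivity
  have hy0 : 0 ≤ offsetScale L * (a - L) := mul_nonneg hs.le (by linarith)
  have hya : offsetScale L * (a - L) ≤ offsetScale L * (w / 3) :=
    mul_le_mul_of_nonneg_left (by linarith) hs.le
  have A := amplified_angle hw h1 h2 hy0 (by nlinarith)
  have B := amplified_angle hw h1 h2 (y := offsetScale L * (w / 2)) (by positivity) (by nlinarith)
  change D * _ ≤ D * _ ∧ D * _ ≤ _ * (D * _) at A B
  have hd := sub_le_arcsin_sub (x := offsetScale L * (a - L)) (y := offsetScale L * (w / 2))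
    (by linarith) (by nlinarith) (by
      have : (1 : ℝ) ≤ D := by simp [D]
      nlinarith [mul_pos hs hw])
  have hda := mul_le_mul_of_nonneg_left hd hD.le
  have hDa := mul_le_mul_of_nonneg_left hya hD.le
  have hpi := Real.pi_pos
  have e1 : D * (offsetScale L * (w / 2)) = D * (offsetScale L * w) / 2 := by ring
  have e2 : D * (offsetScale L * (w / 3)) = D * (offsetScale L * w) / 3 := by ring
  rw [e1] at B
  rw [e2] at hDa
  have hDy : 0 ≤ D * (offsetScale L * (a - L)) := mul_nonneg hD.le hy0
  have := sin_sq_gap (A := D * Real.arcsin (offsetScale L * (a - L)))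
    (B := D * Real.arcsin (offsetScale L * (w / 2))) (by linarith [A.1])
    (B.2.trans (by nlinarith)) (by linarith) (by linarith [A.1, B.1])
    (by nlinarith [A.2, B.2])
  linarith

/-- An overlap in the last third of the interval has a success probability above the threshold. -/
lemma gap_right {L w a : ℝ} (hw : 0 < w) (h1 : -1 ≤ L) (h2 : L + w ≤ 1)
    (ha : L + 2 * w / 3 ≤ a) (ha' : a ≤ L + w) :
    threshold L w (ampSteps L w) + 1 / 432 ≤ successProb a L (ampSteps L w) := by
  obtain ⟨hb1, hb2, hb3⟩ := ampSteps_bounds hw h1 h2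
  have hs := offsetScale_pos L
  rw [threshold_eq, successProb]
  set D : ℝ := 2 * ampSteps L w + 1
  have hD : 0 < D := by positivity
  have hya : offsetScale L * (2 * w / 3) ≤ offsetScale L * (a - L) :=
    mul_le_mul_of_nonneg_left (by linarith) hs.le
  have hya' : offsetScale L * (a - L) ≤ offsetScale L * w :=
    mul_le_mul_of_nonneg_left (by linarith) hs.le
  have A := amplified_angle hw h1 h2 (le_trans (by positivity) hya) hya'
  have B := amplified_angle hw h1 h2 (y := offsetScale L * (w / 2)) (by positivity) (by nlinarith)
  change D * _ ≤ D * _ ∧ D * _ ≤ _ * (D * _) at A B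
  have hd := sub_le_arcsin_sub (x := offsetScale L * (w / 2)) (y := offsetScale L * (a - L))
    (by nlinarith [mul_pos hs hw]) (by nlinarith [mul_pos hs hw]) (by
      have : (1 : ℝ) ≤ D := by simp [D]
      nlinarith [mul_pos hs hw])
  have hda := mul_le_mul_of_nonneg_left hd hD.le
  have hDa := mul_le_mul_of_nonneg_left hya hD.le
  have hDa' := mul_le_mul_of_nonneg_left hya' hD.le
  have hpi := Real.pi_pos
  have e1 : D * (offsetScale L * (w / 2)) = D * (offsetScale L * w) / 2 := by ring
  have e2 : D * (offsetScale L * (2 * w / 3)) = D * (offsetScale L * w) * 2 / 3 := by ring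
  rw [e1] at B
  rw [e2] at hDa
  have := sin_sq_gap (B := D * Real.arcsin (offsetScale L * (a - L)))
    (A := D * Real.arcsin (offsetScale L * (w / 2))) (by linarith [B.1])
    (A.2.trans (by nlinarith)) (by linarith) (by linarith [A.1, B.1])
    (by nlinarith [A.2, B.2])
  linarith

/-- The exponential decay rate of the error probability in the number of trials, `(1 / 864)²`. -/
def decayRate : ℝ := 1 / 746496

/-- Exponential moment of one trial whose success probability is smaller than the threshold by at
least `1 / 432` (for `l = 1 / 864`), or larger (for `l = -1 / 864`). -/
lemma exp_moment_le {p θ l : ℝ} (hp0 : 0 ≤ p) (hp1 : p ≤ 1) (hl : |l| = 1 / 864)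
    (h : 1 / 432 * |l| ≤ l * (θ - p)) (x : ℝ) :
    (1 - p) * Real.exp (l * (x + (0 - θ))) + p * Real.exp (l * (x + (1 - θ))) ≤
      Real.exp (-decayRate) * Real.exp (l * x) := by
  have e1 : Real.exp (l * (x + (0 - θ))) = Real.exp (l * x) * Real.exp (-(l * θ)) := by
    rw [← Real.exp_add]; ring_nf
  have e2 : Real.exp (l * (x + (1 - θ))) = Real.exp (l * x) * Real.exp (-(l * θ)) * Real.exp l := by
    rw [← Real.exp_add, ← Real.exp_add]; ring_nf
  have h3 : Real.exp l - 1 - l ≤ l ^ 2 :=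
    (le_abs_self _).trans (Real.abs_exp_sub_one_sub_id_le (by rw [hl]; norm_num))
  have hl2 : l ^ 2 = (1 / 864) ^ 2 := by rw [← sq_abs, hl]
  have h4 : 1 + p * (Real.exp l - 1) ≤ Real.exp (p * l + l ^ 2) := by
    refine le_trans ?_ (Real.add_one_le_exp _)
    nlinarith [sq_nonneg l]
  have h5 : Real.exp (-(l * θ)) * Real.exp (p * l + l ^ 2) ≤ Real.exp (-decayRate) := by
    rw [← Real.exp_add, Real.exp_le_exp, hl2, decayRate]
    rw [hl] at h
    nlinarith
  calc _ = Real.exp (l * x) * (Real.exp (-(l * θ)) * (1 + p * (Real.exp l - 1))) := by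
        rw [e1, e2]; ring
    _ ≤ Real.exp (l * x) * (Real.exp (-(l * θ)) * Real.exp (p * l + l ^ 2)) := by gcongr
    _ ≤ Real.exp (l * x) * Real.exp (-decayRate) := by gcongr
    _ = _ := mul_comm _ _

/-! ### Bisection by measured trials -/

open Classical in
/-- `0` if `a` is in the interval `[L, L + w]`, and `1` otherwise. -/
def miss (a L w : ℝ) : ℝ := if L ≤ a ∧ a ≤ L + w then 0 else 1

lemma miss_le_one (a L w : ℝ) : miss a L w ≤ 1 := by
  unfold miss; split_ifs <;> norm_num

lemma miss_of_mem {a L w : ℝ} (h : L ≤ a) (h' : a ≤ L + w) : miss a L w = 0 :=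
  if_pos ⟨h, h'⟩

/-- A function `G` of the excess `x` of successes over the threshold which dominates the event that
the interval chosen by the sign of `x` misses `a`, and whose expectation decreases with each trial:
an exponential if `a` is in the first or the last third of the interval, zero if it is in the
middle, and one if it is outside. -/
lemma exists_potential {a L w : ℝ} (hw : 0 < w) (h1 : -1 ≤ L) (h2 : L + w ≤ 1) (T : ℕ) :
    ∃ (G : ℝ → ℝ) (ρ : ℝ), 0 ≤ ρ ∧
      (∀ x, (1 - successProb a L (ampSteps L w)) * G (x + (0 - threshold L w (ampSteps L w))) +
        successProb a L (ampSteps L w) * G (x + (1 - threshold L w (ampSteps L w))) ≤ ρ * G x) ∧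
      ρ ^ T * G 0 ≤ miss a L w + Real.exp (-decayRate) ^ T ∧
      (∀ x, x ≤ 0 → miss a L (2 * w / 3) ≤ G x) ∧
      (∀ x, ¬ x ≤ 0 → miss a (L + w / 3) (2 * w / 3) ≤ G x) := by
  have hp0 := successProb_nonneg a L (ampSteps L w)
  have hp1 := successProb_le_one a L (ampSteps L w)
  have he : 0 ≤ Real.exp (-decayRate) ^ T := by positivity
  by_cases hm : L ≤ a ∧ a ≤ L + w
  swap
  · refine ⟨fun _ => 1, 1, zero_le_one, fun x => by linarith, ?_, fun x _ => miss_le_one _ _ _,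
      fun x _ => miss_le_one _ _ _⟩
    rw [miss, if_neg hm, one_pow]
    linarith
  have hm0 : miss a L w = 0 := if_pos hm
  by_cases hl : a ≤ L + w / 3
  · have hg := gap_left hw h1 h2 hm.1 hl
    refine ⟨fun x => Real.exp (1 / 864 * x), Real.exp (-decayRate), (Real.exp_pos _).le,
      exp_moment_le hp0 hp1 (by norm_num) (by norm_num; linarith), ?_, fun x _ => ?_, fun x hx => ?_⟩
    · simp [hm0]
    · rw [miss_of_mem hm.1 (by linarith)]; positivity
    · refine (miss_le_one _ _ _).trans (Real.one_le_exp ?_)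
      rw [not_le] at hx
      positivity
  by_cases hr : L + 2 * w / 3 ≤ a
  · have hg := gap_right hw h1 h2 hr hm.2
    refine ⟨fun x => Real.exp (-(1 / 864) * x), Real.exp (-decayRate), (Real.exp_pos _).le,
      exp_moment_le hp0 hp1 (by norm_num) (by norm_num; linarith), ?_, fun x hx => ?_, fun x _ => ?_⟩
    · simp [hm0]
    · refine (miss_le_one _ _ _).trans (Real.one_le_exp ?_)
      nlinarith
    · rw [miss_of_mem (by linarith) (by linarith)]; positivity
  · refine ⟨fun _ => 0, 0, le_rfl, fun x => by simp, by simpa [hm0] using he,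
      fun x _ => ?_, fun x _ => ?_⟩
    · rw [miss_of_mem hm.1 (by linarith)]
    · rw [miss_of_mem (by linarith) (by linarith)]

/-- Repetition of the trial; the number of repetitions is in real register `10`. -/
lemma triple_trials {M : Memory} (hM : M.IsUnitary) (hK : M.KeepsPoint) {q : ℕ}
    (hq : q = 2 + M.ℓ + M.n + M.N) (c : Config q) (hc : SizesOK M c.nat) {a : ℝ}
    (ha : M.overlap (c.nat 6) = a) {G : ℝ → ℝ} {ρ : ℝ} (hρ : 0 ≤ ρ)
    (hG : ∀ x, (1 - successProb a (c.real 6) (c.nat 8)) * G (x + (0 - c.real 11)) +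
        successProb a (c.real 6) (c.nat 8) * G (x + (1 - c.real 11)) ≤ ρ * G x) :
    Triple M (.loop (rreg 10) trial) c
      (fun c' => (∀ j ≠ 7, c'.nat j = c.nat j) ∧ (∀ j ≠ 8, c'.real j = c.real j) ∧
        c'.time ≤ c.time + 3 + ⌈c.real 10⌉₊ * (1200 * M.unit * (2 * c.nat 8 + 1) + 1))
      (fun c' => G (c'.real 8)) (ρ ^ ⌈c.real 10⌉₊ * G (c.real 8)) := by
  set T := ⌈c.real 10⌉₊ with hT
  have h := Triple.loop (M := M) (a := rreg 10) (p := trial) (c := c) (n := T)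
    (by simp [RExp.eval, NExp.eval, hT])
    (fun i c' => (∀ j ≠ 7, c'.nat j = c.nat j) ∧ (∀ j ≠ 8, c'.real j = c.real j) ∧
        c'.time ≤ c.time + 3 + i * (1200 * M.unit * (2 * c.nat 8 + 1) + 1))
    (fun i c' => ρ ^ (T - i) * G (c'.real 8)) (v := ρ ^ T * G (c.real 8))
    ⟨fun _ _ => rfl, fun _ _ => rfl, by simp [Config.tick, RExp.size, NExp.size]⟩ le_rfl ?_
  · exact h.mono (fun _ h => h) (fun c' _ => by simp) le_rfl
  rintro i hi c' ⟨hn, hr, ht⟩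
  have hc' : SizesOK M (c'.tick 1).nat := ⟨(hn 1 (by norm_num)).trans hc.addr,
    (hn 2 (by norm_num)).trans hc.data, (hn 3 (by norm_num)).trans hc.feat,
    (hn 9 (by norm_num)).trans hc.counter⟩
  have ha' : M.overlap ((c'.tick 1).nat 6) = a := by
    rw [← ha]; congr 1; exact hn 6 (by norm_num)
  have e8 : (c'.tick 1).nat 8 = c.nat 8 := hn 8 (by norm_num)
  have e6 : (c'.tick 1).real 6 = c.real 6 := hr 6 (by norm_num)
  have e11 : (c'.tick 1).real 11 = c.real 11 := hr 11 (by norm_num)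
  refine (triple_trial hM hK hq (c'.tick 1) hc' ha'
    fun x => ρ ^ (T - (i + 1)) * G x).mono ?_ (fun _ _ => le_rfl) ?_
  · rintro c'' ⟨hn', hr', ht'⟩
    refine ⟨fun j hj => (hn' j hj).trans (hn j hj), fun j hj => (hr' j hj).trans (hr j hj), ?_⟩
    rw [e8] at ht'
    simp only [Config.tick] at ht'
    rw [add_mul]
    omega
  · rw [e8, e6, e11]
    have hx := mul_le_mul_of_nonneg_left (hG ((c'.tick 1).real 8)) (pow_nonneg hρ (T - (i + 1)))
    have e : T - i = T - (i + 1) + 1 := by omega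
    calc _ = ρ ^ (T - (i + 1)) *
          ((1 - successProb a (c.real 6) (c.nat 8)) * G ((c'.tick 1).real 8 + (0 - c.real 11)) +
          successProb a (c.real 6) (c.nat 8) * G ((c'.tick 1).real 8 + (1 - c.real 11))) := by ring
      _ ≤ _ := hx
      _ = ρ ^ (T - i) * G (c'.real 8) := by
        rw [e, pow_succ]
        simp only [Config.tick]
        ring

/-- `√(2 (1 + L²))`, where `L` is in real register `6`. -/
def scaleExp : RExp := .app .sqrt (.mul (rnat 2) (.add (rnat 1) (.mul (rreg 6) (rreg 6))))

/-- Compute the number of amplification steps in register `8`. Only loops round real numbers to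
integers, hence the counting loop. -/
def countSteps : Prog :=
  .seq (.setNat (.const 8) (.const 0))
    (.loop (.div (.sub (.div scaleExp (rreg 7)) (rnat 3)) (rnat 2))
      (.setNat (.const 8) (.add (nreg 8) (.const 1))))

/-- The amplified angle of the midpoint of the interval. -/
def midAngle : RExp :=
  .mul (.add (.add (.ofNat (nreg 8)) (.ofNat (nreg 8))) (rnat 1))
    (.app .arcsin (.div (.div (rreg 7) (rnat 2)) scaleExp))

/-- Replace the interval `[L, L + w]`, in real registers `6` and `7`, by its first or its last two
thirds. -/
def bisect : Prog :=
  .seq countSteps (.seq (.setReal (.const 11) (.mul (.app .sin midAngle) (.app .sin midAngle)))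
    (.seq (.setReal (.const 8) (rnat 0)) (.seq (.loop (rreg 10) trial)
      (.seq (.ite (rreg 8) (rnat 0) .skip
        (.setReal (.const 6) (.add (rreg 6) (.div (rreg 7) (rnat 3)))))
      (.setReal (.const 7) (.div (.mul (rnat 2) (rreg 7)) (rnat 3)))))))

lemma exec_countSteps (M : Memory) {q : ℕ} (c : Config q) :
    ∃ t ≤ 50 * (2 * ampSteps (c.real 6) (c.real 7) + 1), countSteps.exec M c =
      [{ c with
        nat := Function.update c.nat 8 (ampSteps (c.real 6) (c.real 7)), time := c.time + t }] := by
  set k := ampSteps (c.real 6) (c.real 7) with hk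
  refine ⟨25 + 7 * k, by omega, ?_⟩
  have h := exec_loop_single M (a := .div (.sub (.div scaleExp (rreg 7)) (rnat 3)) (rnat 2))
    (p := .setNat (.const 8) (.add (nreg 8) (.const 1)))
    (c := { c.tick 3 with nat := Function.update c.nat 8 0 }) (n := k)
    (by simp [RExp.eval, NExp.eval, scaleExp, Elem.eval, hk, ampSteps, Config.tick])
    (fun i => { c with nat := Function.update c.nat 8 i, time := c.time + 25 + 7 * i })
    (by simp [Config.tick, RExp.size, NExp.size, scaleExp])
    (by
      intro i _
      simp [Prog.exec, Config.tick, NExp.eval, NExp.size]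
      ring)
  change List.flatMap _ _ = _
  simp only [Prog.exec, NExp.eval, NExp.size, List.flatMap_cons, List.flatMap_nil, List.append_nil]
  refine h.trans ?_
  simp [add_assoc]

/-- One step of the bisection. The interval loses one third; it loses the overlap with probability
at most `exp (-decayRate) ^ T`, where `T` is the number of trials. -/
lemma triple_bisect {M : Memory} (hM : M.IsUnitary) (hK : M.KeepsPoint) {q : ℕ}
    (hq : q = 2 + M.ℓ + M.n + M.N) (c : Config q) (hc : SizesOK M c.nat) {a : ℝ}
    (ha : M.overlap (c.nat 6) = a) (hw : 0 < c.real 7) (h1 : -1 ≤ c.real 6)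
    (h2 : c.real 6 + c.real 7 ≤ 1) :
    Triple M bisect c
      (fun c' => (∀ j, j ≠ 7 → j ≠ 8 → c'.nat j = c.nat j) ∧
        (∀ j, j ≠ 6 → j ≠ 7 → j ≠ 8 → j ≠ 11 → c'.real j = c.real j) ∧
        c'.real 7 = 2 * c.real 7 / 3 ∧
        (c'.real 6 = c.real 6 ∨ c'.real 6 = c.real 6 + c.real 7 / 3) ∧
        (c'.time : ℝ) ≤ c.time + 1500 * M.unit * (⌈c.real 10⌉₊ + 1) * (2 / c.real 7))
      (fun c' => miss a (c'.real 6) (c'.real 7))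
      (miss a (c.real 6) (c.real 7) + Real.exp (-decayRate) ^ ⌈c.real 10⌉₊) := by
  set L := c.real 6 with hL
  set w := c.real 7 with hwd
  set T := ⌈c.real 10⌉₊ with hT
  set k := ampSteps L w with hk
  set v := miss a L w + Real.exp (-decayRate) ^ T with hv
  obtain ⟨G, ρ, hρ, hG, hG0, hGl, hGr⟩ := exists_potential (a := a) hw h1 h2 T
  obtain ⟨t1, ht1, he1⟩ := exec_countSteps M c
  change t1 ≤ 50 * (2 * k + 1) at ht1
  refine Triple.seq (Mid := fun c' => c' = { c with
      nat := Function.update c.nat 8 k, time := c.time + t1 }) (h := fun _ => v)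
    (Triple.single he1 rfl rfl le_rfl) ?_
  rintro c1 rfl
  refine Triple.seq (Mid := fun c' => c'.nat = Function.update c.nat 8 k ∧
      c'.real = Function.update c.real 11 (threshold L w k) ∧ c'.time ≤ c.time + t1 + 100)
    (h := fun _ => v) (Triple.setReal ⟨rfl, ?_, ?_⟩ le_rfl) ?_
  · simp [NExp.eval, RExp.eval, midAngle, scaleExp, Elem.eval, threshold, hL, hwd]
  · simp [Config.tick, NExp.size, RExp.size, midAngle, scaleExp]
  rintro c2 ⟨hn2, hr2, ht2⟩
  refine Triple.seq (Mid := fun c' => c'.nat = Function.update c.nat 8 k ∧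
      c'.real = Function.update (Function.update c.real 11 (threshold L w k)) 8 0 ∧
      c'.time ≤ c.time + t1 + 110)
    (h := fun _ => v) (Triple.setReal ⟨hn2, ?_, ?_⟩ le_rfl) ?_
  · simp [NExp.eval, RExp.eval, hr2]
  · simp only [Config.tick, NExp.size, RExp.size]
    omega
  rintro c3 ⟨hn3, hr3, ht3⟩
  have e8 : c3.nat 8 = k := by simp [hn3]
  have e6 : c3.nat 6 = c.nat 6 := by simp [hn3]
  have r6 : c3.real 6 = L := by simp [hr3, hL]
  have r8 : c3.real 8 = 0 := by simp [hr3]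
  have r10 : c3.real 10 = c.real 10 := by simp [hr3]
  have r11 : c3.real 11 = threshold L w k := by simp [hr3]
  have hc3 : SizesOK M c3.nat := by
    constructor <;> simp [hn3, hc.addr, hc.data, hc.feat, hc.counter]
  have htr := triple_trials hM hK hq c3 hc3 (by rw [e6]; exact ha) hρ
    (by rw [e8, r6, r11]; exact hG)
  refine Triple.seq (htr.mono (fun _ h => h) (fun _ _ => le_rfl)
    (by rw [r10, r8]; exact hG0)) ?_
  rintro c4 ⟨hn4, hr4, ht4⟩
  have hn5 : ∀ j, j ≠ 7 → j ≠ 8 → c4.nat j = c.nat j := fun j h7 h8 => by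
    rw [hn4 j h7, hn3, Function.update_of_ne h8]
  have hr5 : ∀ j, j ≠ 8 → j ≠ 11 → c4.real j = c.real j := fun j h8 h11 => by
    rw [hr4 j h8, hr3, Function.update_of_ne h8, Function.update_of_ne h11]
  -- the new left end
  refine Triple.seq (Mid := fun c' => (∀ j, j ≠ 7 → j ≠ 8 → c'.nat j = c.nat j) ∧
      (∀ j, j ≠ 6 → j ≠ 8 → j ≠ 11 → c'.real j = c.real j) ∧
      (c'.real 6 = L ∨ c'.real 6 = L + w / 3) ∧ c'.time ≤ c4.time + 20)
    (h := fun c' => miss a (c'.real 6) (2 * w / 3)) (Triple.ite (fun hle => ?_) fun hle => ?_) ?_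
  · have hx : c4.real 8 ≤ 0 := by simpa [RExp.eval, NExp.eval] using hle
    refine Triple.single rfl rfl ⟨hn5, fun j _ => hr5 j, Or.inl ?_, ?_⟩ ?_
    · exact hr5 6 (by norm_num) (by norm_num)
    · simp [Config.tick, NExp.size, RExp.size]
    · have : (c4.tick (1 + (rreg 8).size + (rnat 0).size)).real 6 = L :=
        hr5 6 (by norm_num) (by norm_num)
      rw [this]
      exact hGl _ hx
  · have hx : ¬ c4.real 8 ≤ 0 := by simpa [RExp.eval, NExp.eval] using hle
    have e7 : c4.real 7 = w := hr5 7 (by norm_num) (by norm_num)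
    have e6 : c4.real 6 = L := hr5 6 (by norm_num) (by norm_num)
    refine Triple.setReal ⟨hn5, fun j h6 h8 h11 => ?_, Or.inr ?_, ?_⟩ ?_
    · simp only [NExp.eval, Function.update_of_ne h6]
      exact hr5 j h8 h11
    · simp [NExp.eval, RExp.eval, Config.tick, e6, e7]
    · simp [Config.tick, NExp.size, RExp.size]
    · simp [NExp.eval, RExp.eval, Config.tick, e6, e7]
      exact hGr _ hx
  rintro c5 ⟨hn6, hr6, hL6, ht6⟩
  have e7 : c5.real 7 = w := hr6 7 (by norm_num) (by norm_num) (by norm_num)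
  refine Triple.setReal ⟨hn6, fun j h6 h7 h8 h11 => ?_, ?_, ?_, ?_⟩ (le_of_eq ?_)
  · simp only [NExp.eval, Function.update_of_ne h7]
    exact hr6 j h6 h8 h11
  · simp [NExp.eval, RExp.eval, e7]
  · simpa [NExp.eval, Config.tick] using hL6
  · have hb := (ampSteps_bounds hw h1 h2).2.2
    rw [r10, e8] at ht4
    have hu : 1 ≤ M.unit := by unfold Memory.unit; omega
    have hnat : c5.time + 20 ≤ c.time + 1500 * M.unit * (T + 1) * (2 * k + 1) := by
      have x1 : T * (1200 * M.unit * (2 * k + 1) + 1) =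
        1200 * (M.unit * T * (2 * k + 1)) + T := by ring
      have x2 : 1500 * M.unit * (T + 1) * (2 * k + 1) =
        1500 * (M.unit * T * (2 * k + 1)) + 1500 * (M.unit * (2 * k + 1)) := by ring
      have x3 : T ≤ M.unit * T * (2 * k + 1) := by
        rw [mul_assoc, mul_comm T, ← mul_assoc]
        exact Nat.le_mul_of_pos_left _ (by positivity)
      have x4 : 2 * k + 1 ≤ M.unit * (2 * k + 1) := Nat.le_mul_of_pos_left _ hu
      rw [x2]
      rw [x1] at ht4
      omega
    have hfin : (c5.time : ℝ) + 20 ≤ c.time + 1500 * M.unit * (T + 1) * (2 * k + 1) := by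
      exact_mod_cast hnat
    have hmono : (1500 * M.unit * (T + 1) * (2 * k + 1) : ℝ) ≤
        1500 * M.unit * (T + 1) * (2 / w) := by gcongr
    simp only [Config.tick, NExp.size, RExp.size]
    push_cast
    linarith
  · simp [NExp.eval, RExp.eval, e7]

/-- Compute an interval for the overlap; the number of steps is in real register `9`. -/
def estimate : Prog :=
  .seq (.setReal (.const 6) (.sub (rnat 0) (rnat 1)))
    (.seq (.setReal (.const 7) (rnat 2)) (.loop (rreg 9) bisect))

/-- The bisection finds an interval of length `2 (2/3)^J` which contains the overlap with high
probability. The running times of the steps form a geometric series. -/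
lemma triple_estimate {M : Memory} (hM : M.IsUnitary) (hK : M.KeepsPoint) {q : ℕ}
    (hq : q = 2 + M.ℓ + M.n + M.N) (c : Config q) (hc : SizesOK M c.nat) {a : ℝ}
    (ha : M.overlap (c.nat 6) = a) :
    Triple M estimate c
      (fun c' => (∀ j, j ≠ 7 → j ≠ 8 → c'.nat j = c.nat j) ∧
        (∀ j, j ≠ 6 → j ≠ 7 → j ≠ 8 → j ≠ 11 → c'.real j = c.real j) ∧
        c'.real 7 = 2 * (2 / 3) ^ ⌈c.real 9⌉₊ ∧
        (c'.time : ℝ) ≤ c.time + 4000 * M.unit * (⌈c.real 10⌉₊ + 1) * (3 / 2) ^ ⌈c.real 9⌉₊)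
      (fun c' => miss a (c'.real 6) (c'.real 7))
      (⌈c.real 9⌉₊ * Real.exp (-decayRate) ^ ⌈c.real 10⌉₊) := by
  set T := ⌈c.real 10⌉₊ with hT
  set J := ⌈c.real 9⌉₊ with hJ
  set η := Real.exp (-decayRate) ^ T with hη
  have ha1 : |a| ≤ 1 := by
    have := norm_overlap_le hM hK (c.nat 6)
    rwa [ha, Complex.norm_real] at this
  have hu : (1 : ℝ) ≤ M.unit := by
    have : 1 ≤ M.unit := by unfold Memory.unit; omega
    exact_mod_cast this
  refine Triple.seq (Mid := fun c' => c'.nat = c.nat ∧ c'.real = Function.update c.real 6 (-1) ∧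
    c'.time = c.time + 7) (h := fun _ => J * η)
    (Triple.setReal ⟨rfl, ?_, ?_⟩ le_rfl) ?_
  · simp [NExp.eval, RExp.eval]
  · simp [Config.tick, NExp.size, RExp.size]
  rintro c1 ⟨hn1, hr1, ht1⟩
  refine Triple.seq (Mid := fun c' => c'.nat = c.nat ∧
    c'.real = Function.update (Function.update c.real 6 (-1)) 7 2 ∧
    c'.time = c.time + 11) (h := fun _ => J * η)
    (Triple.setReal ⟨hn1, ?_, ?_⟩ le_rfl) ?_
  · simp [NExp.eval, RExp.eval, hr1]
  · simp [Config.tick, NExp.size, RExp.size, ht1]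
  rintro c2 ⟨hn2, hr2, ht2⟩
  have h := Triple.loop (M := M) (a := rreg 9) (p := bisect) (c := c2) (n := J)
    (by simp [RExp.eval, NExp.eval, hJ, hr2])
    (fun i c' => (∀ j, j ≠ 7 → j ≠ 8 → c'.nat j = c.nat j) ∧
      (∀ j, j ≠ 6 → j ≠ 7 → j ≠ 8 → j ≠ 11 → c'.real j = c.real j) ∧
      c'.real 7 = 2 * (2 / 3) ^ i ∧ -1 ≤ c'.real 6 ∧ c'.real 6 + c'.real 7 ≤ 1 ∧
      (c'.time : ℝ) ≤ c.time + 14 + 1501 * M.unit * (T + 1) * (2 * ((3 / 2) ^ i - 1)))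
    (fun i c' => miss a (c'.real 6) (c'.real 7) + (J - i : ℝ) * η) (v := J * η) ?_ ?_ ?_
  · refine h.mono ?_ (fun c' _ => by simp) le_rfl
    rintro c' ⟨h1, h2, h3, _, _, h6⟩
    refine ⟨h1, h2, h3, h6.trans ?_⟩
    have hp : (1 : ℝ) ≤ (3 / 2) ^ J := one_le_pow₀ (by norm_num)
    have hx : (1 : ℝ) ≤ M.unit * (T + 1) := by
      have : (0 : ℝ) ≤ T := Nat.cast_nonneg _
      nlinarith
    nlinarith [mul_nonneg (zero_le_one.trans hx) (zero_le_one.trans hp)]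
  · refine ⟨fun j _ _ => by simp [Config.tick, hn2], fun j h6 h7 _ _ => ?_, ?_, ?_, ?_, ?_⟩
    · simp [Config.tick, hr2, Function.update_of_ne h6, Function.update_of_ne h7]
    · simp [Config.tick, hr2]
    · simp [Config.tick, hr2]
    · simp [Config.tick, hr2]; norm_num
    · simp [Config.tick, ht2, RExp.size, NExp.size]; linarith
  · have : miss a (-1) 2 = 0 := by
      have := abs_le.1 ha1
      exact miss_of_mem this.1 (by linarith)
    simp [Config.tick, hr2, this]
  · rintro i hi c' ⟨hn, hr, h7, hl, hu', ht⟩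
    have hc' : SizesOK M (c'.tick 1).nat := ⟨(hn 1 (by norm_num) (by norm_num)).trans hc.addr,
      (hn 2 (by norm_num) (by norm_num)).trans hc.data,
      (hn 3 (by norm_num) (by norm_num)).trans hc.feat,
      (hn 9 (by norm_num) (by norm_num)).trans hc.counter⟩
    have ha' : M.overlap ((c'.tick 1).nat 6) = a := by
      rw [← ha]; congr 1; exact hn 6 (by norm_num) (by norm_num)
    have e10 : (c'.tick 1).real 10 = c.real 10 :=
      hr 10 (by norm_num) (by norm_num) (by norm_num) (by norm_num)
    have hb := triple_bisect hM hK hq (c'.tick 1) hc' ha'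
      (by rw [show (c'.tick 1).real 7 = c'.real 7 from rfl, h7]; positivity) hl hu'
    rw [e10] at hb
    have e7 : (c'.tick 1).real 7 = 2 * (2 / 3) ^ i := h7
    refine (hb.add_const hM ((J - (i + 1 : ℕ) : ℝ) * η)).mono ?_ (fun _ _ => le_rfl) (le_of_eq ?_)
    · rintro c'' ⟨hn', hr', h7', h6', ht'⟩
      rw [e7] at h7' h6' ht'
      have e6 : (c'.tick 1).real 6 = c'.real 6 := rfl
      rw [e6] at h6'
      rw [h7] at hu'
      have hw : (0 : ℝ) < 2 * (2 / 3) ^ i := by positivity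
      refine ⟨fun j h7 h8 => (hn' j h7 h8).trans (hn j h7 h8),
        fun j h6 h7 h8 h11 => (hr' j h6 h7 h8 h11).trans (hr j h6 h7 h8 h11), ?_, ?_, ?_, ?_⟩
      · rw [h7', pow_succ]; ring
      · rcases h6' with h | h <;> rw [h] <;> linarith
      · rw [h7']; rcases h6' with h | h <;> rw [h] <;> linarith
      · have hinv : (2 : ℝ) / (2 * (2 / 3) ^ i) = (3 / 2) ^ i := by
          rw [div_mul_eq_div_div, div_self (by norm_num), one_div, ← inv_pow]; norm_num
        rw [hinv] at ht'
        simp only [Config.tick, Nat.cast_add, Nat.cast_one] at ht'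
        have hp : (1 : ℝ) ≤ (3 / 2) ^ i := one_le_pow₀ (by norm_num)
        have hx : (1 : ℝ) ≤ M.unit * (T + 1) := by
          have : (0 : ℝ) ≤ T := Nat.cast_nonneg _
          nlinarith
        have hxp : (1 : ℝ) ≤ M.unit * (T + 1) * (3 / 2) ^ i := one_le_mul_of_one_le_of_one_le hx hp
        rw [pow_succ]
        linarith
    · have : (c'.tick 1).real 6 = c'.real 6 := rfl
      rw [this, e7, ← h7]
      push_cast
      ring

/-! ### The classification program -/

open Classical in
/-- `0` if `x ≤ y`, and `1` otherwise. -/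
def exceeds (x y : ℝ) : ℝ := if x ≤ y then 0 else 1

lemma exceeds_nonneg (x y : ℝ) : 0 ≤ exceeds x y := by
  unfold exceeds; split_ifs <;> norm_num

lemma exceeds_le_one (x y : ℝ) : exceeds x y ≤ 1 := by
  unfold exceeds; split_ifs <;> norm_num

lemma exceeds_mono_right {x y z : ℝ} (h : y ≤ z) : exceeds x z ≤ exceeds x y := by
  by_cases hxy : x ≤ y
  · rw [exceeds, if_pos (hxy.trans h)]
    exact exceeds_nonneg _ _
  · rw [show exceeds x y = 1 from if_neg hxy]
    exact exceeds_le_one _ _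

/-- `√(2^ℓ / m)`. -/
def ratioExp : RExp :=
  .app .sqrt (.div (.app .exp (.mul (.ofNat (nreg 1)) (.app .log (rnat 2)))) (.ofNat (nreg 0)))

/-- Add the contribution of the vector with the number in register `6` to real register `5`. -/
def addTerm : Prog :=
  .seq (.readEta (.const 12) (nreg 6)) (.seq (.readAlpha (.const 13) (nreg 6))
    (.seq estimate
      (.seq (.setReal (.const 5) (.add (rreg 5)
        (.mul (.mul (.mul (.mul (rreg 13) (rreg 12)) (rreg 4)) ratioExp)
          (.add (rreg 6) (.div (rreg 7) (rnat 2))))))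
      (.setNat (.const 6) (.add (nreg 6) (.const 1))))))

/-- `C R² / ε`. -/
def sizeExp : RExp := .div (.mul (.mul (rreg 0) (rreg 1)) (rreg 1)) (rreg 2)

/-- The number of bisections: `log (2 C R² / ε) / log (3 / 2)`. -/
def roundsExp : RExp :=
  .div (.app .log (.mul (rnat 2) sizeExp)) (.app .log (.div (rnat 3) (rnat 2)))

/-- The number of trials for each bisection: `864² log (|W| (J + 1) / δ)`. -/
def trialsExp : RExp :=
  .mul (rnat 746496) (.app .log (.div (.mul (.ofNat (nreg 4)) (.add (rreg 9) (rnat 1))) (rreg 3)))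

/-- The program: output zero if `C R ‖Φ(x)‖ ≤ ε`, and add up the estimates of all terms
otherwise. -/
def classify : Prog :=
  .ite (.mul (.mul (rreg 0) (rreg 1)) (rreg 4)) (rreg 2) (.setReal (.const 0) (rnat 0))
    (.seq (.setReal (.const 9) roundsExp) (.seq (.setReal (.const 10) trialsExp)
      (.seq (.loop (.ofNat (nreg 4)) addTerm) (.setReal (.const 0) (rreg 5)))))

/-- The algorithm. -/
def classifier : Algorithm where
  qubits := .add (.add (.add (.const 2) (nreg 1)) (nreg 2)) (nreg 3)
  body := classify

/-- The factor of the overlap in the `s`-th term of the decision value. -/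
def termWeight (M : Memory) (m : ℕ) (normX : ℝ) (s : ℕ) : ℝ :=
  M.alpha s * M.eta s * normX * Real.sqrt (2 ^ M.ℓ / m)

/-- Accumulation of the estimates of all terms. The error of the sum exceeds the sum of the errors
`(2/3)^J β_s` only if one of the bisections has lost its overlap. -/
lemma triple_loop_addTerm {M : Memory} (hM : M.IsUnitary) (hK : M.KeepsPoint) {q : ℕ}
    (hq : q = 2 + M.ℓ + M.n + M.N) (c : Config q) (hc : SizesOK M c.nat) (h5 : c.real 5 = 0)
    (h6 : c.nat 6 = 0) {a : ℕ → ℝ} (ha : ∀ s < c.nat 4, M.overlap s = a s)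
    (hα : ∀ s, 0 ≤ M.alpha s) (hη : ∀ s, 0 ≤ M.eta s) (h4 : 0 ≤ c.real 4) :
    Triple M (.loop (.ofNat (nreg 4)) addTerm) c
      (fun c' => (c'.time : ℝ) ≤ c.time + 4 + c.nat 4 * (4100 * M.unit * (⌈c.real 10⌉₊ + 1) *
        (3 / 2) ^ ⌈c.real 9⌉₊))
      (fun c' => exceeds
        |c'.real 5 - ∑ s ∈ Finset.range (c.nat 4), termWeight M (c.nat 0) (c.real 4) s * a s|
        ((2 / 3) ^ ⌈c.real 9⌉₊ *
          ∑ s ∈ Finset.range (c.nat 4), termWeight M (c.nat 0) (c.real 4) s))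
      (c.nat 4 * (⌈c.real 9⌉₊ * Real.exp (-decayRate) ^ ⌈c.real 10⌉₊)) := by
  set T := ⌈c.real 10⌉₊ with hT
  set J := ⌈c.real 9⌉₊ with hJ
  set β := termWeight M (c.nat 0) (c.real 4) with hβ
  set φ := (J : ℝ) * Real.exp (-decayRate) ^ T with hφ
  have hu : (1 : ℝ) ≤ M.unit := by
    have : 1 ≤ M.unit := by unfold Memory.unit; omega
    exact_mod_cast this
  have hβ0 : ∀ s, 0 ≤ β s := fun s => by
    have := hα s; have := hη s
    simp only [hβ, termWeight]; positivity
  have h := Triple.loop (M := M) (a := .ofNat (nreg 4)) (p := addTerm) (c := c) (n := c.nat 4)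
    (by simp [RExp.eval, NExp.eval])
    (fun i c' => c'.nat 6 = i ∧ (∀ j, j ≠ 6 → j ≠ 7 → j ≠ 8 → c'.nat j = c.nat j) ∧
      c'.real 4 = c.real 4 ∧ c'.real 9 = c.real 9 ∧ c'.real 10 = c.real 10 ∧
      (c'.time : ℝ) ≤ c.time + 4 + i * (4100 * M.unit * (T + 1) * (3 / 2) ^ J))
    (fun i c' => exceeds |c'.real 5 - ∑ s ∈ Finset.range i, β s * a s|
        ((2 / 3) ^ J * ∑ s ∈ Finset.range i, β s) + (c.nat 4 - i : ℝ) * φ)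
    (v := c.nat 4 * φ) ?_ ?_ ?_
  · exact h.mono (fun c' h => h.2.2.2.2.2) (fun c' _ => by simp) le_rfl
  · refine ⟨h6, fun _ _ _ _ => rfl, rfl, rfl, rfl, ?_⟩
    simp [Config.tick, RExp.size, NExp.size]
  · simp [Config.tick, h5, exceeds]
  rintro i hi c₀ ⟨g6, gn, gr4, gr9, gr10, gt⟩
  set b := exceeds |c₀.real 5 - ∑ s ∈ Finset.range i, β s * a s|
    ((2 / 3) ^ J * ∑ s ∈ Finset.range i, β s) with hb
  have hv : b + (c.nat 4 - i : ℝ) * φ = φ + (b + (c.nat 4 - (i + 1 : ℕ) : ℝ) * φ) := by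
    push_cast; ring
  rw [hv]
  set v := φ + (b + (c.nat 4 - (i + 1 : ℕ) : ℝ) * φ)
  -- reading the coefficients
  refine Triple.seq (Mid := fun c' => c'.nat = c₀.nat ∧
    c'.real = Function.update c₀.real 12 (M.eta i) ∧ c'.time = c₀.time + 5) (h := fun _ => v)
    (Triple.readEta ⟨rfl, ?_, ?_⟩ le_rfl) ?_
  · simp [NExp.eval, Config.tick, g6]
  · simp [NExp.size, Config.tick]
  rintro c₁ ⟨n1, r1, t1⟩
  refine Triple.seq (Mid := fun c' => c'.nat = c₀.nat ∧
    c'.real = Function.update (Function.update c₀.real 12 (M.eta i)) 13 (M.alpha i) ∧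
    c'.time = c₀.time + 9 + M.qramTime) (h := fun _ => v)
    (Triple.readAlpha ⟨n1, ?_, ?_⟩ le_rfl) ?_
  · simp [NExp.eval, n1, r1, g6]
  · simp only [NExp.size, Config.tick, t1]; omega
  rintro c₂ ⟨n2, r2, t2⟩
  have hc2 : SizesOK M c₂.nat := by
    rw [n2]
    exact ⟨(gn 1 (by norm_num) (by norm_num) (by norm_num)).trans hc.addr,
      (gn 2 (by norm_num) (by norm_num) (by norm_num)).trans hc.data,
      (gn 3 (by norm_num) (by norm_num) (by norm_num)).trans hc.feat,
      (gn 9 (by norm_num) (by norm_num) (by norm_num)).trans hc.counter⟩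
  have he := triple_estimate hM hK hq c₂ hc2 (a := a i) (by rw [n2, g6]; exact ha i hi)
  have e9 : c₂.real 9 = c.real 9 := by simp [r2, gr9]
  have e10 : c₂.real 10 = c.real 10 := by simp [r2, gr10]
  rw [e9, e10] at he
  refine Triple.seq (he.add_const hM (b + (c.nat 4 - (i + 1 : ℕ) : ℝ) * φ)) ?_
  rintro c₃ ⟨n3, r3, w3, t3⟩
  have q5 : c₃.real 5 = c₀.real 5 := by
    rw [r3 5 (by norm_num) (by norm_num) (by norm_num) (by norm_num)]; simp [r2]
  have q4 : c₃.real 4 = c.real 4 := by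
    rw [r3 4 (by norm_num) (by norm_num) (by norm_num) (by norm_num)]; simp [r2, gr4]
  have q12 : c₃.real 12 = M.eta i := by
    rw [r3 12 (by norm_num) (by norm_num) (by norm_num) (by norm_num)]; simp [r2]
  have q13 : c₃.real 13 = M.alpha i := by
    rw [r3 13 (by norm_num) (by norm_num) (by norm_num) (by norm_num)]; simp [r2]
  have q9 : c₃.real 9 = c.real 9 := by
    rw [r3 9 (by norm_num) (by norm_num) (by norm_num) (by norm_num)]; exact e9
  have q10 : c₃.real 10 = c.real 10 := by
    rw [r3 10 (by norm_num) (by norm_num) (by norm_num) (by norm_num)]; exact e10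
  have k0 : c₃.nat 0 = c.nat 0 := by
    rw [n3 0 (by norm_num) (by norm_num), n2, gn 0 (by norm_num) (by norm_num) (by norm_num)]
  have k1 : c₃.nat 1 = M.ℓ := by
    rw [n3 1 (by norm_num) (by norm_num), n2, gn 1 (by norm_num) (by norm_num) (by norm_num),
      hc.addr]
  have k6 : c₃.nat 6 = i := by rw [n3 6 (by norm_num) (by norm_num), n2, g6]
  have kn : ∀ j, j ≠ 6 → j ≠ 7 → j ≠ 8 → c₃.nat j = c.nat j := fun j h6 h7 h8 => by
    rw [n3 j h7 h8, n2, gn j h6 h7 h8]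
  have hpow : Real.exp ((M.ℓ : ℝ) * Real.log 2) = 2 ^ M.ℓ := by
    rw [mul_comm, Real.exp_mul, Real.exp_log (by norm_num), Real.rpow_natCast]
  refine Triple.seq (Mid := fun c' => c'.nat = c₃.nat ∧
    c'.real = Function.update c₃.real 5 (c₀.real 5 + β i * (c₃.real 6 + c₃.real 7 / 2)) ∧
    c'.time ≤ c₃.time + 60)
    (h := fun _ => miss (a i) (c₃.real 6) (c₃.real 7) + (b + (c.nat 4 - (i + 1 : ℕ) : ℝ) * φ))
    (Triple.setReal ⟨rfl, ?_, ?_⟩ le_rfl) ?_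
  · simp [NExp.eval, RExp.eval, Elem.eval, ratioExp, q5, q4, q12, q13, k0, k1, hpow, hβ,
      termWeight]
  · simp [Config.tick, NExp.size, RExp.size, ratioExp]
  rintro c₄ ⟨n4, r4, t4⟩
  refine Triple.setNat ⟨?_, ?_, ?_, ?_, ?_, ?_⟩ ?_
  · simp [NExp.eval, n4, k6]
  · intro j h6 h7 h8
    simp only [NExp.eval, Function.update_of_ne h6]
    exact (congrFun n4 j).trans (kn j h6 h7 h8)
  · simp [Config.tick, r4, q4]
  · simp [Config.tick, r4, q9]
  · simp [Config.tick, r4, q10]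
  · have ht4 : (c₄.time : ℝ) ≤ c₃.time + 60 := by exact_mod_cast t4
    have ht2 : (c₂.time : ℝ) = c₀.time + 9 + M.qramTime := by
      rw [t2]; push_cast [Config.tick]; ring
    have hqr : (M.qramTime : ℝ) ≤ M.unit := by
      have : M.qramTime ≤ M.unit := by unfold Memory.unit; omega
      exact_mod_cast this
    have hp : (1 : ℝ) ≤ (3 / 2) ^ J := one_le_pow₀ (by norm_num)
    have hT1 : (1 : ℝ) ≤ T + 1 := by
      have : (0 : ℝ) ≤ T := Nat.cast_nonneg _
      linarith
    have hbig : (M.unit : ℝ) ≤ M.unit * (T + 1) * (3 / 2) ^ J := by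
      have := one_le_mul_of_one_le_of_one_le hT1 hp
      nlinarith
    simp only [Config.tick, NExp.size]
    push_cast
    rw [add_mul, one_mul]
    linarith
  · -- the error of the new sum
    have hr5 : ({ c₄.tick (1 + (NExp.const 6).size + ((nreg 6).add (.const 1)).size) with
        nat := Function.update c₄.nat ((NExp.const 6).eval c₄.nat)
          (((nreg 6).add (.const 1)).eval c₄.nat) } : Config q).real 5 =
        c₀.real 5 + β i * (c₃.real 6 + c₃.real 7 / 2) := by
      simp [Config.tick, r4]
    rw [hr5, ← add_assoc]
    gcongr ?_ + _
    by_cases hm : c₃.real 6 ≤ a i ∧ a i ≤ c₃.real 6 + c₃.real 7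
    swap
    · rw [miss, if_neg hm]
      have := exceeds_nonneg |c₀.real 5 - ∑ s ∈ Finset.range i, β s * a s|
        ((2 / 3) ^ J * ∑ s ∈ Finset.range i, β s)
      exact (exceeds_le_one _ _).trans (by linarith)
    rw [miss, if_pos hm, zero_add]
    by_cases hle : |c₀.real 5 - ∑ s ∈ Finset.range i, β s * a s| ≤
        (2 / 3) ^ J * ∑ s ∈ Finset.range i, β s
    swap
    · rw [hb]
      conv_rhs => rw [exceeds, if_neg hle]
      exact exceeds_le_one _ _
    refine le_trans (le_of_eq ?_) (exceeds_nonneg _ _)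
    rw [exceeds, if_pos]
    rw [w3] at hm ⊢
    rw [Finset.sum_range_succ, Finset.sum_range_succ]
    have hdiff : |c₃.real 6 + 2 * (2 / 3) ^ J / 2 - a i| ≤ (2 / 3) ^ J := by
      rw [abs_le]; constructor <;> linarith [hm.1, hm.2]
    calc _ = |(c₀.real 5 - ∑ s ∈ Finset.range i, β s * a s) +
          β i * (c₃.real 6 + 2 * (2 / 3) ^ J / 2 - a i)| := by congr 1; ring
      _ ≤ (2 / 3) ^ J * ∑ s ∈ Finset.range i, β s + β i * (2 / 3) ^ J := by
        refine (abs_add_le _ _).trans (add_le_add hle ?_)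
        rw [abs_mul, abs_of_nonneg (hβ0 i)]
        exact mul_le_mul_of_nonneg_left hdiff (hβ0 i)
      _ = _ := by ring

/-- The real number whose ceiling is the number of bisections, where `S = C R² / ε`. -/
def rounds (S : ℝ) : ℝ := Real.log (2 * S) / Real.log (3 / 2)

/-- The real number whose ceiling is the number of trials for each bisection. -/
def trials (S δ : ℝ) (w : ℕ) : ℝ := 746496 * Real.log (w * (rounds S + 1) / δ)

/-- The branch of the program that computes a non-trivial estimate. -/
lemma triple_classify_of_lt {M : Memory} (hM : M.IsUnitary) (hK : M.KeepsPoint) {q : ℕ}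
    (hq : q = 2 + M.ℓ + M.n + M.N) (c : Config q) (hc : SizesOK M c.nat) (h5 : c.real 5 = 0)
    (h6 : c.nat 6 = 0) {a : ℕ → ℝ} (ha : ∀ s < c.nat 4, M.overlap s = a s)
    (hα : ∀ s, 0 ≤ M.alpha s) (hη : ∀ s, 0 ≤ M.eta s) (h4 : 0 ≤ c.real 4)
    (hlt : c.real 2 < c.real 0 * c.real 1 * c.real 4) {S : ℝ}
    (hS : S = c.real 0 * c.real 1 * c.real 1 / c.real 2) :
    Triple M classify c
      (fun c' => (c'.time : ℝ) ≤ c.time + 100 + c.nat 4 * (4100 * M.unit *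
        (⌈trials S (c.real 3) (c.nat 4)⌉₊ + 1) * (3 / 2) ^ ⌈rounds S⌉₊))
      (fun c' => exceeds
        |c'.real 0 - ∑ s ∈ Finset.range (c.nat 4), termWeight M (c.nat 0) (c.real 4) s * a s|
        ((2 / 3) ^ ⌈rounds S⌉₊ *
          ∑ s ∈ Finset.range (c.nat 4), termWeight M (c.nat 0) (c.real 4) s))
      (c.nat 4 * (⌈rounds S⌉₊ * Real.exp (-decayRate) ^ ⌈trials S (c.real 3) (c.nat 4)⌉₊)) := by
  set v := c.nat 4 * (⌈rounds S⌉₊ * Real.exp (-decayRate) ^ ⌈trials S (c.real 3) (c.nat 4)⌉₊)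
  refine Triple.ite (fun h => absurd h ?_) fun _ => ?_
  · simpa [RExp.eval, NExp.eval] using hlt
  refine Triple.seq (Mid := fun c' => c'.nat = c.nat ∧
    c'.real = Function.update c.real 9 (rounds S) ∧ c'.time ≤ c.time + 40) (h := fun _ => v)
    (Triple.setReal ⟨rfl, ?_, ?_⟩ le_rfl) ?_
  · simp [NExp.eval, RExp.eval, Elem.eval, roundsExp, sizeExp, Config.tick, rounds, hS]
  · simp [NExp.size, RExp.size, roundsExp, sizeExp, Config.tick]
  rintro c₁ ⟨n1, r1, t1⟩
  refine Triple.seq (Mid := fun c' => c'.nat = c.nat ∧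
    c'.real = Function.update (Function.update c.real 9 (rounds S)) 10
      (trials S (c.real 3) (c.nat 4)) ∧ c'.time ≤ c.time + 80) (h := fun _ => v)
    (Triple.setReal ⟨n1, ?_, ?_⟩ le_rfl) ?_
  · simp [NExp.eval, RExp.eval, Elem.eval, trialsExp, trials, n1, r1]
  · simp [NExp.size, RExp.size, trialsExp, Config.tick]
    omega
  rintro c₂ ⟨n2, r2, t2⟩
  have hc2 : SizesOK M c₂.nat := by rw [n2]; exact hc
  have hl := triple_loop_addTerm hM hK hq c₂ hc2 (by simp [r2, h5]) (by simp [n2, h6]) (a := a)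
    (by rw [n2]; exact ha) hα hη (by simp [r2, h4])
  have e9 : c₂.real 9 = rounds S := by simp [r2]
  have e10 : c₂.real 10 = trials S (c.real 3) (c.nat 4) := by simp [r2]
  have e4 : c₂.real 4 = c.real 4 := by simp [r2]
  rw [e9, e10, e4, n2] at hl
  refine Triple.seq hl fun c₃ h3 => Triple.setReal ?_ (le_of_eq ?_)
  · have ht : (c₂.time : ℝ) ≤ c.time + 80 := by exact_mod_cast t2
    simp only [Config.tick, NExp.size, RExp.size]
    push_cast
    linarith
  · simp [NExp.eval, RExp.eval]

/-- The branch of the program that outputs zero. -/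
lemma triple_classify_of_le {M : Memory} {q : ℕ} (c : Config q)
    (hle : c.real 0 * c.real 1 * c.real 4 ≤ c.real 2) {t : ℝ}
    (ht : |t| ≤ c.real 0 * c.real 1 * c.real 4) :
    Triple M classify c (fun c' => (c'.time : ℝ) ≤ c.time + 100)
      (fun c' => exceeds |c'.real 0 - t| (c.real 2)) 0 := by
  refine Triple.ite (fun _ => Triple.setReal ?_ (le_of_eq ?_)) fun h => absurd ?_ h
  · simp [Config.tick, NExp.size, RExp.size]
    linarith
  · simp [NExp.eval, RExp.eval, exceeds, ht.trans hle]
  · simpa [RExp.eval, NExp.eval] using hle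

/-- A bound for the expectation of the failure indicator bounds the success probability. -/
lemma Algorithm.le_prob_of_triple (P : Algorithm) {M : Memory} (hM : M.IsUnitary) (a : List ℕ)
    (r : List ℝ) {Post : Config (P.qubits.eval fun i => a.getD i 0) → Prop} {t ε v : ℝ}
    (h : Triple M P.body
      { nat := fun i => a.getD i 0
        real := fun i => r.getD i 0
        amp := Pi.single (fun _ => false) 1
        time := 0 } Post (fun c' => exceeds |c'.real 0 - t| ε) v) :
    1 - v ≤ P.prob M a r (fun out => |out - t| ≤ ε) := by
  have hw := exec_weight hM P.body
    ({ nat := fun i => a.getD i 0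
       real := fun i => r.getD i 0
       amp := Pi.single (fun _ => false) 1
       time := 0 } : Config (P.qubits.eval fun i => a.getD i 0))
  have h1 : ({ nat := fun i => a.getD i 0
               real := fun i => r.getD i 0
               amp := Pi.single (fun _ => false) 1
               time := 0 } : Config (P.qubits.eval fun i => a.getD i 0)).weight = 1 :=
    sum_norm_sq_ket0
  have h2 := h.2
  rw [h1] at hw h2
  have e : P.prob M a r (fun out => |out - t| ≤ ε) +
      ((P.run M a r).map fun c' => c'.weight * exceeds |c'.real 0 - t| ε).sum =
      ((P.run M a r).map Config.weight).sum := by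
    rw [Algorithm.prob, ← List.sum_map_add]
    congr 2
    funext c'
    unfold exceeds
    split_ifs <;> simp
  have e' : ((P.run M a r).map Config.weight).sum = 1 := hw
  have h2' : ((P.run M a r).map fun c' => c'.weight * exceeds |c'.real 0 - t| ε).sum ≤ 1 * v := h2
  linarith

lemma log_three_halves_pos : 0 < Real.log (3 / 2) := Real.log_pos (by norm_num)

lemma rounds_nonneg {S : ℝ} (hS : 1 ≤ S) : 0 ≤ rounds S :=
  div_nonneg (Real.log_nonneg (by linarith)) log_three_halves_pos.le

lemma three_halves_rpow_rounds {S : ℝ} (hS : 1 ≤ S) : (3 / 2 : ℝ) ^ rounds S = 2 * S := by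
  rw [Real.rpow_def_of_pos (by norm_num), rounds, mul_div_cancel₀ _ log_three_halves_pos.ne',
    Real.exp_log (by linarith)]

/-- The cost of the last bisection is proportional to `S`. -/
lemma three_halves_pow_le {S : ℝ} (hS : 1 ≤ S) : (3 / 2 : ℝ) ^ ⌈rounds S⌉₊ ≤ 3 * S := by
  have h := (Nat.ceil_lt_add_one (rounds_nonneg hS)).le
  rw [← Real.rpow_natCast]
  refine (Real.rpow_le_rpow_of_exponent_le (by norm_num) h).trans (le_of_eq ?_)
  rw [Real.rpow_add (by norm_num), three_halves_rpow_rounds hS, Real.rpow_one]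
  ring

/-- The width of the last interval. -/
lemma two_thirds_pow_mul_le {S : ℝ} (hS : 1 ≤ S) : (2 / 3 : ℝ) ^ ⌈rounds S⌉₊ * (2 * S) ≤ 1 := by
  have h : 2 * S ≤ (3 / 2 : ℝ) ^ ⌈rounds S⌉₊ := by
    rw [← three_halves_rpow_rounds hS, ← Real.rpow_natCast]
    exact Real.rpow_le_rpow_of_exponent_le (by norm_num) (Nat.le_ceil _)
  calc (2 / 3 : ℝ) ^ ⌈rounds S⌉₊ * (2 * S)
      ≤ (2 / 3 : ℝ) ^ ⌈rounds S⌉₊ * (3 / 2 : ℝ) ^ ⌈rounds S⌉₊ := by gcongr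
    _ = 1 := by rw [← mul_pow]; norm_num

/-- The failure probabilities of all bisections add up to at most `δ`. -/
lemma failure_le {S δ : ℝ} (hS : 1 ≤ S) (hδ : 0 < δ) {w : ℕ} (hw : 1 ≤ w) :
    w * (⌈rounds S⌉₊ * Real.exp (-decayRate) ^ ⌈trials S δ w⌉₊) ≤ δ := by
  have hJ := rounds_nonneg hS
  have hw' : (1 : ℝ) ≤ w := by exact_mod_cast hw
  have hX : 0 < w * (rounds S + 1) / δ := by positivity
  have h1 : Real.exp (-decayRate) ^ ⌈trials S δ w⌉₊ ≤ δ / (w * (rounds S + 1)) := by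
    rw [← Real.exp_nat_mul]
    calc Real.exp (⌈trials S δ w⌉₊ * -decayRate)
        ≤ Real.exp (-Real.log (w * (rounds S + 1) / δ)) := by
          apply Real.exp_le_exp.2
          have := Nat.le_ceil (trials S δ w)
          have e : decayRate * trials S δ w = Real.log (w * (rounds S + 1) / δ) := by
            unfold trials decayRate; ring
          have h2 : decayRate * trials S δ w ≤ decayRate * ⌈trials S δ w⌉₊ :=
            mul_le_mul_of_nonneg_left this (by unfold decayRate; norm_num)
          linarith
      _ = _ := by rw [Real.exp_neg, Real.exp_log hX, inv_div]
  calc (w : ℝ) * (⌈rounds S⌉₊ * Real.exp (-decayRate) ^ ⌈trials S δ w⌉₊)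
      ≤ w * ((rounds S + 1) * (δ / (w * (rounds S + 1)))) := by
        gcongr
        exact (Nat.ceil_lt_add_one hJ).le
    _ = δ := by field_simp

/-! ### The decision value as a sum of overlaps -/

lemma bit_nonneg (b : Bool) : 0 ≤ bit b := by unfold bit; split_ifs <;> norm_num

lemma bit_le_one (b : Bool) : bit b ≤ 1 := by unfold bit; split_ifs <;> norm_num

/-- Summation over addresses: only those of the `m` stored entries contribute. -/
lemma sum_dite_ofBits {m ℓ : ℕ} (hm : m ≤ 2 ^ ℓ) (F : Fin m → ℝ) :
    ∑ b : Bits ℓ, (if h : Nat.ofBits b < m then F ⟨Nat.ofBits b, h⟩ else 0) = ∑ i, F i := by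
  have hof : ∀ i : Fin m, Nat.ofBits (fun j : Fin ℓ => (i : ℕ).testBit j) = i := fun i => by
    rw [Nat.ofBits_testBit, Nat.mod_eq_of_lt (i.2.trans_le hm)]
  refine (Fintype.sum_of_injective (fun i : Fin m => fun j : Fin ℓ => (i : ℕ).testBit j) ?_ _ _
    ?_ ?_).symm
  · intro i j h
    have h' := congrArg Nat.ofBits h
    simp only [hof] at h'
    exact Fin.ext h'
  · intro b hb
    rw [dif_neg]
    intro h
    refine hb ⟨⟨Nat.ofBits b, h⟩, funext fun j => ?_⟩
    simp [Nat.testBit_ofBits_lt b j j.2]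
  · intro i
    simp [hof]

section TrainingSet

variable {m n N : ℕ} {Φ : Bits n → Feature N} {pts : Fin m → Bits n} {y : Fin m → ℝ}

lemma norm_le_maxNorm (i : Fin m) : ‖Φ (pts i)‖ ≤ maxNorm Φ pts :=
  le_ciSup (f := fun i => ‖Φ (pts i)‖) (Set.finite_range _).bddAbove i

lemma maxNorm_nonneg : 0 ≤ maxNorm Φ pts := Real.iSup_nonneg fun _ => norm_nonneg _

lemma eta_le_maxNorm (c : Bits m) : eta Φ pts c ≤ maxNorm Φ pts := by
  unfold eta
  refine Real.sqrt_le_iff.2 ⟨maxNorm_nonneg, div_le_of_le_mul₀ (Nat.cast_nonneg _) (sq_nonneg _) ?_⟩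
  calc ∑ i, bit (c i) * ‖Φ (pts i)‖ ^ 2 ≤ ∑ _i : Fin m, maxNorm Φ pts ^ 2 := by
        refine Finset.sum_le_sum fun i _ => ?_
        have := pow_le_pow_left₀ (norm_nonneg _) (norm_le_maxNorm (Φ := Φ) (pts := pts) i) 2
        have h1 := bit_le_one (c i)
        nlinarith [sq_nonneg ‖Φ (pts i)‖]
    _ = _ := by simp [mul_comm]

/-- The norm of `Ψ_c` is at most the mean of the norms of the feature vectors. -/
lemma norm_Psi_le_maxNorm (hy : ∀ i, y i = 1 ∨ y i = -1) (c : Bits m) :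
    ‖Psi Φ pts y c‖ ≤ maxNorm Φ pts := by
  unfold Psi
  have hy' : ∀ i, |y i| = 1 := fun i => by rcases hy i with h | h <;> simp [h]
  have h : ‖∑ i, (bit (c i) * y i) • Φ (pts i)‖ ≤ m * maxNorm Φ pts := by
    calc _ ≤ ∑ i, ‖(bit (c i) * y i) • Φ (pts i)‖ := norm_sum_le _ _
      _ ≤ ∑ _i : Fin m, maxNorm Φ pts := by
        refine Finset.sum_le_sum fun i _ => ?_
        rw [norm_smul, Real.norm_eq_abs, abs_mul, hy', mul_one, abs_of_nonneg (bit_nonneg _)]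
        exact (mul_le_of_le_one_left (norm_nonneg _) (bit_le_one _)).trans (norm_le_maxNorm i)
      _ = _ := by simp
  rw [norm_smul, Real.norm_of_nonneg (by positivity)]
  rcases Nat.eq_zero_or_pos m with rfl | hm
  · simpa using maxNorm_nonneg
  · have hm' : (0 : ℝ) < m := by exact_mod_cast hm
    calc 1 / (m : ℝ) * _ ≤ 1 / m * (m * maxNorm Φ pts) := by gcongr
      _ = _ := by field_simp

/-- If all `c_i ‖Φ(x_i)‖` vanish, so does `Ψ_c`; hence the division by `η_c` is a proper one. -/
lemma eta_ne_zero {c : Bits m} (h : Psi Φ pts y c ≠ 0) : eta Φ pts c ≠ 0 := by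
  intro h0
  apply h
  have hnn : ∀ i, 0 ≤ bit (c i) * ‖Φ (pts i)‖ ^ 2 := fun i =>
    mul_nonneg (bit_nonneg _) (sq_nonneg _)
  have h1 : (∑ i, bit (c i) * ‖Φ (pts i)‖ ^ 2) / (m : ℝ) = 0 :=
    (Real.sqrt_eq_zero (div_nonneg (Finset.sum_nonneg fun i _ => hnn i) (Nat.cast_nonneg _))).1 h0
  unfold Psi
  rcases div_eq_zero_iff.1 h1 with h2 | h2
  · rw [Finset.sum_eq_zero fun i _ => ?_, smul_zero]
    rcases mul_eq_zero.1 ((Finset.sum_eq_zero_iff_of_nonneg fun i _ => hnn i).1 h2 i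
      (Finset.mem_univ i)) with h3 | h3
    · rw [h3, zero_mul, zero_smul]
    · rw [norm_eq_zero.1 (pow_eq_zero_iff (two_ne_zero) |>.1 h3), smul_zero]
  · simp [h2]

end TrainingSet

section Classification

variable {m n N : ℕ} {κ tmax TΦ : ℕ} {Φ : Bits n → Feature N}
  {U : Matrix (Fin n ⊕ Fin N → Bool) (Fin n ⊕ Fin N → Bool) ℂ} {pts : Fin m → Bits n}
  {y : Fin m → ℝ} {W : Finset (Bits m)} {e : Fin W.card ≃ W} {α : Bits m → ℝ}
  {V : Fin W.card → Matrix (Bits (Nat.clog 2 m)) (Bits (Nat.clog 2 m)) ℂ} {x : Bits n}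

lemma classificationMemory_isUnitary (hU : IsFeatureMap U Φ)
    (hV : ∀ s, IsStatePrep Φ pts y (V s) (e s)) :
    (classificationMemory κ tmax Φ U TΦ pts W e α V x).IsUnitary where
  prep s := by
    simp only [classificationMemory]
    split_ifs with h
    · exact (hV _).1
    · exact Submonoid.one_mem (Matrix.unitaryGroup (Bits (Nat.clog 2 m)) ℂ)
  feat := hU.1

lemma classificationMemory_keepsPoint (hU : IsFeatureMap U Φ) (hx : Φ x ≠ 0) :
    (classificationMemory κ tmax Φ U TΦ pts W e α V x).KeepsPoint := fun x' z h => by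
  refine (hU.2 x hx x' z).trans (if_neg h)

/-- The contribution of the `i`-th training point to the overlap for the vector `c`. -/
def overlapTerm (Φ : Bits n → Feature N) (pts : Fin m → Bits n) (y : Fin m → ℝ) (x : Bits n)
    (c : Bits m) (i : Fin m) : ℝ :=
  stored Φ pts y c i / eta Φ pts c * ((1 / Real.sqrt 2) ^ Nat.clog 2 m *
    (inner ℝ (Φ (pts i)) (Φ x) / (‖Φ (pts i)‖ * ‖Φ x‖)))

lemma overlap_classificationMemory (hU : IsFeatureMap U Φ)
    (hV : ∀ s, IsStatePrep Φ pts y (V s) (e s)) (hx : Φ x ≠ 0) (s : Fin W.card) :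
    (classificationMemory κ tmax Φ U TΦ pts W e α V x).overlap s =
      ((∑ i, overlapTerm Φ pts y x (e s) i : ℝ) : ℂ) := by
  have key : ∀ b : Bits (Nat.clog 2 m), conj (V s b fun _ => false) *
      ((1 / (Real.sqrt 2 : ℝ) : ℂ) ^ Nat.clog 2 m * ∑ z : Bits N, conj (U (Sum.elim (cellOf pts b) z)
        (Sum.elim (cellOf pts b) fun _ => false)) * U (Sum.elim x z) (Sum.elim x fun _ => false)) =
      ((if h : Nat.ofBits b < m then overlapTerm Φ pts y x (e s) ⟨Nat.ofBits b, h⟩ else 0 : ℝ) :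
        ℂ) := by
    intro b
    rw [(hV s).2 b]
    by_cases hb : Nat.ofBits b < m
    swap
    · simp [hb]
    rw [dif_pos hb, dif_pos hb]
    set i : Fin m := ⟨Nat.ofBits b, hb⟩
    have hcell : cellOf pts b = pts i := dif_pos hb
    rw [Complex.conj_ofReal]
    by_cases h0 : Φ (pts i) = 0
    · simp [overlapTerm, stored, h0]
    have hs : ∑ z : Bits N, conj (U (Sum.elim (cellOf pts b) z)
          (Sum.elim (cellOf pts b) fun _ => false)) * U (Sum.elim x z) (Sum.elim x fun _ => false) =
        ((inner ℝ (Φ (pts i)) (Φ x) / (‖Φ (pts i)‖ * ‖Φ x‖) : ℝ) : ℂ) := by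
      rw [hcell, PiLp.inner_apply, Finset.sum_div, Complex.ofReal_sum]
      refine Finset.sum_congr rfl fun z _ => ?_
      rw [hU.2 _ h0, hU.2 _ hx, if_pos rfl, if_pos rfl, Complex.conj_ofReal, ← Complex.ofReal_mul]
      congr 1
      simp only [RCLike.inner_apply, conj_trivial]
      rw [div_mul_div_comm, mul_comm (Φ (pts i) z)]
    unfold overlapTerm
    rw [Complex.ofReal_mul, Complex.ofReal_mul, ← hs]
    push_cast
    rfl
  rw [← sum_dite_ofBits (Nat.le_pow_clog (by norm_num) m) (overlapTerm Φ pts y x (e s)),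
    Complex.ofReal_sum]
  unfold Memory.overlap
  refine Finset.sum_congr rfl fun b _ => ?_
  simp only [classificationMemory, dif_pos s.2, Fin.eta]
  exact key b

/-- The overlap with the proper factor is the contribution of `c` to the decision value. -/
lemma mul_sum_overlapTerm (hm : 0 < m) (hx : Φ x ≠ 0) {c : Bits m} (hη : eta Φ pts c ≠ 0) :
    eta Φ pts c * ‖Φ x‖ * Real.sqrt (2 ^ Nat.clog 2 m / m) * ∑ i, overlapTerm Φ pts y x c i =
      inner ℝ (Psi Φ pts y c) (Φ x) := by
  have hm' : (0 : ℝ) < m := by exact_mod_cast hm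
  have hx' : ‖Φ x‖ ≠ 0 := norm_ne_zero_iff.2 hx
  unfold Psi
  rw [real_inner_smul_left, sum_inner, Finset.mul_sum, Finset.mul_sum]
  refine Finset.sum_congr rfl fun i _ => ?_
  rw [real_inner_smul_left]
  have hs : Real.sqrt (2 ^ Nat.clog 2 m / m) * (1 / Real.sqrt 2) ^ Nat.clog 2 m = 1 / Real.sqrt m := by
    have h2 : Real.sqrt (2 ^ Nat.clog 2 m) = Real.sqrt 2 ^ Nat.clog 2 m := by
      refine Real.sqrt_eq_iff_mul_self_eq (by positivity) (by positivity) |>.2 ?_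
      rw [← mul_pow, Real.mul_self_sqrt (by norm_num)]
    rw [Real.sqrt_div (by positivity), h2, one_div, inv_pow]
    field_simp
  by_cases h0 : Φ (pts i) = 0
  · simp [overlapTerm, stored, h0]
  have h0' : ‖Φ (pts i)‖ ≠ 0 := norm_ne_zero_iff.2 h0
  calc _ = bit (c i) * y i / Real.sqrt m *
        (Real.sqrt (2 ^ Nat.clog 2 m / m) * (1 / Real.sqrt 2) ^ Nat.clog 2 m) *
        inner ℝ (Φ (pts i)) (Φ x) := by
        unfold overlapTerm stored
        field_simp
    _ = _ := by
        rw [hs]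
        have := Real.mul_self_sqrt hm'.le
        have h3 : Real.sqrt m ≠ 0 := (Real.sqrt_pos.2 hm').ne'
        field_simp
        rw [sq, this]
        ring

lemma sum_range_card {G : Bits m → ℝ} (e : Fin W.card ≃ W) :
    ∑ s ∈ Finset.range W.card, (if h : s < W.card then G (e ⟨s, h⟩) else 0) = ∑ c ∈ W, G c := by
  rw [Finset.sum_range, ← Finset.sum_coe_sort W]
  simp only [Fin.is_lt, dite_true, Fin.eta]
  exact Equiv.sum_comp e fun c : W => G c

lemma two_pow_clog_div_le (hm : 0 < m) : (2 : ℝ) ^ Nat.clog 2 m / m ≤ 2 := by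
  have hm' : (0 : ℝ) < m := by exact_mod_cast hm
  rw [div_le_iff₀ hm']
  have : 2 ^ Nat.clog 2 m ≤ 2 * m := by
    rcases Nat.lt_or_ge 1 m with h | h
    · have h1 := Nat.pow_pred_clog_lt_self (b := 2) (by norm_num) h
      have h2 : 0 < Nat.clog 2 m := Nat.clog_pos (by norm_num) h
      obtain ⟨k, hk⟩ := Nat.exists_eq_succ_of_ne_zero h2.ne'
      rw [hk] at h1 ⊢
      simp only [Nat.pred_succ, Nat.succ_eq_add_one] at h1
      rw [Nat.succ_eq_add_one, pow_succ]
      omega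
    · obtain rfl : m = 1 := by omega
      simp
  exact_mod_cast this

lemma sum_termWeight_le (hm : 0 < m) {C : ℝ} (hα : DualFeasible W C α)
    (hxR : ‖Φ x‖ ≤ maxNorm Φ pts) :
    ∑ s ∈ Finset.range W.card,
      termWeight (classificationMemory κ tmax Φ U TΦ pts W e α V x) m ‖Φ x‖ s ≤
        2 * (C * maxNorm Φ pts * maxNorm Φ pts) := by
  set R := maxNorm Φ pts
  have hR : 0 ≤ R := maxNorm_nonneg
  have hsq : Real.sqrt (2 ^ Nat.clog 2 m / m) ≤ 2 := by
    refine Real.sqrt_le_iff.2 ⟨by norm_num, (two_pow_clog_div_le hm).trans (by norm_num)⟩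
  calc _ = ∑ s ∈ Finset.range W.card, (if h : s < W.card then
          (fun c => α c * eta Φ pts c * ‖Φ x‖ * Real.sqrt (2 ^ Nat.clog 2 m / m)) (e ⟨s, h⟩)
          else 0) := by
        refine Finset.sum_congr rfl fun s hs => ?_
        have hs := Finset.mem_range.1 hs
        simp only [termWeight, classificationMemory, dif_pos hs]
    _ = ∑ c ∈ W, α c * eta Φ pts c * ‖Φ x‖ * Real.sqrt (2 ^ Nat.clog 2 m / m) :=
        sum_range_card (G := fun c => α c * eta Φ pts c * ‖Φ x‖ *
          Real.sqrt (2 ^ Nat.clog 2 m / m)) e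
    _ ≤ ∑ c ∈ W, α c * R * R * 2 := by
        refine Finset.sum_le_sum fun c _ => ?_
        have := hα.1 c
        have := eta_le_maxNorm (Φ := Φ) (pts := pts) c
        have : 0 ≤ eta Φ pts c := Real.sqrt_nonneg _
        gcongr
    _ = (∑ c ∈ W, α c) * (R * R * 2) := by rw [Finset.sum_mul]; simp only [mul_assoc]
    _ ≤ C * (R * R * 2) := mul_le_mul_of_nonneg_right hα.2.2 (by positivity)
    _ = _ := by ring

lemma inner_decision_eq (hα : DualFeasible W C α) :
    inner ℝ (∑ c, α c • Psi Φ pts y c) (Φ x) =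
      ∑ c ∈ W, α c * inner ℝ (Psi Φ pts y c) (Φ x) := by
  rw [sum_inner]
  simp only [real_inner_smul_left]
  refine (Finset.sum_subset (Finset.subset_univ W) fun c _ hc => ?_).symm
  rw [hα.2.1 c hc, zero_mul]

/-- The bound that justifies the output zero if `C R ‖Φ(x)‖ ≤ ε`. -/
lemma abs_inner_decision_le (hy : ∀ i, y i = 1 ∨ y i = -1) (hα : DualFeasible W C α) :
    |inner ℝ (∑ c, α c • Psi Φ pts y c) (Φ x)| ≤ C * maxNorm Φ pts * ‖Φ x‖ := by
  rw [inner_decision_eq hα]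
  calc _ ≤ ∑ c ∈ W, |α c * inner ℝ (Psi Φ pts y c) (Φ x)| := Finset.abs_sum_le_sum_abs _ _
    _ ≤ ∑ c ∈ W, α c * (maxNorm Φ pts * ‖Φ x‖) := by
      refine Finset.sum_le_sum fun c _ => ?_
      rw [abs_mul, abs_of_nonneg (hα.1 c)]
      refine mul_le_mul_of_nonneg_left ((abs_real_inner_le_norm _ _).trans ?_) (hα.1 c)
      exact mul_le_mul_of_nonneg_right (norm_Psi_le_maxNorm hy c) (norm_nonneg _)
    _ = (∑ c ∈ W, α c) * (maxNorm Φ pts * ‖Φ x‖) := by rw [Finset.sum_mul]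
    _ ≤ C * (maxNorm Φ pts * ‖Φ x‖) :=
      mul_le_mul_of_nonneg_right hα.2.2 (mul_nonneg maxNorm_nonneg (norm_nonneg _))
    _ = _ := by ring

/-- The decision value is the weighted sum of the overlaps. -/
lemma sum_termWeight_mul (hm : 0 < m) (hx : Φ x ≠ 0) (hα : DualFeasible W C α)
    (hΨ : ∀ c ∈ W, Psi Φ pts y c ≠ 0) :
    ∑ s ∈ Finset.range W.card,
      termWeight (classificationMemory κ tmax Φ U TΦ pts W e α V x) m ‖Φ x‖ s *
        (if h : s < W.card then ∑ i, overlapTerm Φ pts y x (e ⟨s, h⟩) i else 0) =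
      inner ℝ (∑ c, α c • Psi Φ pts y c) (Φ x) := by
  rw [inner_decision_eq hα, ← sum_range_card e]
  refine Finset.sum_congr rfl fun s hs => ?_
  have hs := Finset.mem_range.1 hs
  simp only [termWeight, classificationMemory, dif_pos hs]
  rw [← mul_sum_overlapTerm hm hx (eta_ne_zero (hΨ _ (e ⟨s, hs⟩).2))]
  ring

end Classification

/-! ### The training run -/

section Training

variable {m : ℕ} {C ε : ℝ} {tmax : ℕ} {c₀ : Bits m} (T : TrainingRun m C ε tmax c₀)

lemma TrainingRun.dualFeasible : DualFeasible T.workingSet C T.alphaHat :=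
  (T.α_spec T.last T.one_le_last le_rfl).1

lemma TrainingRun.card_W_le {t : ℕ} (h1 : 1 ≤ t) (ht : t ≤ T.last) : (T.W t).card ≤ t := by
  induction t, h1 using Nat.le_induction with
  | base => simp [T.W_one]
  | succ t h1 ih =>
    rw [T.W_succ t h1 ht]
    exact (Finset.card_insert_le _ _).trans (Nat.succ_le_succ (ih (by omega)))

lemma TrainingRun.W_nonempty {t : ℕ} (h1 : 1 ≤ t) (ht : t ≤ T.last) : (T.W t).Nonempty := by
  induction t, h1 using Nat.le_induction with
  | base => simp [T.W_one]
  | succ t h1 ih =>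
    rw [T.W_succ t h1 ht]
    exact Finset.insert_nonempty _ _

lemma TrainingRun.last_le (h : 1 ≤ tmax) : T.last ≤ tmax := by
  rcases T.one_le_last.eq_or_lt with h1 | h1
  · omega
  · have := (T.continue_spec (T.last - 1) (by omega) (by omega)).2
    omega

lemma TrainingRun.card_workingSet_le (h : 1 ≤ tmax) : T.workingSet.card ≤ tmax :=
  (T.card_W_le T.one_le_last le_rfl).trans (T.last_le h)

lemma TrainingRun.workingSet_nonempty : T.workingSet.Nonempty :=
  T.W_nonempty T.one_le_last le_rfl

end Training

lemma psiMin_le {m n N : ℕ} {Φ : Bits n → Feature N} {pts : Fin m → Bits n} {y : Fin m → ℝ}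
    {W : Finset (Bits m)} {c : Bits m} (hc : c ∈ W) : psiMin Φ pts y W ≤ ‖Psi Φ pts y c‖ :=
  ciInf_le (Set.finite_range fun c : W => ‖Psi Φ pts y c‖).bddBelow ⟨c, hc⟩

/-! ### The running time -/

lemma half_le_log_inv {δ : ℝ} (hδ : 0 < δ) (hδ2 : δ ≤ 1 / 2) : 1 / 2 ≤ Real.log (1 / δ) := by
  have h : (2 : ℝ) ≤ 1 / δ := by rw [le_div_iff₀ hδ]; linarith
  have := Real.log_two_gt_d9
  have := Real.log_le_log (by norm_num) h
  linarith

lemma one_le_log_of_three_le {X : ℝ} (h : 3 ≤ X) : 1 ≤ Real.log X := by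
  rw [Real.le_log_iff_exp_le (by linarith)]
  have := Real.exp_one_lt_d9
  linarith

lemma log_two_mul_le {X Y : ℝ} (hY : 3 ≤ Y) (hX : 0 ≤ X) (h : X ≤ 2 * Y) :
    Real.log X ≤ 2 * Real.log Y := by
  rcases hX.eq_or_lt with rfl | hX
  · have := one_le_log_of_three_le hY
    simp only [Real.log_zero]
    linarith
  · have h1 := Real.log_le_log hX (h.trans (by nlinarith : 2 * Y ≤ Y ^ 2))
    rwa [Real.log_pow, Nat.cast_ofNat] at h1

/-- The number of trials is logarithmic. -/
lemma ceil_trials_le {S δ Y : ℝ} {w : ℕ} (hS : 1 ≤ S) (hδ : 0 < δ) (hδ2 : δ ≤ 1 / 2) (hw : 1 ≤ w)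
    (hY : 3 ≤ Y) (hSY : S ≤ 2 * Y) (hwY : w ≤ 2 * Y) :
    (⌈trials S δ w⌉₊ + 1 : ℝ) ≤ 2 * 10 ^ 7 * (Real.log Y * Real.log (1 / δ)) := by
  set L := Real.log Y
  set μ := Real.log (1 / δ) with hμ
  have hL : 1 ≤ L := one_le_log_of_three_le hY
  have hμ2 : 1 / 2 ≤ μ := half_le_log_inv hδ hδ2
  have hJ := rounds_nonneg hS
  have hw' : (1 : ℝ) ≤ w := by exact_mod_cast hw
  have h1 : Real.log w ≤ 2 * L := log_two_mul_le hY (by linarith) hwY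
  have h2 : Real.log (2 * S) ≤ 3 * L := by
    rw [Real.log_mul (by norm_num) (by linarith)]
    have := log_two_mul_le hY (by linarith) hSY
    have := Real.log_two_lt_d9
    linarith
  have h3 : rounds S ≤ 9 * L := by
    have hl : 1 / 3 ≤ Real.log (3 / 2) := by
      have := Real.one_sub_inv_le_log_of_pos (show (0 : ℝ) < 3 / 2 by norm_num)
      norm_num at this ⊢
      exact this
    unfold rounds
    rw [div_le_iff₀ log_three_halves_pos]
    nlinarith
  have h4 : Real.log (rounds S + 1) ≤ 9 * L := by
    have := Real.log_le_sub_one_of_pos (show 0 < rounds S + 1 by linarith)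
    linarith
  have h5 : Real.log (w * (rounds S + 1) / δ) ≤ 23 * (L * μ) := by
    rw [div_eq_mul_one_div, Real.log_mul (by positivity) (by positivity),
      Real.log_mul (by positivity) (by positivity), ← hμ]
    nlinarith
  have h6 : 0 ≤ trials S δ w := by
    unfold trials
    refine mul_nonneg (by norm_num) (Real.log_nonneg ?_)
    rw [le_div_iff₀ hδ]
    nlinarith
  have h7 := (Nat.ceil_lt_add_one h6).le
  have h8 : trials S δ w ≤ 746496 * (23 * (L * μ)) := by
    unfold trials
    exact mul_le_mul_of_nonneg_left h5 (by norm_num)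
  nlinarith

lemma natLog_le (k : ℕ) {Y : ℝ} (hY : 3 ≤ Y) (h : k ≤ 2 * Y) :
    (Nat.log 2 k : ℝ) ≤ 4 * Real.log Y := by
  have hL := one_le_log_of_three_le hY
  rcases Nat.eq_zero_or_pos k with rfl | hk
  · simp; linarith
  have h1 : (2 : ℝ) ^ Nat.log 2 k ≤ k := by exact_mod_cast Nat.pow_log_le_self 2 hk.ne'
  have h2 := Real.log_le_log (by positivity) h1
  rw [Real.log_pow] at h2
  have h3 := log_two_mul_le hY (Nat.cast_nonneg k) h
  have := Real.log_two_gt_d9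
  have : (0 : ℝ) ≤ Nat.log 2 k := Nat.cast_nonneg _
  nlinarith

/-- The time of the elementary operations is polylogarithmic in `m`, relative to `TΦ`. -/
lemma unit_le {κ m n N tmax TΦ : ℕ} (hT : 1 ≤ TΦ) (hnN : n + N ≤ TΦ) {Y : ℝ} (hY : 3 ≤ Y)
    (hm : (m + n + tmax : ℕ) ≤ 2 * Y) :
    (((1 + Nat.log 2 (m + n + tmax)) ^ κ + TΦ + Nat.clog 2 m + n + N + 1 : ℕ) : ℝ) ≤
      TΦ * ((5 ^ κ + 8) * Real.log Y ^ (κ + 1)) := by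
  set L := Real.log Y
  have hL : 1 ≤ L := one_le_log_of_three_le hY
  have hT' : (1 : ℝ) ≤ TΦ := by exact_mod_cast hT
  have hnN' : (n + N : ℝ) ≤ TΦ := by exact_mod_cast hnN
  have h1 : ((1 : ℝ) + Nat.log 2 (m + n + tmax)) ^ κ ≤ 5 ^ κ * L ^ κ := by
    rw [← mul_pow]
    have := natLog_le _ hY hm
    gcongr
    linarith
  have h2 : (Nat.clog 2 m : ℝ) ≤ 5 * L := by
    have hmY : (m : ℝ) ≤ 2 * Y := le_trans (by exact_mod_cast (by omega)) hm
    have h3 := natLog_le m hY hmY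
    have h4 : Nat.clog 2 m ≤ Nat.log 2 m + 1 :=
      Nat.clog_le_of_le_pow (Nat.lt_pow_succ_log_self (by norm_num) m).le
    have h5 : (Nat.clog 2 m : ℝ) ≤ Nat.log 2 m + 1 := by exact_mod_cast h4
    linarith
  have hLk : 1 ≤ L ^ κ := one_le_pow₀ hL
  have hL1 : L ≤ L ^ (κ + 1) := le_self_pow₀ hL (by omega)
  have hL2 : L ^ κ ≤ L ^ (κ + 1) := pow_le_pow_right₀ hL (by omega)
  have h5 : (0 : ℝ) ≤ 5 ^ κ := by positivity
  have h6 : (5 : ℝ) ^ κ * L ^ κ ≤ 5 ^ κ * L ^ (κ + 1) := by gcongr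
  have h7 : ((5 : ℝ) ^ κ + 8) * L ^ (κ + 1) ≥ 0 := by positivity
  have h8 : (5 : ℝ) ^ κ * L ^ κ + 5 * L ≤ TΦ * (5 ^ κ * L ^ (κ + 1) + 5 * L ^ (κ + 1)) := by
    have : (0 : ℝ) ≤ 5 ^ κ * L ^ (κ + 1) + 5 * L ^ (κ + 1) := by positivity
    nlinarith
  have h9 : (3 : ℝ) * TΦ ≤ TΦ * (3 * L ^ (κ + 1)) := by nlinarith
  push_cast
  calc _ ≤ 5 ^ κ * L ^ κ + TΦ + 5 * L + TΦ + TΦ := by linarith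
    _ ≤ TΦ * (5 ^ κ * L ^ (κ + 1) + 5 * L ^ (κ + 1)) + TΦ * (3 * L ^ (κ + 1)) := by linarith
    _ = _ := by ring

/-- The main term dominates the product of the number of terms, of the order `S` of the number of
amplification steps, of `log (1 / δ)` and of the time of the feature map, since `Ψ ≤ R`. -/
lemma le_mainTerm {C R δ Ψ ε S : ℝ} {tmax TΦ : ℕ} (hC : 0 < C) (hε : 0 < ε) (hδ : 0 < δ)
    (hδ2 : δ ≤ 1 / 2) (hΨ : 0 < Ψ) (hΨR : Ψ ≤ R) (hS : S = C * R * R / ε) :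
    S * Real.log (1 / δ) * tmax * TΦ ≤ mainTerm C R δ Ψ ε tmax TΦ := by
  have hR : 0 < R := hΨ.trans_le hΨR
  have hμ := half_le_log_inv hδ hδ2
  have e : mainTerm C R δ Ψ ε tmax TΦ = R / Ψ * (S * Real.log (1 / δ) * tmax * TΦ) := by
    unfold mainTerm; rw [hS]; field_simp
  rw [e]
  refine le_mul_of_one_le_left ?_ ((one_le_div hΨ).2 hΨR)
  have : 0 ≤ S := by rw [hS]; positivity
  positivity

/-- The time bound. Apart from factors that are polylogarithmic in `Y = 3 + m + n + f`, the time is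
at most `w · S · log (1 / δ) · TΦ`, which is at most `f`. -/
lemma total_time_le {κ m n N tmax TΦ w : ℕ} {C R δ Ψ ε S f : ℝ} (hT : 1 ≤ TΦ) (hnN : n + N ≤ TΦ)
    (hw : 1 ≤ w) (hwt : w ≤ tmax) (hC : 0 < C) (hε : 0 < ε) (hδ : 0 < δ) (hδ2 : δ ≤ 1 / 2)
    (hΨ : 0 < Ψ) (hΨR : Ψ ≤ R) (hS : S = C * R * R / ε) (hS1 : 1 ≤ S)
    (hf : f = mainTerm C R δ Ψ ε tmax TΦ) :
    100 + w * (4100 * (((1 + Nat.log 2 (m + n + tmax)) ^ κ + TΦ + Nat.clog 2 m + n + N + 1 : ℕ) : ℝ)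
      * (⌈trials S δ w⌉₊ + 1) * (3 / 2) ^ ⌈rounds S⌉₊) ≤
      (10 ^ 12 * (5 ^ κ + 8)) * (1 + f) * Real.log (3 + m + n + f) ^ (κ + 2) := by
  set μ := Real.log (1 / δ)
  set Y := 3 + (m : ℝ) + n + f with hY
  have hμ : 1 / 2 ≤ μ := half_le_log_inv hδ hδ2
  have hA : S * μ * tmax * TΦ ≤ f := by
    rw [hf]; exact le_mainTerm hC hε hδ hδ2 hΨ hΨR hS
  have hT' : (1 : ℝ) ≤ TΦ := by exact_mod_cast hT
  have hw' : (1 : ℝ) ≤ w := by exact_mod_cast hw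
  have hwt' : (w : ℝ) ≤ tmax := by exact_mod_cast hwt
  have ht' : (1 : ℝ) ≤ tmax := hw'.trans hwt'
  have htT : (1 : ℝ) ≤ tmax * TΦ := one_le_mul_of_one_le_of_one_le ht' hT'
  have hS2 : S ≤ 2 * f := by
    have h1 : S * (1 / 2) * 1 ≤ S * μ * (tmax * TΦ) := by gcongr
    rw [← mul_assoc] at h1
    linarith
  have ht2 : (tmax : ℝ) ≤ 2 * f := by
    have h1 : 1 * (1 / 2) * (tmax * 1) ≤ S * μ * (tmax * TΦ) := by gcongr
    rw [← mul_assoc] at h1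
    linarith
  have hf0 : 0 ≤ f := by linarith
  have hm0 : (0 : ℝ) ≤ m := Nat.cast_nonneg _
  have hn0 : (0 : ℝ) ≤ n := Nat.cast_nonneg _
  have hY3 : 3 ≤ Y := by linarith
  have h1 := ceil_trials_le hS1 hδ hδ2 hw hY3 (by linarith) (by linarith)
  have h2 := unit_le (κ := κ) (m := m) (tmax := tmax) hT hnN hY3 (by push_cast; linarith)
  have h3 := three_halves_pow_le hS1
  set u := (((1 + Nat.log 2 (m + n + tmax)) ^ κ + TΦ + Nat.clog 2 m + n + N + 1 : ℕ) : ℝ) with hu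
  have hu0 : 0 ≤ u := Nat.cast_nonneg _
  set L := Real.log Y
  have hL : 1 ≤ L := one_le_log_of_three_le hY3
  have hLk : 1 ≤ L ^ (κ + 2) := one_le_pow₀ hL
  have hK : (0 : ℝ) ≤ 5 ^ κ := by positivity
  calc 100 + w * (4100 * u * (⌈trials S δ w⌉₊ + 1) * (3 / 2) ^ ⌈rounds S⌉₊)
      ≤ 100 + tmax * (4100 * (TΦ * ((5 ^ κ + 8) * L ^ (κ + 1))) * (2 * 10 ^ 7 * (L * μ)) *
          (3 * S)) := by gcongr
    _ = 100 + (246 * 10 ^ 9 * (5 ^ κ + 8)) * (S * μ * tmax * TΦ) * L ^ (κ + 2) := by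
        rw [show κ + 2 = κ + 1 + 1 from rfl, pow_succ L (κ + 1)]; ring
    _ ≤ 100 * L ^ (κ + 2) + (246 * 10 ^ 9 * (5 ^ κ + 8)) * f * L ^ (κ + 2) := by
        gcongr
        linarith
    _ = (100 + (246 * 10 ^ 9 * (5 ^ κ + 8)) * f) * L ^ (κ + 2) := by ring
    _ ≤ _ := by
        refine mul_le_mul_of_nonneg_right ?_ (by positivity)
        have : 0 ≤ 5 ^ κ * f := by positivity
        nlinarith

end

end QSVM

theorem mainTheorem3 :
    -- one algorithm for all instances
    ∃ P : QSVM.Algorithm,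
    -- the exponent of the polylogarithmic access time of the qRAM
    ∀ κ : ℕ,
    ∃ (K : ℝ) (k : ℕ),
    -- the quantum feature map, with running time `TΦ`
    ∀ (n N : ℕ) (Φ : QSVM.Bits n → QSVM.Feature N)
      (U : Matrix (Fin n ⊕ Fin N → Bool) (Fin n ⊕ Fin N → Bool) ℂ)
      (_ : QSVM.IsFeatureMap U Φ)
      (TΦ : ℕ) (_ : 1 ≤ TΦ) (_ : n + N ≤ TΦ)
    -- the training set
      (m : ℕ) (pts : Fin m → QSVM.Bits n) (y : Fin m → ℝ) (_ : ∀ i, y i = 1 ∨ y i = -1)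
    -- the training run
      (C : ℝ) (_ : 0 < C) (ε₀ : ℝ) (_ : 0 < ε₀) (tmax : ℕ) (_ : 1 ≤ tmax) (c₀ : QSVM.Bits m)
      (T : QSVM.TrainingRun m C ε₀ tmax c₀)
      (_ : 0 < QSVM.psiMin Φ pts y T.workingSet)
    -- the qRAM
      (e : Fin T.workingSet.card ≃ T.workingSet)
      (V : Fin T.workingSet.card →
        Matrix (QSVM.Bits (Nat.clog 2 m)) (QSVM.Bits (Nat.clog 2 m)) ℂ)
      (_ : ∀ s, QSVM.IsStatePrep Φ pts y (V s) (e s))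
    -- the new point
      (x : QSVM.Bits n) (_ : ‖Φ x‖ ≤ QSVM.maxNorm Φ pts)
    -- accuracy and failure probability
      (ε : ℝ) (_ : 0 < ε) (δ : ℝ) (_ : 0 < δ) (_ : δ ≤ 1 / 2),
      let M := QSVM.classificationMemory κ tmax Φ U TΦ pts T.workingSet e T.alphaHat V x
      let R := QSVM.maxNorm Φ pts
      let f := QSVM.mainTerm C R δ (QSVM.psiMin Φ pts y T.workingSet) ε tmax TΦ
      let a := [m, Nat.clog 2 m, n, N, T.workingSet.card, tmax]
      let r := [C, R, ε, δ, ‖Φ x‖]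
      1 - δ ≤ P.prob M a r
          (fun out => |out - inner ℝ (∑ c, T.alphaHat c • QSVM.Psi Φ pts y c) (Φ x)| ≤ ε) ∧
        P.TimeLE M a r (K * (1 + f) * Real.log (3 + m + n + f) ^ k) := by
  refine ⟨QSVM.classifier, fun κ => ⟨10 ^ 12 * (5 ^ κ + 8), κ + 2, ?_⟩⟩
  intro n N Φ U hU TΦ hT hnN m pts y hy C hC ε₀ _ tmax htmax c₀ T hΨ e V hV x hxR ε hε δ hδ hδ2
    M R f a r
  have hα := T.dualFeasible
  have hM : M.IsUnitary := QSVM.classificationMemory_isUnitary hU hV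
  obtain ⟨c₁, hc₁⟩ := T.workingSet_nonempty
  have hw : 1 ≤ T.workingSet.card := Finset.card_pos.2 ⟨c₁, hc₁⟩
  have hΨR : QSVM.psiMin Φ pts y T.workingSet ≤ R :=
    (QSVM.psiMin_le hc₁).trans (QSVM.norm_Psi_le_maxNorm hy c₁)
  have hR : 0 < R := hΨ.trans_le hΨR
  have hΨ0 : ∀ c ∈ T.workingSet, QSVM.Psi Φ pts y c ≠ 0 := fun c hc =>
    norm_pos_iff.1 (hΨ.trans_le (QSVM.psiMin_le hc))
  have hm : 0 < m := by
    rcases Nat.eq_zero_or_pos m with rfl | h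
    · exact absurd (by simp [QSVM.Psi]) (hΨ0 c₁ hc₁)
    · exact h
  have hmain := QSVM.le_mainTerm (tmax := tmax) (TΦ := TΦ) hC hε hδ hδ2 hΨ hΨR rfl
  by_cases hle : C * R * ‖Φ x‖ ≤ ε
  -- zero is an accurate output
  · have h := QSVM.triple_classify_of_le (M := M)
      ({ nat := fun i => a.getD i 0
         real := fun i => r.getD i 0
         amp := Pi.single (fun _ => false) 1
         time := 0 } : QSVM.Config (QSVM.classifier.qubits.eval fun i => a.getD i 0))
      (by simpa [r] using hle)
      (t := inner ℝ (∑ c, T.alphaHat c • QSVM.Psi Φ pts y c) (Φ x))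
      (by simpa [r] using QSVM.abs_inner_decision_le hy hα)
    refine ⟨?_, fun c' hc' _ => (h.1 c' hc').trans ?_⟩
    · have := QSVM.classifier.le_prob_of_triple hM a r h
      rw [sub_zero] at this
      exact le_trans (by linarith) this
    · have hf : 0 ≤ f := by
        refine le_trans ?_ hmain
        have := QSVM.half_le_log_inv hδ hδ2
        positivity
      have hL : 1 ≤ Real.log (3 + m + n + f) := by
        refine QSVM.one_le_log_of_three_le ?_
        have : (0 : ℝ) ≤ m := Nat.cast_nonneg _
        have : (0 : ℝ) ≤ n := Nat.cast_nonneg _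
        linarith
      have h1 : (1 : ℝ) ≤ (1 + f) * Real.log (3 + m + n + f) ^ (κ + 2) :=
        one_le_mul_of_one_le_of_one_le (by linarith) (one_le_pow₀ hL)
      have h5 : (0 : ℝ) ≤ 5 ^ κ := by positivity
      rw [mul_assoc]
      simp only [Nat.cast_zero, zero_add]
      nlinarith
  -- otherwise the feature state of the new point exists, and `S = C R² / ε` is at least one
  · have hlt := not_le.1 hle
    have hx : Φ x ≠ 0 := by
      intro h0
      rw [h0, norm_zero, mul_zero] at hlt
      exact absurd hε (not_lt.2 hlt.le)
    obtain ⟨S, hS⟩ : ∃ S, S = C * R * R / ε := ⟨_, rfl⟩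
    have hS1 : 1 ≤ S := by
      rw [hS, one_le_div hε]
      exact hlt.le.trans (mul_le_mul_of_nonneg_left hxR (by positivity))
    have h := QSVM.triple_classify_of_lt hM (QSVM.classificationMemory_keepsPoint hU hx) rfl
      ({ nat := fun i => a.getD i 0
         real := fun i => r.getD i 0
         amp := Pi.single (fun _ => false) 1
         time := 0 } : QSVM.Config (QSVM.classifier.qubits.eval fun i => a.getD i 0))
      ⟨rfl, rfl, rfl, rfl⟩ rfl rfl
      (a := fun s => if h : s < T.workingSet.card then
        ∑ i, QSVM.overlapTerm Φ pts y x (e ⟨s, h⟩) i else 0)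
      (fun s hs => by
        have hs' : s < T.workingSet.card := hs
        rw [dif_pos hs']
        exact QSVM.overlap_classificationMemory hU hV hx ⟨s, hs'⟩)
      (fun s => by
        change 0 ≤ dite _ _ _
        split_ifs
        · exact hα.1 _
        · exact le_rfl)
      (fun s => by
        change 0 ≤ dite _ _ _
        split_ifs
        · exact Real.sqrt_nonneg _
        · exact le_rfl)
      (norm_nonneg (Φ x)) hlt hS
    refine ⟨?_, fun c' hc' _ => (h.1 c' hc').trans ?_⟩
    · have hv := QSVM.failure_le hS1 hδ hw
      refine (sub_le_sub_left hv 1).trans (QSVM.classifier.le_prob_of_triple (ε := ε) hM a r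
        (h.mono (fun _ hc' => hc') (fun c' _ => ?_) le_rfl))
      have hβ := QSVM.sum_termWeight_le (κ := κ) (tmax := tmax) (TΦ := TΦ) (U := U) (e := e)
        (V := V) hm hα hxR
      have ht := QSVM.sum_termWeight_mul (κ := κ) (tmax := tmax) (TΦ := TΦ) (U := U) (e := e)
        (V := V) hm hx hα hΨ0
      have hC2 : C * R * R = S * ε := by rw [hS]; field_simp
      have hacc : (2 / 3 : ℝ) ^ ⌈QSVM.rounds S⌉₊ * ∑ s ∈ Finset.range T.workingSet.card,
          QSVM.termWeight M m ‖Φ x‖ s ≤ ε := by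
        have h23 := QSVM.two_thirds_pow_mul_le hS1
        calc _ ≤ (2 / 3 : ℝ) ^ ⌈QSVM.rounds S⌉₊ * (2 * (S * ε)) := by
              rw [← hC2]
              exact mul_le_mul_of_nonneg_left hβ (by positivity)
          _ = (2 / 3 : ℝ) ^ ⌈QSVM.rounds S⌉₊ * (2 * S) * ε := by ring
          _ ≤ 1 * ε := mul_le_mul_of_nonneg_right h23 hε.le
          _ = ε := one_mul ε
      rw [← ht]
      exact QSVM.exceeds_mono_right hacc
    · have := QSVM.total_time_le (κ := κ) (m := m) (n := n) (N := N) (f := f) hT hnN hw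
        (T.card_workingSet_le htmax) hC hε hδ hδ2 hΨ hΨR hS hS1 rfl
      refine le_trans (le_of_eq ?_) this
      simp only [Nat.cast_zero, zero_add]
      rfl
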